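/- Let $n\ge 1$, $G=GL(n,\mathbb C)$, $\mathfrak g=\mathfrak{gl}(n,\mathbb C)$, let $\theta$ be conjugation by $c=\mathrm{diag}(1,\dots,1,-1)$ on $G$ and on $\mathfrak g$, and let $K=G^\theta=GL(n-1,\mathbb C)\times GL(1,\mathbb C)$ (block diagonal matrices). Let $\mathcal B_n$ be the variety of Borel subalgebras of $\mathfrak g$, with its Zariski topology, on which $K$ acts by $\mathrm{Ad}$, and let $\mathcal B_K$ be the flag variety of $K$. Let $e_1,\dots,e_n$ be the standard basis of $\mathbb C^n$ and write $(v_1\subset\dots\subset v_n)$ for the flag of the subspaces $\mathrm{span}\{v_1,\dots,v_k\}$. For $1\le i\le n$ let $Q_i=K\cdot\mathfrak b_i$, where $\mathfrak b_i$ is the stabilizer of the flag $$(e_1\subset\dots\subset e_{i-1}\subset \underbrace{e_n}_{i}\subset e_i\subset\dots\subset e_{n-1}),$$ and for $1\le i<j\le n$ let $Q_{i,j}=K\cdot\mathfrak b_{i,j}$, where $\mathfrak b_{i,j}$ is the stabilizer of the flag $$(e_1\subset\dots\subset e_{i-1}\subset\underbrace{e_i+e_n}_{i}\subset e_{i+1}\subset\dots\subset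 e_{j-1}\subset\underbrace{e_i}_{j}\subset e_j\subset\dots\subset e_{n-1}).$$ Let $\mathfrak b_0$ be the upper triangular matrices, $B_0\subset G$ the Borel subgroup with Lie algebra $\mathfrak b_0$, $T_0\subset G$ the diagonal torus, $\mathfrak t_0$ its Lie algebra, with $\epsilon_k$ the $k$-th diagonal entry, $N=N_G(T_0)$ and $W=N/T_0\cong S_n$. An element $v\in G$ with $\tau(v):=v^{-1}\theta(v)\in N$ is called a representative of the orbit $Q=K\cdot\mathrm{Ad}(v)\mathfrak b_0$. The Springer invariant of $Q$ is $\tau(v)T_0\in W$; put $\theta_v=\mathrm{Ad}(v^{-1})\circ\theta\circ\mathrm{Ad}(v)$, an involution of $\mathfrak g$ that preserves $\mathfrak t_0$. A root $\alpha$ of $(\mathfrak g,\mathfrak t_0)$, with root vector $x_\alpha$, is imaginary for $Q$ if $\theta_v(\alpha)=\alpha$, and non-compact imaginary if moreover $\theta_v(x_\alpha)=-x_\alpha$; it is complex $\theta$-stable if $\theta_v(\alpha)\ne\pm\alpha$ and $\alpha$, $\theta_v(\alpha)$ are both positive. That these notions are the same for all representatives $v$ of $Q$ is part of the assertions below. The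 length of $Q$ is $l(Q)=\dim Q-\dim\mathcal B_K$. For the simple root $\alpha_k=\epsilon_k-\epsilon_{k+1}$, let $P_{\alpha_k}\supset B_0$ be the minimal parabolic subgroup, $\pi_k:\mathcal B_n\cong G/B_0\to G/P_{\alpha_k}$ the projection, and $m(s_k)\cdot Q$ the unique open $K$-orbit in $\pi_k^{-1}\pi_k(Q)$. Then the following hold. 1. The $K$-orbits on $\mathcal B_n$ are exactly the $Q_i$ ($1\le i\le n$) and the $Q_{i,j}$ ($1\le i<j\le n$), and these are all distinct. The closed orbits are exactly the $n$ orbits $Q_i$. 2. For all $1\le i<j\le n$: (a) $Q_{i,j}=m(s_{j-1})\cdots m(s_i)\cdot Q_i$ and $l(Q_{i,j})=j-i$; moreover $m(s_{i-1})\cdot Q_{i,j}=Q_{i-1,j}$ if $i\ge 2$. (b) The Springer invariant of $Q_{i,j}$ is the transposition $(i\ j)$, and for every representative $v$ of $Q_{i,j}$ the involution $\theta_v$ acts on the roots as $(i\ j)$. The element $(n\ n-1\ \cdots\ i)\,u_{\alpha_i}\,\dot s_{i+1}\cdots\dot s_{j-1}$ is a representative, where permutations stand for their permutation matrices ($\sigma$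 maps $e_k$ to $e_{\sigma(k)}$), $\dot s_k$ is the permutation matrix of $(k\ k+1)$, and $u_{\alpha_i}$ is $\frac1{\sqrt2}\begin{pmatrix}1&\imath\\ \imath&1\end{pmatrix}$ in rows and columns $i,i+1$ and the identity elsewhere. (c) The complex $\theta$-stable simple roots for $Q_{i,j}$ are exactly $\alpha_{i-1}$ and $\alpha_j$ (those of them that exist, i.e. $i\ge2$, respectively $j\le n-1$), and $Q_{i,j}$ has no non-compact imaginary roots. 3. If $n\ge2$, then $Q_{1,n}$ is the unique open $K$-orbit on $\mathcal B_n$. -/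

import Mathlib

noncomputable section

namespace KOrb

open Matrix

attribute [local instance] LieRing.ofAssociativeRing

/-! ### Borel subalgebras and the Zariski topology on a flag variety -/

/-- The Borel subalgebras of a complex Lie algebra `L`: the maximal solvable subalgebras. -/
def BorelSubalgebra (L : Type*) [LieRing L] [LieAlgebra ℂ L] : Type _ :=
  {b : LieSubalgebra ℂ L // Maximal (fun s : LieSubalgebra ℂ L => LieAlgebra.IsSolvable s) b}

theorem isSolvable_map {L : Type*} [LieRing L] [LieAlgebra ℂ L] (e : L ≃ₗ⁅ℂ⁆ L)
    (s : LieSubalgebra ℂ L) (hs : LieAlgebra.IsSolvable s) :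
    LieAlgebra.IsSolvable (s.map (e : L →ₗ⁅ℂ⁆ L)) :=
  (LieAlgebra.solvable_iff_equiv_solvable (R := ℂ) (e.lieSubalgebraMap s)).1 hs

theorem map_map_symm {L : Type*} [LieRing L] [LieAlgebra ℂ L] (e : L ≃ₗ⁅ℂ⁆ L)
    (s : LieSubalgebra ℂ L) :
    (s.map (e.symm : L →ₗ⁅ℂ⁆ L)).map (e : L →ₗ⁅ℂ⁆ L) = s := by
  ext x
  simp [LieSubalgebra.mem_map]

/-- An automorphism of a Lie algebra acts on its Borel subalgebras. -/
def BorelSubalgebra.map {L : Type*} [LieRing L] [LieAlgebra ℂ L] (e : L ≃ₗ⁅ℂ⁆ L)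
    (b : BorelSubalgebra L) : BorelSubalgebra L :=
  ⟨b.1.map (e : L →ₗ⁅ℂ⁆ L), isSolvable_map e _ b.2.1, by
    intro s hs hbs
    have h1 : b.1 ≤ s.map (e.symm : L →ₗ⁅ℂ⁆ L) := by
      intro x hx
      refine (LieSubalgebra.mem_map _ _ _).2 ⟨e x, hbs ((LieSubalgebra.mem_map _ _ _).2 ⟨x, hx, rfl⟩), ?_⟩
      simp
    have h2 := b.2.2 (isSolvable_map e.symm s hs) h1
    have h3 := (LieSubalgebra.gc_map_comap (f := (e : L →ₗ⁅ℂ⁆ L))).monotone_l h2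
    rwa [map_map_symm] at h3⟩

/-- The Zariski topology on the variety of Borel subalgebras, for a group `H` with a (Zariski)
topology acting on `L` through `Ad`: the quotient topology of the orbit maps `h ↦ Ad(h) b`,
that is, the topology carried over from `H / B`. A set is open if and only if its
preimages under all the orbit maps are open. -/
@[reducible] def flagTopology {L : Type*} [LieRing L] [LieAlgebra ℂ L] {H : Type*} (t : TopologicalSpace H)
    (Ad : H → (L ≃ₗ⁅ℂ⁆ L)) : TopologicalSpace (BorelSubalgebra L) :=
  ⨆ b : BorelSubalgebra L, TopologicalSpace.coinduced (fun h => b.map (Ad h)) t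

/-! ### The groups `G = GL(n, ℂ)` and `K = GL(n-1, ℂ) × GL(1, ℂ)`

Indices in `Fin n` start at `0`; the index `i` of the usual numbering `1, …, n` is the element
of `Fin n` with value `i - 1`. -/

/-- The group `G`. -/
abbrev G (n : ℕ) : Type := GL (Fin n) ℂ

/-- The Lie algebra `𝔤 = 𝔤𝔩(n, ℂ)`. -/
abbrev 𝔤 (n : ℕ) : Type := Matrix (Fin n) (Fin n) ℂ

/-- The Zariski topology on `G`, generated by the non-vanishing loci of polynomials in the
matrix entries. -/
@[reducible] def zariski (n : ℕ) : TopologicalSpace (G n) :=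
  TopologicalSpace.generateFrom
    {U | ∃ p : MvPolynomial (Fin n × Fin n) ℂ,
      U = {g : G n | MvPolynomial.eval (fun q => (g : 𝔤 n) q.1 q.2) p ≠ 0}}

/-- The adjoint action `Ad(g) x = g x g⁻¹`. -/
def Ad {n : ℕ} (g : G n) : 𝔤 n ≃ₗ⁅ℂ⁆ 𝔤 n := Matrix.lieConj (g : 𝔤 n) g.invertible

theorem Ad_apply {n : ℕ} (g : G n) (x : 𝔤 n) :
    Ad g x = (g : 𝔤 n) * x * ((g⁻¹ : G n) : 𝔤 n) := by
  simp [Ad]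

/-- The element `c = diag(1, …, 1, -1)`. -/
def c (n : ℕ) : G n :=
  ⟨diagonal fun k => if k.val + 1 = n then -1 else 1,
   diagonal fun k => if k.val + 1 = n then -1 else 1,
   by rw [diagonal_mul_diagonal, ← diagonal_one]; congr 1; ext k; split_ifs <;> simp,
   by rw [diagonal_mul_diagonal, ← diagonal_one]; congr 1; ext k; split_ifs <;> simp⟩

/-- The involution `θ` on `G`, conjugation by `c`. -/
def θ (n : ℕ) : G n ≃* G n := MulAut.conj (c n)

/-- The involution `θ` on `𝔤`. -/
def dθ (n : ℕ) : 𝔤 n ≃ₗ⁅ℂ⁆ 𝔤 n := Ad (c n)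

/-- The group `K = G^θ`. -/
def K (n : ℕ) : Subgroup (G n) := (θ n : G n →* G n).eqLocus (MonoidHom.id (G n))

/-- The entries of `c x c⁻¹`. -/
theorem dθ_entry {n : ℕ} (x : 𝔤 n) (a b : Fin n) :
    dθ n x a b = (if a.val + 1 = n then -1 else 1) * x a b * (if b.val + 1 = n then -1 else 1) := by
  rw [dθ, Ad_apply]
  have : ((c n)⁻¹ : G n) = c n := rfl
  rw [this]
  simp [c, Matrix.mul_diagonal, Matrix.diagonal_mul]

/-- `K` consists of the block diagonal matrices with blocks of size `n - 1` and `1`, so that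
`K = GL(n-1, ℂ) × GL(1, ℂ)`. -/
theorem mem_K_iff {n : ℕ} (g : G n) :
    g ∈ K n ↔ ∀ a b : Fin n, (a.val + 1 = n ↔ ¬ b.val + 1 = n) → (g : 𝔤 n) a b = 0 := by
  have h1 : g ∈ K n ↔ dθ n (g : 𝔤 n) = (g : 𝔤 n) := by
    rw [dθ, Ad_apply]
    constructor
    · intro h
      exact congrArg (fun u : G n => (u : 𝔤 n)) (show θ n g = g from h)
    · intro h
      exact show θ n g = g from Units.ext h
  rw [h1, ← Matrix.ext_iff]
  refine forall₂_congr fun a b => ?_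
  rw [dθ_entry]
  by_cases ha : a.val + 1 = n <;> by_cases hb : b.val + 1 = n <;>
    simp [ha, hb, neg_eq_iff_add_eq_zero, ← two_mul]

/-- The Lie algebra `𝔨 = 𝔤^θ` of `K`. -/
def 𝔨 (n : ℕ) : LieSubalgebra ℂ (𝔤 n) where
  carrier := {x | dθ n x = x}
  add_mem' := by
    intro x y (hx : dθ n x = x) (hy : dθ n y = y)
    change dθ n (x + y) = x + y
    rw [map_add, hx, hy]
  zero_mem' := map_zero (dθ n)
  smul_mem' := by
    intro a x (hx : dθ n x = x)
    change dθ n (a • x) = a • x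
    rw [map_smul, hx]
  lie_mem' := by
    intro x y (hx : dθ n x = x) (hy : dθ n y = y)
    change dθ n ⁅x, y⁆ = ⁅x, y⁆
    rw [LieEquiv.map_lie, hx, hy]

theorem map_Ad_le {n : ℕ} (k : K n) : (𝔨 n).map (Ad (k : G n) : 𝔤 n →ₗ⁅ℂ⁆ 𝔤 n) ≤ 𝔨 n := by
  intro y hy
  obtain ⟨x, hx, rfl⟩ := (LieSubalgebra.mem_map _ _ _).1 hy
  have hx' : dθ n x = x := hx
  have hk : c n * (k : G n) * (c n)⁻¹ = k := k.2
  have hk2 : c n * (k : G n) = k * c n := by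
    rw [← mul_inv_eq_iff_eq_mul]; exact hk
  change dθ n (Ad (k : G n) x) = Ad (k : G n) x
  have hmul : ∀ (g h : G n) (z : 𝔤 n), Ad g (Ad h z) = Ad (g * h) z := by
    intro g h z
    simp only [Ad_apply, _root_.mul_inv_rev, Units.val_mul, Matrix.mul_assoc]
  calc dθ n (Ad (k : G n) x) = Ad (c n) (Ad (k : G n) x) := rfl
    _ = Ad (k : G n) (Ad (c n) x) := by rw [hmul, hmul, hk2]
    _ = Ad (k : G n) x := by rw [show Ad (c n) x = x from hx']

theorem map_Ad_eq {n : ℕ} (k : K n) : (𝔨 n).map (Ad (k : G n) : 𝔤 n →ₗ⁅ℂ⁆ 𝔤 n) = 𝔨 n := by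
  refine le_antisymm (map_Ad_le k) fun x hx => ?_
  refine (LieSubalgebra.mem_map _ _ _).2 ⟨Ad ((k⁻¹ : K n) : G n) x,
    map_Ad_le k⁻¹ ((LieSubalgebra.mem_map _ _ _).2 ⟨x, hx, rfl⟩), ?_⟩
  change Ad (k : G n) (Ad ((k⁻¹ : K n) : G n) x) = x
  simp [Ad_apply, Matrix.mul_assoc]

/-- The adjoint action of `K` on `𝔨`. -/
def AdK {n : ℕ} (k : K n) : 𝔨 n ≃ₗ⁅ℂ⁆ 𝔨 n :=
  LieEquiv.ofSubalgebras (𝔨 n) (𝔨 n) (Ad (k : G n)) (map_Ad_eq k)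

/-- The flag variety `𝓑` of `𝔤𝔩(n, ℂ)`. -/
abbrev 𝓑 (n : ℕ) : Type := BorelSubalgebra (𝔤 n)

instance (n : ℕ) : TopologicalSpace (𝓑 n) := flagTopology (zariski n) Ad

/-- The flag variety of `K`. -/
def 𝓑K (n : ℕ) : Type := BorelSubalgebra (𝔨 n)

instance (n : ℕ) : TopologicalSpace (𝓑K n) :=
  flagTopology (TopologicalSpace.induced Subtype.val (zariski n)) (AdK (n := n))

/-! ### `K`-orbits on the flag variety -/

/-- `Ad(g) 𝔟` for a subalgebra `𝔟` of `𝔤`. -/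
def AdSub {n : ℕ} (g : G n) (b : LieSubalgebra ℂ (𝔤 n)) : LieSubalgebra ℂ (𝔤 n) :=
  b.map (Ad g : 𝔤 n →ₗ⁅ℂ⁆ 𝔤 n)

/-- The orbit `K · 𝔟` in the flag variety. -/
def orbit {n : ℕ} (b : LieSubalgebra ℂ (𝔤 n)) : Set (𝓑 n) :=
  {x | ∃ k ∈ K n, x.1 = AdSub k b}

/-- `Q` is a `K`-orbit on the flag variety. -/
def IsKOrbit {n : ℕ} (Q : Set (𝓑 n)) : Prop := ∃ x : 𝓑 n, Q = orbit x.1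

/-- The length `l(Q) = dim Q - dim 𝓑_K`; dimensions are those of the Zariski topology. -/
def HasLength {n : ℕ} (Q : Set (𝓑 n)) (l : ℤ) : Prop :=
  ∃ d e : ℕ, topologicalKrullDim Q = (d : WithBot ℕ∞) ∧
    topologicalKrullDim (𝓑K n) = (e : WithBot ℕ∞) ∧ (d : ℤ) - e = l

/-- The stabilizer in `𝔤` of the flag `span {v 0} ⊆ span {v 0, v 1} ⊆ ⋯`. -/
def flagStabilizer {n : ℕ} (v : Fin n → (Fin n → ℂ)) : LieSubalgebra ℂ (𝔤 n) where
  carrier := {x | ∀ k : Fin n, ∀ w ∈ Submodule.span ℂ (v '' Set.Iic k),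
    x *ᵥ w ∈ Submodule.span ℂ (v '' Set.Iic k)}
  add_mem' := by
    intro x y hx hy k w hw
    rw [Matrix.add_mulVec]
    exact add_mem (hx k w hw) (hy k w hw)
  zero_mem' := by
    intro k w _
    rw [Matrix.zero_mulVec]
    exact zero_mem _
  smul_mem' := by
    intro a x hx k w hw
    rw [Matrix.smul_mulVec]
    exact Submodule.smul_mem _ _ (hx k w hw)
  lie_mem' := by
    intro x y hx hy k w hw
    rw [Ring.lie_def, Matrix.sub_mulVec, ← Matrix.mulVec_mulVec, ← Matrix.mulVec_mulVec]
    exact sub_mem (hx k _ (hy k w hw)) (hy k _ (hx k w hw))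

/-- The standard basis vector of `ℂⁿ` whose `1` is in position `k`, positions starting at `0`. -/
def e (n k : ℕ) : Fin n → ℂ := fun r => if r.val = k then 1 else 0

/-- The flag `𝓕_i = (e₁ ⊂ ⋯ ⊂ e_{i-1} ⊂ e_n ⊂ e_i ⊂ ⋯ ⊂ e_{n-1})`, with `e_n` in position `i`. -/
def flagC {n : ℕ} (i : Fin n) (k : Fin n) : Fin n → ℂ :=
  if k < i then e n k else if k = i then e n (n - 1) else e n (k - 1)

/-- The flag `𝓕_{i,j} = (e₁ ⊂ ⋯ ⊂ e_i + e_n ⊂ e_{i+1} ⊂ ⋯ ⊂ e_{j-1} ⊂ e_i ⊂ e_j ⊂ ⋯ ⊂ e_{n-1})`,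
for `i < j`, with `e_i + e_n` in position `i` and `e_i` in position `j`. -/
def flagO {n : ℕ} (i j : Fin n) (k : Fin n) : Fin n → ℂ :=
  if k < i then e n k
  else if k = i then e n i + e n (n - 1)
  else if k < j then e n k
  else if k = j then e n i
  else e n (k - 1)

/-- The orbit `Q_i`. -/
def QC {n : ℕ} (i : Fin n) : Set (𝓑 n) := orbit (flagStabilizer (flagC i))

/-- The orbit `Q_{i,j}`. -/
def QO {n : ℕ} (i j : Fin n) : Set (𝓑 n) := orbit (flagStabilizer (flagO i j))

/-! ### The standard pair, the Weyl group and the Springer map -/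

/-- The standard Borel subalgebra of upper triangular matrices. -/
def b₀ (n : ℕ) : LieSubalgebra ℂ (𝔤 n) where
  carrier := {x | x.BlockTriangular id}
  add_mem' := fun hx hy => hx.add hy
  zero_mem' := Matrix.blockTriangular_zero
  smul_mem' := fun a x hx => fun i j hij => by
    rw [Matrix.smul_apply, hx hij, smul_zero]
  lie_mem' := fun hx hy => (hx.mul hy).sub (hy.mul hx)

/-- The standard Cartan subgroup of invertible diagonal matrices. -/
def T₀ (n : ℕ) : Subgroup (G n) :=
  (Units.map (Matrix.diagonalRingHom (Fin n) ℂ : (Fin n → ℂ) →* 𝔤 n)).range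

/-- `N = N_G(T₀)`. -/
def N (n : ℕ) : Subgroup (G n) := Subgroup.normalizer (T₀ n : Set (G n))

/-- The Weyl group `W = N / T₀`. -/
abbrev W (n : ℕ) : Type := N n ⧸ (T₀ n).subgroupOf (N n)

/-- The permutation matrix of `σ`, which maps `e_k` to `e_{σ k}`, as an element of `G`. -/
def permG {n : ℕ} (σ : Equiv.Perm (Fin n)) : G n :=
  ⟨(σ⁻¹).permMatrix ℂ, σ.permMatrix ℂ, by rw [← Matrix.permMatrix_mul]; simp,
    by rw [← Matrix.permMatrix_mul]; simp⟩

theorem permG_conj {n : ℕ} (σ : Equiv.Perm (Fin n)) (d : (Fin n → ℂ)ˣ) :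
    permG σ * Units.map (Matrix.diagonalRingHom (Fin n) ℂ : (Fin n → ℂ) →* 𝔤 n) d * (permG σ)⁻¹ =
      Units.map (Matrix.diagonalRingHom (Fin n) ℂ : (Fin n → ℂ) →* 𝔤 n)
        (Units.map (MonoidHom.pi fun a => Pi.evalMonoidHom (fun _ => ℂ) (σ⁻¹ a)) d) := by
  rw [mul_inv_eq_iff_eq_mul]
  ext a b
  simp only [permG, Units.val_mul, Units.coe_map, MonoidHom.coe_coe,
    Matrix.diagonalRingHom_apply, Matrix.mul_diagonal, Matrix.diagonal_mul,
    Equiv.Perm.permMatrix, PEquiv.toMatrix_apply, Equiv.toPEquiv_apply,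
    MonoidHom.pi_apply, Pi.evalMonoidHom_apply, Option.mem_def, Option.some.injEq]
  split_ifs with h
  · have h' : σ⁻¹ a = b := by simpa using h
    simp [h']
  · ring

theorem permG_mem_N {n : ℕ} (σ : Equiv.Perm (Fin n)) : permG σ ∈ N n := by
  have key : ∀ (τ : Equiv.Perm (Fin n)) (t : G n), t ∈ T₀ n →
      permG τ * t * (permG τ)⁻¹ ∈ T₀ n := by
    rintro τ t ⟨d, rfl⟩
    exact ⟨_, (permG_conj τ d).symm⟩
  have hinv : permG σ⁻¹ = (permG σ)⁻¹ := by
    ext1; simp [permG]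
  refine Subgroup.mem_normalizer_iff.2 fun t => ⟨key σ t, fun h => ?_⟩
  have := key σ⁻¹ _ h
  rw [hinv] at this
  simpa [mul_assoc] using this

/-- The element of `W` that corresponds to a permutation. -/
def weyl {n : ℕ} (σ : Equiv.Perm (Fin n)) : W n := QuotientGroup.mk ⟨permG σ, permG_mem_N σ⟩

/-- `τ(g) = g⁻¹ θ(g)`. -/
def τ {n : ℕ} (g : G n) : G n := g⁻¹ * θ n g

/-- `𝓥 = {g ∈ G : g⁻¹ θ(g) ∈ N}`. -/
def 𝓥 (n : ℕ) : Set (G n) := {g | τ g ∈ N n}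

/-- The Weyl group element `τ(v) T₀` attached to `v ∈ 𝓥`. -/
def springer {n : ℕ} (v : G n) (hv : v ∈ 𝓥 n) : W n := QuotientGroup.mk ⟨τ v, hv⟩

/-- `v ∈ 𝓥` represents the orbit `Q`, that is, `Q = K · Ad(v) 𝔟₀`. -/
structure IsRep {n : ℕ} (v : G n) (Q : Set (𝓑 n)) : Prop where
  mem : v ∈ 𝓥 n
  eq : Q = orbit (AdSub v (b₀ n))

/-- The Springer invariant of `Q` is `w`: representatives exist and they all give `w`. -/
def HasSpringerInvariant {n : ℕ} (Q : Set (𝓑 n)) (w : W n) : Prop :=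
  (∃ v : G n, IsRep v Q) ∧ ∀ (v : G n) (h : IsRep v Q), springer v h.mem = w

/-! ### Types of roots -/

/-- The involution `θ_v = Ad(v⁻¹) ∘ θ ∘ Ad(v)` of `𝔤`. -/
def θᵥ {n : ℕ} (v : G n) (x : 𝔤 n) : 𝔤 n := Ad v⁻¹ (dθ n (Ad v x))

/-- For `r = (k, l)` with `k ≠ l`, the root `ε_k - ε_l`, evaluated on a (diagonal) matrix. -/
def rootVal {n : ℕ} (r : Fin n × Fin n) (t : 𝔤 n) : ℂ := t r.1 r.1 - t r.2 r.2

/-- A root vector for the root `r`. -/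
def rootVec {n : ℕ} (r : Fin n × Fin n) : 𝔤 n := Matrix.single r.1 r.2 1

/-- The involution `ϑ` preserves the diagonal Cartan subalgebra `𝔱₀` and maps the weight `r`
to the weight `s`. -/
def MapsRoot {n : ℕ} (ϑ : 𝔤 n → 𝔤 n) (r s : Fin n × Fin n) : Prop :=
  ∀ t : 𝔤 n, t.IsDiag → (ϑ t).IsDiag ∧ rootVal s (ϑ t) = rootVal r t

/-- `r` is positive for `(𝔟₀, 𝔱₀)`. -/
def IsPositive {n : ℕ} (r : Fin n × Fin n) : Prop := rootVec r ∈ b₀ n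

/-- `r` is real for `ϑ`; note that `-(ε_k - ε_l) = ε_l - ε_k`. -/
def IsRealRoot {n : ℕ} (ϑ : 𝔤 n → 𝔤 n) (r : Fin n × Fin n) : Prop := MapsRoot ϑ r r.swap

/-- `r` is imaginary for `ϑ`. -/
def IsImaginary {n : ℕ} (ϑ : 𝔤 n → 𝔤 n) (r : Fin n × Fin n) : Prop := MapsRoot ϑ r r

/-- `r` is non-compact imaginary for `ϑ`. -/
def IsNoncompactImaginary {n : ℕ} (ϑ : 𝔤 n → 𝔤 n) (r : Fin n × Fin n) : Prop :=
  IsImaginary ϑ r ∧ ϑ (rootVec r) = -rootVec r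

/-- `r` is complex `ϑ`-stable. -/
def IsComplexStable {n : ℕ} (ϑ : 𝔤 n → 𝔤 n) (r : Fin n × Fin n) : Prop :=
  ¬ IsRealRoot ϑ r ∧ ¬ IsImaginary ϑ r ∧ IsPositive r ∧
    ∃ s : Fin n × Fin n, s.1 ≠ s.2 ∧ MapsRoot ϑ r s ∧ IsPositive s

/-! ### The action of simple reflections on orbits

The simple root with index `k` is `ε_k - ε_{k+1}`, for `0 ≤ k` and `k + 1 < n`. -/

/-- The minimal parabolic subgroup `P_α` for the simple root `α` with index `k`: invertible
matrices that are upper triangular, except that the entry in row `k+1` and column `k` is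
arbitrary. -/
def P (n k : ℕ) : Set (G n) :=
  {g | ∀ a b : Fin n, b < a → ¬ (b.val = k ∧ a.val = k + 1) → (g : 𝔤 n) a b = 0}

/-- The set `π_α⁻¹ (π_α Q)`, for the projection `π_α : G/B₀ → G/P_α`. -/
def saturation {n : ℕ} (k : ℕ) (Q : Set (𝓑 n)) : Set (𝓑 n) :=
  {x | ∃ g : G n, (∃ y ∈ Q, y.1 = AdSub g (b₀ n)) ∧ ∃ p ∈ P n k, x.1 = AdSub (g * p) (b₀ n)}

/-- `Q'` is a `K`-orbit contained and open in `π_α⁻¹ (π_α Q)`. -/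
def IsOpenOrbitIn {n : ℕ} (k : ℕ) (Q Q' : Set (𝓑 n)) : Prop :=
  IsKOrbit Q' ∧ ∃ U : Set (𝓑 n), IsOpen U ∧ Q' = U ∩ saturation k Q

open Classical in
/-- The orbit `m(s_α) · Q`: the unique open `K`-orbit in `π_α⁻¹ (π_α Q)` (with the empty set as
the value if there were no such orbit or several). -/
def m {n : ℕ} (k : ℕ) (Q : Set (𝓑 n)) : Set (𝓑 n) :=
  if h : ∃! Q' : Set (𝓑 n), IsOpenOrbitIn k Q Q' then h.choose else ∅

/-! ### The representatives of the orbits `Q_{i,j}` -/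

/-- The permutation matrix of the cycle `(n n-1 … i)`, which maps `e_i` to `e_n`, and `e_k` to
`e_{k-1}` for `k > i`: its columns are the vectors of the flag `𝓕_i`. -/
def cycleMatrix {n : ℕ} (i : Fin n) : 𝔤 n := Matrix.of fun r k => flagC i k r

/-- The Cayley transform `u_α` for the simple root `α` with index `k`: the image of the matrix
`(1/√2) [[1, ı], [ı, 1]]` in rows and columns `k` and `k+1`. -/
def cayleyMatrix (n k : ℕ) : 𝔤 n :=
  Matrix.of fun a b =>
    if (a.val = k ∨ a.val = k + 1) ∧ (b.val = k ∨ b.val = k + 1) then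
      ((Real.sqrt 2 : ℝ) : ℂ)⁻¹ * (if a = b then 1 else Complex.I)
    else if a = b then 1 else 0

/-- The permutation matrix of the transposition `(k k+1)`. -/
def simpleMatrix (n k : ℕ) : 𝔤 n :=
  if h : k + 1 < n then (Equiv.swap ⟨k, Nat.lt_of_succ_lt h⟩ ⟨k + 1, h⟩).permMatrix ℂ else 1

/-- The matrix `(n n-1 … i) u_{α_i} s_{i+1} ⋯ s_{j-1}`. -/
def repMatrix {n : ℕ} (i j : Fin n) : 𝔤 n :=
  cycleMatrix i * cayleyMatrix n i *
    ((List.range' (i + 1) (j - 1 - i)).map (simpleMatrix n)).prod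

end KOrb

end

/-! A flag is the sequence of spans of the first columns of some g in G, and g matters only up to
right multiplication by upper triangular matrices. Lie's theorem (`exists_triangular_basis`)
identifies the Borel subalgebras with the stabilizers of such flags.

K is the stabilizer of the line L spanned by e_n together with the hyperplane H where the last
coordinate vanishes. A K-orbit is therefore a relative position of a flag and the pair (L, H), and
only two vectors matter: φ, the last row of g, and ψ, the last column of g⁻¹, which satisfy φ·ψ = 1.
Let i be the index of the first nonzero entry of φ (the flag leaves H) and j that of the last
nonzero entry of ψ (the flag absorbs L). Since φ·ψ = 1, i ≤ j. Upper triangular column operations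
bring φ to ε_i and ψ to e_i or e_i - e_j (`exists_isNormal_mul`), and matrices with the same φ and ψ
differ by a left factor in K (`exists_K_of_row_col`). So the types (i, j) with i ≤ j classify the
orbits: Q_i has type (i, i) and Q_{i,j} has type (i, j).

Non-vanishing of entries of φ or ψ is an open condition, which makes the types (i, i) closed and the
extreme type open. Conversely, two nonempty open sets meet on a line joining two matrices, and the
line g(1 + tE_{ji}) lies in type (i, j) except at t = 0, where it reaches type (i, i). A minimal
parabolic changes a single step of the flag, so all vanishing conditions at the other steps survive
in the saturation; this gives the action of m(s_k).

For a representative v, θ_v is conjugation by v⁻¹cv = 1 - 2ψφ. If this matrix normalizes the torus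
it is monomial, and its nonzero entry -2ψ_jφ_i forces the permutation (i j) (`cConj_monomial`). The
statements on roots follow.

For the length, orbits are covered by translates of the big cell. In coordinates w with flag given
by f w⁻¹, f in normal form, the type (i, j) is cut out by linear equations and one inequality w_{ji}
≠ 1 (`IsLowerUnip.hasType_mul_inv_iff`). The dimension is the number of free matrix positions, and
counting them gives j - i. -/

namespace KOrb

open Matrix TopologicalSpace Topology

attribute [local instance] LieRing.ofAssociativeRing

/-! ### Zariski topologies defined by coordinate functions -/

section Zariski

variable {X Y σ σ' : Type*}

/-- The Zariski topology on a set with coordinate functions. -/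
@[reducible] def zar (co : X → σ → ℂ) : TopologicalSpace X :=
  generateFrom {U | ∃ p : MvPolynomial σ ℂ, U = {x | MvPolynomial.eval (co x) p ≠ 0}}

theorem isOpen_zar_ne (co : X → σ → ℂ) (p : MvPolynomial σ ℂ) :
    IsOpen[zar co] {x | MvPolynomial.eval (co x) p ≠ 0} :=
  GenerateOpen.basic _ ⟨p, rfl⟩

/-- A product of polynomials is nonzero exactly where all the factors are, so the generating sets
are stable under finite intersections and already form a basis. -/
theorem exists_poly_of_isOpen {co : X → σ → ℂ} {U : Set X} (hU : IsOpen[zar co] U) {x : X}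
    (hx : x ∈ U) : ∃ p : MvPolynomial σ ℂ, MvPolynomial.eval (co x) p ≠ 0 ∧
      ∀ y, MvPolynomial.eval (co y) p ≠ 0 → y ∈ U := by
  have hU' : GenerateOpen {U | ∃ p : MvPolynomial σ ℂ,
    U = {x | MvPolynomial.eval (co x) p ≠ 0}} U := hU
  clear hU
  induction hU' with
  | basic s hs => obtain ⟨p, rfl⟩ := hs; exact ⟨p, hx, fun y hy => hy⟩
  | univ => exact ⟨1, by simp, fun y _ => trivial⟩
  | inter s t _ _ hs ht =>
    obtain ⟨p, hp, hp'⟩ := hs hx.1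
    obtain ⟨q, hq, hq'⟩ := ht hx.2
    refine ⟨p * q, by simpa using ⟨hp, hq⟩, fun y hy => ?_⟩
    rw [map_mul] at hy
    exact ⟨hp' y (left_ne_zero_of_mul hy), hq' y (right_ne_zero_of_mul hy)⟩
  | sUnion S _ ih =>
    obtain ⟨s, hs, hxs⟩ := hx
    obtain ⟨p, hp, hp'⟩ := ih s hs hxs
    exact ⟨p, hp, fun y hy => ⟨s, hs, hp' y hy⟩⟩

theorem isOpen_zar_of_forall {co : X → σ → ℂ} {U : Set X}
    (h : ∀ x ∈ U, ∃ p : MvPolynomial σ ℂ, MvPolynomial.eval (co x) p ≠ 0 ∧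
      ∀ y, MvPolynomial.eval (co y) p ≠ 0 → y ∈ U) : IsOpen[zar co] U := by
  let := zar co
  refine isOpen_iff_forall_mem_open.2 fun x hx => ?_
  obtain ⟨p, hp, hp'⟩ := h x hx
  exact ⟨_, hp', isOpen_zar_ne co p, hp⟩

theorem induced_zar (f : Y → X) (co : X → σ → ℂ) :
    TopologicalSpace.induced f (zar co) = zar fun y => co (f y) := by
  rw [zar, induced_generateFrom_eq]
  congr 1
  ext U
  constructor
  · rintro ⟨_, ⟨p, rfl⟩, rfl⟩
    exact ⟨p, rfl⟩
  · rintro ⟨p, rfl⟩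
    exact ⟨_, ⟨p, rfl⟩, rfl⟩

/-- The functions on `X` that are regular away from the zeros of `D`. -/
def regFun (co : X → σ → ℂ) (D : MvPolynomial σ ℂ) : Subalgebra ℂ (X → ℂ) where
  carrier := {F | ∃ (N : ℕ) (p : MvPolynomial σ ℂ), ∀ x, MvPolynomial.eval (co x) D ≠ 0 →
    MvPolynomial.eval (co x) D ^ N * F x = MvPolynomial.eval (co x) p}
  mul_mem' := by
    rintro F F' ⟨N, p, h⟩ ⟨N', p', h'⟩
    refine ⟨N + N', p * p', fun x hx => ?_⟩
    rw [map_mul, ← h x hx, ← h' x hx, Pi.mul_apply]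
    ring
  add_mem' := by
    rintro F F' ⟨N, p, h⟩ ⟨N', p', h'⟩
    refine ⟨N + N', D ^ N' * p + D ^ N * p', fun x hx => ?_⟩
    rw [map_add, map_mul, map_mul, map_pow, map_pow, ← h x hx, ← h' x hx, Pi.add_apply]
    ring
  algebraMap_mem' r := ⟨0, MvPolynomial.C r, fun x _ => by simp⟩

variable {co : X → σ → ℂ} {D : MvPolynomial σ ℂ}

theorem regFun_coord (s : σ) : (fun x => co x s) ∈ regFun co D :=
  ⟨0, MvPolynomial.X s, fun x _ => by simp⟩

theorem regFun_const (r : ℂ) : (fun _ : X => r) ∈ regFun co D :=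
  (regFun co D).algebraMap_mem r

theorem regFun_inv {E : MvPolynomial σ ℂ} (h : E ∣ D) :
    (fun x => (MvPolynomial.eval (co x) E)⁻¹) ∈ regFun co D := by
  obtain ⟨E', rfl⟩ := h
  refine ⟨1, E', fun x hx => ?_⟩
  rw [map_mul] at hx ⊢
  have := left_ne_zero_of_mul hx
  field_simp

theorem regFun_comp {f : X → σ' → ℂ} (hf : ∀ s, (fun x => f x s) ∈ regFun co D)
    (p : MvPolynomial σ' ℂ) : (fun x => MvPolynomial.eval (f x) p) ∈ regFun co D := by
  induction p using MvPolynomial.induction_on with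
  | C a => simpa using regFun_const a
  | add p q hp hq =>
    simp only [map_add]
    exact add_mem hp hq
  | mul_X p s hp =>
    simp only [map_mul, MvPolynomial.eval_X]
    exact mul_mem hp (hf s)

/-- Denominators can be cleared: where D is nonzero, F and its numerator have the same zeros. -/
theorem isOpen_regFun_ne {F : X → ℂ} (hF : F ∈ regFun co D) :
    IsOpen[zar co] {x | MvPolynomial.eval (co x) D ≠ 0 ∧ F x ≠ 0} := by
  obtain ⟨N, p, h⟩ := hF
  convert isOpen_zar_ne co (D * p) using 1
  ext x
  simp only [Set.mem_ofPred_eq, map_mul, mul_ne_zero_iff]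
  refine and_congr_right fun hx => ?_
  rw [← h x hx, mul_ne_zero_iff]
  exact ⟨fun hF => ⟨pow_ne_zero _ hx, hF⟩, fun hF => hF.2⟩

theorem continuous_zar {co' : Y → σ' → ℂ} {f : X → Y}
    (hD : ∀ x, MvPolynomial.eval (co x) D ≠ 0)
    (hf : ∀ s, (fun x => co' (f x) s) ∈ regFun co D) : @Continuous _ _ (zar co) (zar co') f := by
  let := zar co
  refine continuous_generateFrom_iff.2 ?_
  rintro _ ⟨p, rfl⟩
  have := isOpen_regFun_ne (regFun_comp hf p)
  simp only [hD, not_false_eq_true, true_and, ne_eq] at this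
  exact this

/-! ### Regularity of determinants, adjugates and matrix products. -/

section Matrices

variable {ι : Type*} [Fintype ι] [DecidableEq ι] (R : Subalgebra ℂ (X → ℂ))

theorem det_mem {M : X → Matrix ι ι ℂ} (hM : ∀ a b, (fun x => M x a b) ∈ R) :
    (fun x => (M x).det) ∈ R := by
  have : (fun x => (M x).det) =
      ∑ s : Equiv.Perm ι, (fun _ => ((Equiv.Perm.sign s : ℤ) : ℂ)) * ∏ a, fun x => M x (s a) a := by
    ext x
    simp [Matrix.det_apply']
  rw [this]
  exact sum_mem fun s _ => mul_mem (R.algebraMap_mem _) (prod_mem fun a _ => hM _ _)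

theorem adjugate_mem {M : X → Matrix ι ι ℂ} (hM : ∀ a b, (fun x => M x a b) ∈ R) (a b : ι) :
    (fun x => (M x).adjugate a b) ∈ R := by
  simp only [Matrix.adjugate_apply]
  refine det_mem R fun c d => ?_
  by_cases hc : c = b
  · subst hc
    simp only [Matrix.updateRow_apply, if_true]
    exact R.algebraMap_mem ((Pi.single a 1 : ι → ℂ) d)
  · simpa [Matrix.updateRow_apply, hc] using hM c d

omit [DecidableEq ι] in
theorem matMul_mem {M M' : X → Matrix ι ι ℂ} (hM : ∀ a b, (fun x => M x a b) ∈ R)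
    (hM' : ∀ a b, (fun x => M' x a b) ∈ R) (a b : ι) : (fun x => (M x * M' x) a b) ∈ R := by
  have : (fun x => (M x * M' x) a b) = ∑ k, (fun x => M x a k) * fun x => M' x k b := by
    ext x
    simp [Matrix.mul_apply]
  rw [this]
  exact sum_mem fun k _ => mul_mem (hM _ _) (hM' _ _)

end Matrices

/-- Two open sets that contain the ends of an affine line contain almost all of its points. -/
theorem exists_finite_line {U₀ U₁ : Set X} (h₀ : IsOpen[zar co] U₀) (h₁ : IsOpen[zar co] U₁)
    {x₀ x₁ : X} (hx₀ : x₀ ∈ U₀) (hx₁ : x₁ ∈ U₁) :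
    ∃ F : Finset ℂ, ∀ t ∉ F, ∀ x, (∀ s, co x s = (1 - t) * co x₀ s + t * co x₁ s) →
      x ∈ U₀ ∩ U₁ := by
  obtain ⟨p₀, hp₀, hp₀'⟩ := exists_poly_of_isOpen h₀ hx₀
  obtain ⟨p₁, hp₁, hp₁'⟩ := exists_poly_of_isOpen h₁ hx₁
  -- The parametrized line, so that substituting it turns a polynomial on the space into a
  -- polynomial in one variable t.
  let l : σ → Polynomial ℂ := fun s =>
    (1 - Polynomial.X) * Polynomial.C (co x₀ s) + Polynomial.X * Polynomial.C (co x₁ s)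
  have key : ∀ (p : MvPolynomial σ ℂ) (t : ℂ), (MvPolynomial.aeval l p).eval t =
      MvPolynomial.eval (fun s => (1 - t) * co x₀ s + t * co x₁ s) p := by
    intro p t
    induction p using MvPolynomial.induction_on with
    | C a => simp
    | add p q hp hq => simp [hp, hq]
    | mul_X p s hp => rw [map_mul, map_mul, Polynomial.eval_mul, hp]; simp [l, mul_comm t]
  -- The parameters t = 0 and t = 1 give the two ends of the line, where the respective polynomial
  -- does not vanish.
  have ne₀ : MvPolynomial.aeval l p₀ ≠ 0 := fun h => hp₀ <| by
    simpa [h] using (key p₀ 0).symm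
  have ne₁ : MvPolynomial.aeval l p₁ ≠ 0 := fun h => hp₁ <| by
    simpa [h] using (key p₁ 1).symm
  refine ⟨(MvPolynomial.aeval l p₀ * MvPolynomial.aeval l p₁).roots.toFinset, fun t ht x hx => ?_⟩
  have hx' : co x = fun s => (1 - t) * co x₀ s + t * co x₁ s := funext hx
  rw [Multiset.mem_toFinset, Polynomial.mem_roots (mul_ne_zero ne₀ ne₁), Polynomial.IsRoot.def,
    Polynomial.eval_mul, key, key, mul_eq_zero, not_or] at ht
  exact ⟨hp₀' x (by rw [hx']; exact ht.1), hp₁' x (by rw [hx']; exact ht.2)⟩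

end Zariski

/-! ### The dimension of affine space -/

/-- Affine space with its Zariski topology. -/
def Aff (ι : Type*) : Type _ := ι → ℂ

instance (ι : Type*) : TopologicalSpace (Aff ι) := zar fun x : ι → ℂ => x

section Dimension

variable {ι : Type*}

theorem Aff.isClosed_coord (s : Set ι) : IsClosed {x : Aff ι | ∀ i ∈ s, x i = 0} := by
  refine isOpen_compl_iff.1 (isOpen_zar_of_forall fun x hx => ?_)
  obtain ⟨i, hi, hxi⟩ : ∃ i ∈ s, x i ≠ 0 := by simpa using hx
  exact ⟨MvPolynomial.X i, (MvPolynomial.eval_X (f := (x : ι → ℂ)) i).trans_ne hxi,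
    fun y hy h => hy ((MvPolynomial.eval_X (f := (y : ι → ℂ)) i).trans (h i hi))⟩

/-- The subspace contains the line through any two of its points, and almost every point of that
line lies in both open sets. -/
theorem Aff.isIrreducible_coord (s : Set ι) : IsIrreducible {x : Aff ι | ∀ i ∈ s, x i = 0} := by
  refine ⟨⟨fun _ => 0, fun _ _ => rfl⟩, ?_⟩
  rintro U V hU hV ⟨x, hx, hxU⟩ ⟨y, hy, hyV⟩
  obtain ⟨F, hF⟩ := exists_finite_line hU hV hxU hyV
  obtain ⟨t, ht⟩ := Infinite.exists_notMem_finset F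
  refine ⟨fun i => (1 - t) * x i + t * y i, fun i hi => ?_, hF t ht _ fun _ => rfl⟩
  change (1 - t) * x i + t * y i = 0
  rw [hx i hi, hy i hi]
  ring

/-- A linear subspace of affine space defined by the vanishing of coordinates. -/
def Aff.coordSubspace (s : Set ι) : IrreducibleCloseds (Aff ι) :=
  ⟨{x | ∀ i ∈ s, x i = 0}, Aff.isIrreducible_coord s, Aff.isClosed_coord s⟩

theorem Aff.coordSubspace_lt {s t : Set ι} (h : s ⊂ t) :
    Aff.coordSubspace t < Aff.coordSubspace s := by
  classical
  refine lt_of_le_not_ge (fun x hx i hi => hx i (h.1 hi)) fun hle => ?_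
  obtain ⟨i, hit, his⟩ := Set.exists_of_ssubset h
  have := hle (show (fun j => if j = i then 1 else 0 : ι → ℂ) ∈ Aff.coordSubspace s from
    fun j hj => if_neg (ne_of_mem_of_not_mem hj his)) i hit
  simp at this

/-- Freeing one coordinate at a time gives a chain of subspaces that starts at the origin. The bound
concerns the coheight of the origin, not just the dimension of the space, because coheights are
preserved when passing to an open neighbourhood. -/
theorem Aff.card_le_coheight [Fintype ι] :
    (Fintype.card ι : ℕ∞) ≤ Order.coheight (Aff.coordSubspace (Set.univ : Set ι)) := by
  let e := Fintype.equivFin ι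
  let f : Fin (Fintype.card ι + 1) → IrreducibleCloseds (Aff ι) := fun k =>
    Aff.coordSubspace {i | (k : ℕ) ≤ e i}
  have hf : StrictMono f := by
    intro k l hkl
    refine Aff.coordSubspace_lt ⟨fun i (hi : (l : ℕ) ≤ e i) => ?_, fun h => ?_⟩
    · exact (Nat.le_of_lt hkl).trans hi
    · have h1 := h (show e.symm ⟨k, by have := l.2; have : (k : ℕ) < l := hkl; omega⟩ ∈ _ by simp)
      simp only [Set.mem_ofPred_eq, Equiv.apply_symm_apply] at h1
      exact absurd hkl (not_lt.2 h1)
  refine Order.length_le_coheight (p := LTSeries.mk _ f hf) (le_of_eq ?_)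
  change _ = f 0
  simp only [f]
  congr
  simp

/-- Vanishing ideals of irreducible closed sets are prime, and the assignment strictly reverses
inclusions; so chains are bounded by the Krull dimension of the polynomial ring. -/
theorem Aff.topologicalKrullDim_le [Fintype ι] :
    topologicalKrullDim (Aff ι) ≤ (Fintype.card ι : WithBot ℕ∞) := by
  have h1 : ringKrullDim (MvPolynomial ι ℂ) = Fintype.card ι := by
    rw [MvPolynomial.ringKrullDim_of_isNoetherianRing, ringKrullDim_eq_zero_of_field]
    simp
  rw [← h1, topologicalKrullDim, ringKrullDim, ← Order.krullDim_orderDual (α := PrimeSpectrum _)]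
  let I : IrreducibleCloseds (Aff ι) → Ideal (MvPolynomial ι ℂ) := fun Z =>
    { carrier := {p | ∀ x : ι → ℂ, x ∈ (Z : Set (Aff ι)) → MvPolynomial.eval x p = 0}
      add_mem' := fun hp hq x hx => by rw [map_add, hp x hx, hq x hx, add_zero]
      zero_mem' := fun x _ => map_zero _
      smul_mem' := fun a p hp x hx => by rw [smul_eq_mul, map_mul, hp x hx, mul_zero] }
  have hI : ∀ Z, (I Z).IsPrime := by
    intro Z
    refine ⟨fun h => ?_, fun {p q} hpq => ?_⟩
    · obtain ⟨x, hx⟩ := Z.isIrreducible.nonempty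
      have : (1 : MvPolynomial ι ℂ) ∈ I Z := h ▸ Submodule.mem_top
      simpa using this x hx
    · by_contra hcon
      rw [not_or] at hcon
      obtain ⟨x, hx, hxp⟩ : ∃ x : ι → ℂ, x ∈ (Z : Set (Aff ι)) ∧ MvPolynomial.eval x p ≠ 0 := by
        simpa [I] using hcon.1
      obtain ⟨y, hy, hyq⟩ : ∃ x : ι → ℂ, x ∈ (Z : Set (Aff ι)) ∧ MvPolynomial.eval x q ≠ 0 := by
        simpa [I] using hcon.2
      obtain ⟨z, hz, hz1, hz2⟩ := Z.isIrreducible.2 _ _ (isOpen_zar_ne _ p) (isOpen_zar_ne _ q)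
        ⟨x, hx, hxp⟩ ⟨y, hy, hyq⟩
      have := hpq z hz
      rw [map_mul] at this
      exact (mul_ne_zero hz1 hz2) this
  refine Order.krullDim_le_of_strictMono
    (fun Z => OrderDual.toDual (⟨I Z, hI Z⟩ : PrimeSpectrum (MvPolynomial ι ℂ))) fun Z Z' hlt => ?_
  rw [OrderDual.toDual_lt_toDual]
  -- Strictness: a point of the larger set outside the smaller closed set is separated from it by a
  -- polynomial that vanishes on the smaller one.
  refine lt_of_le_not_ge (fun p hp x hx => hp x (hlt.le hx)) fun hle => hlt.not_ge fun x hx => ?_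
  by_contra hxZ
  obtain ⟨p, hp, hp'⟩ := exists_poly_of_isOpen Z.isClosed.isOpen_compl (x := x) hxZ
  refine hp (hle (show p ∈ I Z from fun y hy => ?_) x hx)
  by_contra hpy
  exact hp' y hpy hy

/-- The dimension of a space that is covered by open pieces which are isomorphic to
open neighbourhoods of the origin in affine space. -/
theorem topologicalKrullDim_eq_of_cells [Fintype ι] {X : Type*} [TopologicalSpace X] [Nonempty X]
    (V : Set (Aff ι)) (hV : IsOpen V) (hV0 : (fun _ => 0 : ι → ℂ) ∈ V)
    (h : ∀ x : X, ∃ f : V → X, IsOpenEmbedding f ∧ x ∈ Set.range f) :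
    topologicalKrullDim X = (Fintype.card ι : WithBot ℕ∞) := by
  have hVemb : IsOpenEmbedding (Subtype.val : V → Aff ι) := hV.isOpenEmbedding_subtypeVal
  apply le_antisymm
  -- Upper bound: the coheight of an irreducible closed set can be computed in any open piece that
  -- it meets.
  · rw [topologicalKrullDim, Order.krullDim_eq_iSup_coheight]
    refine iSup_le fun Z => ?_
    obtain ⟨x, hx⟩ := Z.isIrreducible.nonempty
    obtain ⟨f, hf, v, rfl⟩ := h x
    obtain ⟨Z', hZ'⟩ := (IrreducibleCloseds.orderIsoOfIsOpenEmbedding f hf).surjective ⟨Z, v, hx⟩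
    have : IrreducibleCloseds.map f hf.continuous Z' = Z := congrArg Subtype.val hZ'
    rw [← this, hf.coheight_map]
    exact (Order.coheight_le_krullDim Z').trans
      ((hVemb.isInducing.topologicalKrullDim_le).trans Aff.topologicalKrullDim_le)
  · obtain ⟨x⟩ := ‹Nonempty X›
    obtain ⟨f, hf, -⟩ := h x
    -- Lower bound: the origin lies in the piece and keeps its coheight there.
    refine le_trans ?_ hf.isInducing.topologicalKrullDim_le
    obtain ⟨Z', hZ'⟩ := (IrreducibleCloseds.orderIsoOfIsOpenEmbedding _ hVemb).surjective
      ⟨Aff.coordSubspace (Set.univ : Set ι), ⟨⟨_, hV0⟩, fun _ _ => rfl⟩⟩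
    have h1 : IrreducibleCloseds.map _ hVemb.continuous Z' = Aff.coordSubspace Set.univ :=
      congrArg Subtype.val hZ'
    have h2 := hVemb.coheight_map Z'
    rw [h1] at h2
    refine le_trans ?_ (Order.coheight_le_krullDim Z')
    rw [← h2]
    exact_mod_cast Aff.card_le_coheight (ι := ι)

end Dimension

/-! ### The standard Borel subalgebra is solvable -/

/-- Vanishing below the `k`-th superdiagonal. -/
def IsUpper {n : ℕ} (k : ℕ) (x : 𝔤 n) : Prop := ∀ a b : Fin n, (b : ℕ) < a + k → x a b = 0

theorem IsUpper.mul {n k l : ℕ} {x y : 𝔤 n} (hx : IsUpper k x) (hy : IsUpper l y) :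
    IsUpper (k + l) (x * y) := by
  intro a b hab
  rw [Matrix.mul_apply]
  refine Finset.sum_eq_zero fun c _ => ?_
  by_cases hc : (c : ℕ) < a + k
  · rw [hx a c hc, zero_mul]
  · rw [hy c b (by omega), mul_zero]

theorem IsUpper.mono {n k l : ℕ} (hkl : k ≤ l) {x : 𝔤 n} (hx : IsUpper l x) : IsUpper k x :=
  fun a b hab => hx a b (by omega)

theorem IsUpper.sub {n k : ℕ} {x y : 𝔤 n} (hx : IsUpper k x) (hy : IsUpper k y) :
    IsUpper k (x - y) := fun a b hab => by
  rw [Matrix.sub_apply, hx a b hab, hy a b hab, sub_zero]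

/-- For k ≥ 1 each product already vanishes below superdiagonal 2k ≥ k + 1. For k = 0 the two
products have the same diagonal, which cancels in the commutator. -/
theorem IsUpper.lie {n k : ℕ} {x y : 𝔤 n} (hx : IsUpper k x) (hy : IsUpper k y) :
    IsUpper (k + 1) ⁅x, y⁆ := by
  rw [Ring.lie_def]
  rcases Nat.eq_zero_or_pos k with rfl | hk
  · intro a b hab
    rcases lt_or_eq_of_le (Nat.le_of_lt_succ hab) with h | h
    · exact ((hx.mul hy).sub (hy.mul hx)) a b h
    · obtain rfl : b = a := Fin.ext h
      have diag : ∀ {u v : 𝔤 n}, IsUpper 0 u → IsUpper 0 v → (u * v) b b = u b b * v b b := by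
        intro u v hu hv
        rw [Matrix.mul_apply]
        refine Finset.sum_eq_single b (fun c _ hc => ?_) fun h => absurd (Finset.mem_univ _) h
        rcases lt_or_gt_of_ne hc with h | h
        · rw [hu b c h, zero_mul]
        · rw [hv c b h, mul_zero]
      rw [Matrix.sub_apply, diag hx hy, diag hy hx, mul_comm, sub_self]
  · exact ((hx.mul hy).sub (hy.mul hx)).mono (by omega)

theorem mem_b₀_iff {n : ℕ} {x : 𝔤 n} : x ∈ b₀ n ↔ IsUpper 0 x := Iff.rfl

/-- The ideal of upper triangular matrices that vanish below the `k`-th superdiagonal. -/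
def upperIdeal (n k : ℕ) : LieIdeal ℂ (b₀ n) where
  carrier := {x | IsUpper k (x : 𝔤 n)}
  add_mem' {x y} hx hy := fun a b hab => by
    change (x : 𝔤 n) a b + (y : 𝔤 n) a b = 0
    rw [hx a b hab, hy a b hab, add_zero]
  zero_mem' := fun a b _ => rfl
  smul_mem' r x hx := fun a b hab => by
    change r • (x : 𝔤 n) a b = 0
    rw [hx a b hab, smul_zero]
  lie_mem {x y} hy := by
    have hx := mem_b₀_iff.1 x.2
    change IsUpper k ⁅(x : 𝔤 n), (y : 𝔤 n)⁆
    rw [Ring.lie_def]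
    exact ((hx.mul hy).mono (by omega)).sub ((IsUpper.mul hy hx).mono (by omega))

theorem derivedSeries_le_upperIdeal (n k : ℕ) :
    LieAlgebra.derivedSeries ℂ (b₀ n) k ≤ upperIdeal n k := by
  induction k with
  | zero => exact fun x _ => mem_b₀_iff.1 x.2
  | succ k ih =>
    rw [LieAlgebra.derivedSeries_def, LieAlgebra.derivedSeriesOfIdeal_succ,
      LieSubmodule.lie_le_iff]
    exact fun x hx y hy => IsUpper.lie (ih hx) (ih hy)

theorem isSolvable_b₀ (n : ℕ) : LieAlgebra.IsSolvable (b₀ n) := by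
  rw [LieAlgebra.isSolvable_iff ℂ]
  refine ⟨n, le_bot_iff.1 fun x hx => ?_⟩
  have := derivedSeries_le_upperIdeal n n hx
  rw [LieSubmodule.mem_bot]
  ext a b
  exact this a b (by omega)

/-! ### Lie's theorem in triangular form -/

/-- Induction on the dimension: solvability provides a common eigenvector, and a triangular basis of
the quotient by its line is lifted and placed after it. -/
theorem exists_triangular_basis {L : Type*} [LieRing L] [LieAlgebra ℂ L] [LieAlgebra.IsSolvable L]
    (n : ℕ) : ∀ (V : Type) [AddCommGroup V] [Module ℂ V] [LieRingModule L V] [LieModule ℂ L V]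
      [Module.Finite ℂ V], Module.finrank ℂ V = n → ∃ b : Module.Basis (Fin n) ℂ V,
      ∀ (x : L) (k : Fin n), ⁅x, b k⁆ ∈ Submodule.span ℂ (b '' Set.Iic k) := by
  induction n with
  | zero =>
    intro V _ _ _ _ _ hV
    exact ⟨Module.finBasisOfFinrankEq ℂ V hV, fun x k => k.elim0⟩
  | succ n ih =>
    intro V _ _ _ _ _ hV
    have : Nontrivial V := Module.nontrivial_of_finrank_pos (R := ℂ) (by omega)
    obtain ⟨χ, hχ⟩ := LieModule.exists_nontrivial_weightSpace_of_isSolvable ℂ V (L := L)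
    obtain ⟨⟨v, hv⟩, hv0⟩ := exists_ne (0 : LieModule.weightSpace V χ)
    rw [LieModule.mem_weightSpace] at hv
    have hv0' : v ≠ 0 := fun h => hv0 (Subtype.ext h)
    let N : LieSubmodule ℂ L V :=
      { Submodule.span ℂ {v} with
        lie_mem := by
          intro x w hw
          obtain ⟨r, rfl⟩ := Submodule.mem_span_singleton.1 hw
          refine Submodule.mem_span_singleton.2 ⟨r * χ x, ?_⟩
          rw [lie_smul, hv, smul_smul] }
    have hN : ∀ w, w ∈ N ↔ w ∈ Submodule.span ℂ {v} := fun w => Iff.rfl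
    have hfin : Module.finrank ℂ (V ⧸ N) = n := by
      have h1 := Submodule.finrank_quotient_add_finrank N.toSubmodule
      have h2 : Module.finrank ℂ N.toSubmodule = 1 := finrank_span_singleton hv0'
      change Module.finrank ℂ (V ⧸ N.toSubmodule) = n
      omega
    obtain ⟨b', hb'⟩ := ih (V ⧸ N) hfin
    choose l hl using fun k => LieSubmodule.Quotient.surjective_mk' N (b' k)
    let u : Fin (n + 1) → V := Fin.cons v l
    -- Membership in a span can be tested in the quotient at the cost of adding the eigenvector to
    -- the spanning set.
    have lift : ∀ (s : Set (Fin n)) (w : V),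
        LieSubmodule.Quotient.mk' N w ∈ Submodule.span ℂ (b' '' s) →
        w ∈ Submodule.span ℂ (insert v (l '' s)) := by
      intro s w hw
      have h1 : b' '' s = (LieSubmodule.Quotient.mk' N : V →ₗ[ℂ] V ⧸ N) '' (l '' s) := by
        rw [← Set.image_comp]
        exact Set.image_congr fun k _ => (hl k).symm
      rw [h1, Submodule.span_image] at hw
      obtain ⟨z, hz, hzw⟩ := hw
      have h2 : w - z ∈ N := by
        rw [← LieSubmodule.Quotient.mk_eq_zero, map_sub, sub_eq_zero]
        exact hzw.symm
      rw [← sub_add_cancel w z]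
      exact add_mem (Submodule.span_mono (by simp) ((hN _).1 h2))
        (Submodule.span_mono (Set.subset_insert _ _) hz)
    have htop : ⊤ ≤ Submodule.span ℂ (Set.range u) := by
      intro w _
      have := lift Set.univ w (by rw [Set.image_univ, b'.span_eq]; trivial)
      rwa [Set.image_univ, ← Fin.range_cons] at this
    let b := basisOfTopLeSpanOfCardEqFinrank u htop (by simp [hV])
    have hb : ∀ k, b k = u k := fun k => by simp [b]
    have hbu : (b : Fin (n + 1) → V) = u := funext hb
    refine ⟨b, fun x k => ?_⟩
    rw [hbu]
    refine Fin.cases ?_ (fun k => ?_) k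
    · rw [show u 0 = v from rfl, hv]
      exact Submodule.smul_mem _ _ (Submodule.subset_span ⟨0, Set.mem_Iic.2 le_rfl, rfl⟩)
    · have h1 := lift (Set.Iic k) ⁅x, l k⁆ (by
        rw [LieModuleHom.map_lie, hl]
        exact hb' x k)
      refine Submodule.span_mono ?_ h1
      rintro _ (rfl | ⟨j, hj, rfl⟩)
      · exact ⟨0, Fin.zero_le _, rfl⟩
      · exact ⟨j.succ, Fin.succ_le_succ_iff.2 hj, rfl⟩

/-! ### Borel subalgebras and conjugation -/

theorem Ad_mul {n : ℕ} (g h : G n) (x : 𝔤 n) : Ad (g * h) x = Ad g (Ad h x) := by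
  simp only [Ad_apply, _root_.mul_inv_rev, Units.val_mul, Matrix.mul_assoc]

theorem Ad_one {n : ℕ} (x : 𝔤 n) : Ad 1 x = x := by
  simp [Ad_apply]

theorem mem_AdSub {n : ℕ} {g : G n} {b : LieSubalgebra ℂ (𝔤 n)} {x : 𝔤 n} :
    x ∈ AdSub g b ↔ Ad g⁻¹ x ∈ b := by
  rw [AdSub, LieSubalgebra.mem_map]
  constructor
  · rintro ⟨y, hy, rfl⟩
    change Ad g⁻¹ (Ad g y) ∈ b
    rwa [← Ad_mul, inv_mul_cancel, Ad_one]
  · intro h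
    refine ⟨_, h, ?_⟩
    change Ad g (Ad g⁻¹ x) = x
    rw [← Ad_mul, mul_inv_cancel, Ad_one]

theorem AdSub_mul {n : ℕ} (g h : G n) (b : LieSubalgebra ℂ (𝔤 n)) :
    AdSub (g * h) b = AdSub g (AdSub h b) := by
  ext x
  rw [mem_AdSub, mem_AdSub, mem_AdSub, _root_.mul_inv_rev, Ad_mul]

theorem AdSub_one {n : ℕ} (b : LieSubalgebra ℂ (𝔤 n)) : AdSub 1 b = b := by
  ext x
  rw [mem_AdSub, inv_one, Ad_one]

/-- If a solvable subalgebra contains a conjugate of every solvable subalgebra, then it is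
maximal solvable, and all maximal solvable subalgebras are conjugate to it. -/
theorem maximal_solvable_of_conj {L H : Type*} [LieRing L] [LieAlgebra ℂ L] [Module.Finite ℂ L]
    {b : LieSubalgebra ℂ L} (hb : LieAlgebra.IsSolvable b) (Φ : H → (L ≃ₗ⁅ℂ⁆ L))
    (h : ∀ s : LieSubalgebra ℂ L, LieAlgebra.IsSolvable s →
      ∃ a, s ≤ b.map (Φ a : L →ₗ⁅ℂ⁆ L)) :
    Maximal (fun s : LieSubalgebra ℂ L => LieAlgebra.IsSolvable s) b ∧
      ∀ s, Maximal (fun s : LieSubalgebra ℂ L => LieAlgebra.IsSolvable s) s →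
        ∃ a, s = b.map (Φ a : L →ₗ⁅ℂ⁆ L) := by
  refine ⟨⟨hb, fun s hs hbs => ?_⟩, fun s hs => ?_⟩
  · obtain ⟨a, ha⟩ := h s hs
    -- Conjugates have the same dimension, so a solvable subalgebra containing b, itself contained
    -- in a conjugate of b, cannot be larger than b.
    have h1 : Module.finrank ℂ (b.map (Φ a : L →ₗ⁅ℂ⁆ L)).toSubmodule =
        Module.finrank ℂ b.toSubmodule :=
      ((Φ a).lieSubalgebraMap b).toLinearEquiv.finrank_eq.symm
    have h2 : Module.finrank ℂ s.toSubmodule ≤ Module.finrank ℂ b.toSubmodule :=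
      h1 ▸ Submodule.finrank_mono (show s.toSubmodule ≤ (b.map (Φ a : L →ₗ⁅ℂ⁆ L)).toSubmodule from ha)
    exact (Submodule.eq_of_le_of_finrank_le
      (show b.toSubmodule ≤ s.toSubmodule from hbs) h2).ge
  · obtain ⟨a, ha⟩ := h s hs.1
    exact ⟨a, le_antisymm ha (hs.2 (isSolvable_map _ _ hb) ha)⟩

/-- The entries of g⁻¹w are the coordinates of w in the basis of columns of g. -/
theorem mem_span_cols_iff {n : ℕ} (g : G n) (k : Fin n) (w : Fin n → ℂ) :
    w ∈ Submodule.span ℂ ((fun l r => (g : 𝔤 n) r l) '' Set.Iic k) ↔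
      ∀ a, k < a → (((g⁻¹ : G n) : 𝔤 n) *ᵥ w) a = 0 := by
  have hcol : ∀ l, (fun r => (g : 𝔤 n) r l) = (g : 𝔤 n) *ᵥ Pi.single l 1 := fun l => by
    ext r; simp
  constructor
  · intro hw a hka
    induction hw using Submodule.span_induction with
    | mem x hx =>
      obtain ⟨l, hl, rfl⟩ := hx
      simp only [hcol]
      rw [Matrix.mulVec_mulVec, ← Units.val_mul, inv_mul_cancel, Units.val_one, Matrix.one_mulVec]
      exact Pi.single_eq_of_ne (lt_of_le_of_lt hl hka).ne' _
    | zero => simp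
    | add x y _ _ hx hy => rw [Matrix.mulVec_add, Pi.add_apply, hx, hy, add_zero]
    | smul r x _ hx => rw [Matrix.mulVec_smul, Pi.smul_apply, hx, smul_zero]
  · intro h
    have h1 : w = ∑ l, (((g⁻¹ : G n) : 𝔤 n) *ᵥ w) l • fun r => (g : 𝔤 n) r l := by
      have : w = (g : 𝔤 n) *ᵥ (((g⁻¹ : G n) : 𝔤 n) *ᵥ w) := by
        rw [Matrix.mulVec_mulVec, ← Units.val_mul, mul_inv_cancel, Units.val_one,
          Matrix.one_mulVec]
      ext r
      conv_lhs => rw [this]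
      rw [Matrix.mulVec, dotProduct, Finset.sum_apply]
      exact Finset.sum_congr rfl fun l _ => mul_comm _ _
    rw [h1]
    refine Submodule.sum_mem _ fun l _ => ?_
    by_cases hl : l ≤ k
    · exact Submodule.smul_mem _ _ (Submodule.subset_span ⟨l, hl, rfl⟩)
    · rw [h l (not_le.1 hl), zero_smul]
      exact zero_mem _

theorem mem_AdSub_b₀_iff {n : ℕ} (g : G n) (x : 𝔤 n) : x ∈ AdSub g (b₀ n) ↔
    ∀ k, x *ᵥ (fun r => (g : 𝔤 n) r k) ∈
      Submodule.span ℂ ((fun l r => (g : 𝔤 n) r l) '' Set.Iic k) := by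
  have key : ∀ a k, (((g⁻¹ : G n) : 𝔤 n) *ᵥ (x *ᵥ fun r => (g : 𝔤 n) r k)) a = Ad g⁻¹ x a k := by
    intro a k
    rw [Matrix.mulVec_mulVec, Ad_apply, inv_inv]
    rfl
  simp only [mem_span_cols_iff, mem_AdSub, key]
  exact ⟨fun h k a hka => h hka, fun h a k hka => h k a hka⟩

theorem flagStabilizer_eq {n : ℕ} (g : G n) (v : Fin n → (Fin n → ℂ))
    (hv : ∀ k r, v k r = (g : 𝔤 n) r k) : flagStabilizer v = AdSub g (b₀ n) := by
  obtain rfl : v = fun k r => (g : 𝔤 n) r k := funext fun k => funext fun r => hv k r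
  ext x
  rw [mem_AdSub_b₀_iff]
  constructor
  · exact fun h k => h k _ (Submodule.subset_span ⟨k, Set.mem_Iic.2 le_rfl, rfl⟩)
  · intro h k w hw
    induction hw using Submodule.span_induction with
    | mem y hy =>
      obtain ⟨l, hl, rfl⟩ := hy
      exact Submodule.span_mono (Set.image_mono (Set.Iic_subset_Iic.2 hl)) (h l)
    | zero => rw [Matrix.mulVec_zero]; exact zero_mem _
    | add y z _ _ hy hz => rw [Matrix.mulVec_add]; exact add_mem hy hz
    | smul r y _ hy => rw [Matrix.mulVec_smul]; exact Submodule.smul_mem _ _ hy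

theorem exists_G_of_basis {n : ℕ} (b : Module.Basis (Fin n) ℂ (Fin n → ℂ)) :
    ∃ g : G n, ∀ r k, (g : 𝔤 n) r k = b k r := by
  have h : IsUnit (Matrix.of fun r k => b k r : 𝔤 n) := by
    rw [← Matrix.linearIndependent_cols_iff_isUnit]
    exact b.linearIndependent
  exact ⟨h.unit, fun r k => rfl⟩

theorem exists_le_AdSub_b₀ {n : ℕ} (s : LieSubalgebra ℂ (𝔤 n)) (hs : LieAlgebra.IsSolvable s) :
    ∃ g : G n, s ≤ AdSub g (b₀ n) := by
  obtain ⟨b, hb⟩ := exists_triangular_basis (L := s) n (Fin n → ℂ) (by simp)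
  obtain ⟨g, hg⟩ := exists_G_of_basis b
  refine ⟨g, fun x hx => (mem_AdSub_b₀_iff g x).2 fun k => ?_⟩
  have h1 : (fun l r => (g : 𝔤 n) r l) = (b : Fin n → Fin n → ℂ) :=
    funext fun l => funext fun r => hg r l
  have h2 : (fun r => (g : 𝔤 n) r k) = b k := funext fun r => hg r k
  rw [h1, h2]
  exact hb ⟨x, hx⟩ k

theorem maximal_b₀ (n : ℕ) :
    Maximal (fun s : LieSubalgebra ℂ (𝔤 n) => LieAlgebra.IsSolvable s) (b₀ n) :=
  (maximal_solvable_of_conj (isSolvable_b₀ n) Ad exists_le_AdSub_b₀).1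

/-- The Borel subalgebra `Ad(g) 𝔟₀`. -/
def flagPt {n : ℕ} (g : G n) : 𝓑 n := BorelSubalgebra.map (Ad g) ⟨b₀ n, maximal_b₀ n⟩

theorem flagPt_val {n : ℕ} (g : G n) : (flagPt g).1 = AdSub g (b₀ n) := rfl

theorem flagPt_surjective {n : ℕ} (x : 𝓑 n) : ∃ g, x = flagPt g := by
  obtain ⟨g, hg⟩ :=
    (maximal_solvable_of_conj (isSolvable_b₀ n) Ad exists_le_AdSub_b₀).2 x.1 x.2
  exact ⟨g, Subtype.ext hg⟩

/-- The Borel subalgebra of `𝔨` of upper triangular matrices. -/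
def bK (n : ℕ) : LieSubalgebra ℂ (𝔨 n) := (b₀ n).comap (𝔨 n).incl

theorem isSolvable_bK (n : ℕ) : LieAlgebra.IsSolvable (bK n) := by
  have := isSolvable_b₀ n
  let f : bK n →ₗ⁅ℂ⁆ b₀ n :=
    { toFun := fun x => ⟨((x : 𝔨 n) : 𝔤 n), x.2⟩
      map_add' := fun _ _ => rfl
      map_smul' := fun _ _ => rfl
      map_lie' := rfl }
  exact Function.Injective.lieAlgebra_isSolvable (R := ℂ) (f := f) fun x y h =>
    Subtype.ext (Subtype.ext (congrArg (fun z : b₀ n => (z : 𝔤 n)) h))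

theorem AdK_coe {n : ℕ} (k : K n) (x : 𝔨 n) : ((AdK k x : 𝔨 n) : 𝔤 n) = Ad (k : G n) x := rfl

theorem mem_map_AdK {n : ℕ} {k : K n} {x : 𝔨 n} :
    x ∈ (bK n).map (AdK k : 𝔨 n →ₗ⁅ℂ⁆ 𝔨 n) ↔ (x : 𝔤 n) ∈ AdSub (k : G n) (b₀ n) := by
  rw [mem_AdSub, LieSubalgebra.mem_map]
  constructor
  · rintro ⟨y, hy, rfl⟩
    change Ad (k : G n)⁻¹ (Ad (k : G n) y) ∈ b₀ n
    rw [← Ad_mul, inv_mul_cancel, Ad_one]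
    exact hy
  · intro h
    refine ⟨AdK k⁻¹ x, h, Subtype.ext ?_⟩
    change Ad (k : G n) (Ad (k : G n)⁻¹ x) = x
    rw [← Ad_mul, mul_inv_cancel, Ad_one]

theorem mem_𝔨_apply {n : ℕ} {x : 𝔤 n} (hx : x ∈ 𝔨 n) {a b : Fin n} (hab : a.val + 1 = n ↔ ¬ b.val + 1 = n) :
    x a b = 0 := by
  have h1 : dθ n x a b = x a b := by rw [show dθ n x = x from hx]
  rw [dθ_entry] at h1
  by_cases ha : a.val + 1 = n <;> by_cases hb : b.val + 1 = n <;> simp [ha, hb] at hab h1 ⊢ <;>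
    simpa [neg_eq_iff_add_eq_zero, ← two_mul] using h1

/-- Elements of 𝔨 preserve the hyperplane where the last coordinate vanishes, so Lie's theorem
applies to it. Adding e_n to a triangular basis of the hyperplane gives a matrix in K. -/
theorem exists_le_map_bK {n : ℕ} (hn : 1 ≤ n) (s : LieSubalgebra ℂ (𝔨 n))
    (hs : LieAlgebra.IsSolvable s) : ∃ k : K n, s ≤ (bK n).map (AdK k : 𝔨 n →ₗ⁅ℂ⁆ 𝔨 n) := by
  obtain ⟨m, rfl⟩ : ∃ m, n = m + 1 := ⟨n - 1, by omega⟩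
  let V : LieSubmodule ℂ s (Fin (m + 1) → ℂ) :=
    { LinearMap.ker (LinearMap.proj (Fin.last m) : (Fin (m + 1) → ℂ) →ₗ[ℂ] ℂ) with
      lie_mem := by
        intro x w hw
        have hw' : w (Fin.last m) = 0 := hw
        change (((x : 𝔨 (m + 1)) : 𝔤 (m + 1)) *ᵥ w) (Fin.last m) = 0
        rw [Matrix.mulVec, dotProduct, Fin.sum_univ_castSucc, hw', mul_zero, add_zero]
        refine Finset.sum_eq_zero fun l _ => ?_
        rw [mem_𝔨_apply (x : 𝔨 (m + 1)).2 (by simp [l.2.ne]), zero_mul] }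
  have hV : ∀ w, w ∈ V ↔ w (Fin.last m) = 0 := fun w => Iff.rfl
  have hrank : Module.finrank ℂ V = m := by
    have h1 := LinearMap.finrank_range_add_finrank_ker
      (LinearMap.proj (Fin.last m) : (Fin (m + 1) → ℂ) →ₗ[ℂ] ℂ)
    rw [LinearMap.range_eq_top.2 (LinearMap.proj_surjective _), finrank_top] at h1
    simp only [Module.finrank_self, Module.finrank_pi, Fintype.card_fin] at h1
    change Module.finrank ℂ (LinearMap.ker (LinearMap.proj (Fin.last m) : (Fin (m + 1) → ℂ) →ₗ[ℂ] ℂ)) = m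
    omega
  obtain ⟨b, hb⟩ := exists_triangular_basis (L := s) m V hrank
  -- With e_n in the last position its image needs no check: the last step of the flag is the whole
  -- space.
  let u : Fin (m + 1) → (Fin (m + 1) → ℂ) :=
    Fin.snoc (fun k => (b k : Fin (m + 1) → ℂ)) (Pi.single (Fin.last m) 1)
  have hu : ∀ k : Fin m, u k.castSucc = b k := fun k => by simp [u]
  have hu' : u (Fin.last m) = Pi.single (Fin.last m) 1 := by simp [u]
  have htop : ⊤ ≤ Submodule.span ℂ (Set.range u) := by
    intro w _
    have h1 : w - w (Fin.last m) • u (Fin.last m) ∈ V := by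
      rw [hV, hu']; simp
    have h2 : ∀ z : V, (z : Fin (m + 1) → ℂ) ∈ Submodule.span ℂ (Set.range u) := by
      intro z
      rw [← b.sum_repr z, show ((∑ k, b.repr z k • b k : V) : Fin (m + 1) → ℂ) =
        ∑ k, ((b.repr z k • b k : V) : Fin (m + 1) → ℂ) from map_sum V.toSubmodule.subtype _ _]
      refine Submodule.sum_mem _ fun k _ => ?_
      rw [LieSubmodule.coe_smul, ← hu]
      exact Submodule.smul_mem _ _ (Submodule.subset_span ⟨_, rfl⟩)
    rw [← sub_add_cancel w (w (Fin.last m) • u (Fin.last m))]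
    exact add_mem (h2 ⟨_, h1⟩) (Submodule.smul_mem _ _ (Submodule.subset_span ⟨_, rfl⟩))
  let B := basisOfTopLeSpanOfCardEqFinrank u htop (by simp)
  have hB : (B : Fin (m + 1) → Fin (m + 1) → ℂ) = u := by simp [B]
  obtain ⟨g, hg⟩ := exists_G_of_basis B
  rw [hB] at hg
  have hgK : g ∈ K (m + 1) := by
    rw [mem_K_iff]
    intro a c hac
    rw [hg]
    refine Fin.lastCases (fun hac => ?_) (fun c hac => ?_) c hac
    · have : a ≠ Fin.last m := by rintro rfl; simp at hac
      rw [hu', Pi.single_eq_of_ne this]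
    · have : a = Fin.last m := Fin.ext (by have := c.2; simp at hac ⊢; omega)
      rw [hu, this]
      exact (hV _).1 (b c).2
  refine ⟨⟨g, hgK⟩, fun x hx => mem_map_AdK.2 ((mem_AdSub_b₀_iff g x).2 fun k => ?_)⟩
  have h1 : (fun l r => (g : 𝔤 (m + 1)) r l) = u := funext fun l => funext fun r => hg r l
  have h2 : (fun r => (g : 𝔤 (m + 1)) r k) = u k := funext fun r => hg r k
  change _ *ᵥ (fun r => (g : 𝔤 (m + 1)) r k) ∈ _
  rw [h1, h2]
  refine Fin.lastCases ?_ (fun k => ?_) k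
  · have : Set.Iic (Fin.last m) = Set.univ := Set.eq_univ_of_forall fun a => Fin.le_last a
    rw [this, Set.image_univ]
    exact htop trivial
  · rw [hu]
    have h3 := Submodule.mem_map_of_mem (f := V.toSubmodule.subtype) (hb ⟨x, hx⟩ k)
    rw [Submodule.map_span, ← Set.image_comp] at h3
    refine Submodule.span_mono ?_ h3
    rintro _ ⟨j, hj, rfl⟩
    exact ⟨j.castSucc, hj, hu j⟩

theorem maximal_bK {n : ℕ} (hn : 1 ≤ n) :
    Maximal (fun s : LieSubalgebra ℂ (𝔨 n) => LieAlgebra.IsSolvable s) (bK n) :=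
  (maximal_solvable_of_conj (isSolvable_bK n) AdK (exists_le_map_bK hn)).1

/-- The Borel subalgebra `Ad(k) 𝔟` of `𝔨`, for the standard Borel subalgebra `𝔟` of `𝔨`. -/
def flagPtK {n : ℕ} (hn : 1 ≤ n) (k : K n) : 𝓑K n :=
  BorelSubalgebra.map (AdK k) ⟨bK n, maximal_bK hn⟩

theorem flagPtK_surjective {n : ℕ} (hn : 1 ≤ n) (x : 𝓑K n) : ∃ k, x = flagPtK hn k := by
  obtain ⟨k, hk⟩ :=
    (maximal_solvable_of_conj (isSolvable_bK n) AdK (exists_le_map_bK hn)).2 x.1 x.2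
  exact ⟨k, Subtype.ext hk⟩

/-! ### Stabilizers -/

/-- This is the self-normalization of the standard Borel. The hypothesis says that g_{ak}(g⁻¹)_{lb}
= 0 for k ≤ l and b < a. If g_{ak} ≠ 0 for some a > k, then column k of g⁻¹ vanishes from row k on;
as earlier columns of g are already triangular, the entry (k, k) of gg⁻¹ would be 0. -/
theorem isUpper_of_conj {n : ℕ} {g : G n} (h : ∀ k l : Fin n, k ≤ l → IsUpper 0 (Ad g (single k l 1))) :
    IsUpper 0 (g : 𝔤 n) := by
  have key : ∀ k l a b : Fin n, k ≤ l → b < a →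
      (g : 𝔤 n) a k * ((g⁻¹ : G n) : 𝔤 n) l b = 0 := by
    intro k l a b hkl hab
    have := h k l hkl a b (by simpa using hab)
    rw [Ad_apply, Matrix.mul_assoc, Matrix.mul_apply] at this
    rw [Finset.sum_eq_single k, Matrix.single_mul_apply_same, one_mul] at this
    · exact this
    · intro c _ hc
      rw [Matrix.single_mul_apply_of_ne _ _ _ _ _ hc, mul_zero]
    · exact fun h => absurd (Finset.mem_univ _) h
  suffices ∀ k a : Fin n, k < a → (g : 𝔤 n) a k = 0 from fun a k hka => this k a hka
  intro k
  induction k using WellFoundedLT.induction with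
  | ind k ih =>
    intro a hka
    by_contra hne
    have h0 : ∀ l, k ≤ l → ((g⁻¹ : G n) : 𝔤 n) l k = 0 := fun l hl =>
      (mul_eq_zero.1 (key k l a k hl hka)).resolve_left hne
    have h1 : ((g : 𝔤 n) * ((g⁻¹ : G n) : 𝔤 n)) k k = 1 := by
      rw [← Units.val_mul, mul_inv_cancel, Units.val_one, Matrix.one_apply_eq]
    rw [Matrix.mul_apply, Finset.sum_eq_zero] at h1
    · exact zero_ne_one h1
    · intro l _
      rcases lt_or_ge l k with hl | hl
      · rw [ih l hl k hl, zero_mul]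
      · rw [h0 l hl, mul_zero]

theorem isUpper_inv {n : ℕ} {g : G n} (h : IsUpper 0 (g : 𝔤 n)) :
    IsUpper 0 ((g⁻¹ : G n) : 𝔤 n) := by
  have : Invertible (g : 𝔤 n) := g.invertible
  rw [Matrix.coe_units_inv]
  exact Matrix.blockTriangular_inv_of_blockTriangular (show (g : 𝔤 n).BlockTriangular id from h)

theorem AdSub_of_isUpper {n : ℕ} {g : G n} (h : IsUpper 0 (g : 𝔤 n)) :
    AdSub g (b₀ n) = b₀ n := by
  have key : ∀ {g : G n}, IsUpper 0 (g : 𝔤 n) → AdSub g (b₀ n) ≤ b₀ n := by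
    intro g h x hx
    rw [mem_AdSub, mem_b₀_iff] at hx
    rw [mem_b₀_iff]
    have : x = Ad g (Ad g⁻¹ x) := by rw [← Ad_mul, mul_inv_cancel, Ad_one]
    rw [this, Ad_apply g]
    exact (h.mul hx).mul (isUpper_inv h)
  refine le_antisymm (key h) ?_
  intro x hx
  rw [mem_AdSub]
  exact key (g := g⁻¹) (isUpper_inv h) (mem_AdSub.2 (by rwa [← Ad_mul, inv_inv, mul_inv_cancel, Ad_one]))

theorem flagPt_eq_iff {n : ℕ} {g h : G n} :
    flagPt g = flagPt h ↔ IsUpper 0 ((g⁻¹ * h : G n) : 𝔤 n) := by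
  constructor
  · intro heq
    have h1 : AdSub g (b₀ n) = AdSub h (b₀ n) := congrArg Subtype.val heq
    refine isUpper_of_conj fun k l hkl => ?_
    have h2 : Ad h (single k l 1) ∈ AdSub h (b₀ n) := by
      rw [mem_AdSub, ← Ad_mul, inv_mul_cancel, Ad_one]
      intro a b hab
      refine Matrix.single_apply_of_ne _ _ _ _ _ ?_
      rintro ⟨rfl, rfl⟩
      exact hkl.not_gt hab
    rw [← h1, mem_AdSub, ← Ad_mul] at h2
    exact h2
  · intro h1
    refine Subtype.ext ?_
    rw [flagPt_val, flagPt_val, show h = g * (g⁻¹ * h) by simp, AdSub_mul, AdSub_of_isUpper h1]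

theorem flagPtK_eq_iff {n : ℕ} (hn : 1 ≤ n) {g h : K n} :
    flagPtK hn g = flagPtK hn h ↔ IsUpper 0 ((g⁻¹ * h : G n) : 𝔤 n) := by
  constructor
  · intro heq
    have h1 : (bK n).map (AdK g : 𝔨 n →ₗ⁅ℂ⁆ 𝔨 n) = (bK n).map (AdK h : 𝔨 n →ₗ⁅ℂ⁆ 𝔨 n) :=
      congrArg Subtype.val heq
    have hK : ∀ x : 𝔨 n, (x : 𝔤 n) ∈ b₀ n → Ad (g⁻¹ * h : G n) x ∈ b₀ n := by
      intro x hx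
      have h2 : AdK h x ∈ (bK n).map (AdK h : 𝔨 n →ₗ⁅ℂ⁆ 𝔨 n) :=
        (LieSubalgebra.mem_map _ _ _).2 ⟨x, hx, rfl⟩
      rw [← h1, mem_map_AdK, mem_AdSub, AdK_coe, ← Ad_mul] at h2
      exact h2
    have hk : (g⁻¹ * h : G n) ∈ K n := (g⁻¹ * h).2
    have hk' : (g⁻¹ * h : G n)⁻¹ ∈ K n := inv_mem hk
    rw [mem_K_iff] at hk'
    refine isUpper_of_conj fun k l hkl => ?_
    -- Only matrix units inside 𝔨 are controlled by the hypothesis. The remaining ones lie in the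
    -- last column; their conjugates involve only the last row of the inverse, which is zero off the
    -- corner, and so are upper triangular anyway.
    by_cases hl : (k.val + 1 = n ↔ ¬ l.val + 1 = n)
    · have hl' : l.val + 1 = n := by
        by_contra hne
        have := hl.2 hne
        have : (k : ℕ) ≤ l := hkl
        have := l.2
        omega
      intro a b hab
      have hb : ¬ b.val + 1 = n := by have := a.2; omega
      rw [Ad_apply, Matrix.mul_assoc, Matrix.mul_apply]
      refine Finset.sum_eq_zero fun c _ => ?_
      by_cases hc : c = k
      · subst hc
        rw [Matrix.single_mul_apply_same, hk' l b (by simp [hl', hb]), mul_zero, mul_zero]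
      · rw [Matrix.single_mul_apply_of_ne _ _ _ _ _ hc, mul_zero]
    · have hx : (single k l 1 : 𝔤 n) ∈ 𝔨 n := by
        change dθ n _ = _
        ext a b
        rw [dθ_entry, Matrix.single_apply]
        split_ifs <;> simp_all
      refine hK ⟨_, hx⟩ fun a b hab => Matrix.single_apply_of_ne _ _ _ _ _ ?_
      rintro ⟨rfl, rfl⟩
      exact hkl.not_gt hab
  · intro h1
    refine Subtype.ext (LieSubalgebra.ext _ _ fun x => ?_)
    change x ∈ (bK n).map (AdK g : 𝔨 n →ₗ⁅ℂ⁆ 𝔨 n) ↔ x ∈ (bK n).map (AdK h : 𝔨 n →ₗ⁅ℂ⁆ 𝔨 n)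
    rw [mem_map_AdK, mem_map_AdK]
    have := congrArg Subtype.val (flagPt_eq_iff.2 h1)
    rw [flagPt_val, flagPt_val] at this
    rw [this]

/-! ### The invariants of a `K`-orbit -/

section Types

variable {n : ℕ} {z : Fin n}

/-- The first `a` columns of `g` have zero in row `z`. -/
def RowVanish (z : Fin n) (g : G n) (a : ℕ) : Prop := ∀ l : Fin n, (l : ℕ) < a → (g : 𝔤 n) z l = 0

/-- The first `b` columns of `g` span the basis vector with index `z`. -/
def ColVanish (z : Fin n) (g : G n) (b : ℕ) : Prop :=
  ∀ l : Fin n, b ≤ (l : ℕ) → ((g⁻¹ : G n) : 𝔤 n) l z = 0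

/-- The flag of the columns of `g` leaves the hyperplane of vectors with vanishing coordinate `z`
in step `i`, and reaches the line of the basis vector with index `z` in step `j`. -/
structure HasType (z : Fin n) (i j : ℕ) (g : G n) : Prop where
  row : RowVanish z g i
  row' : ¬ RowVanish z g (i + 1)
  col : ColVanish z g (j + 1)
  col' : ¬ ColVanish z g j

theorem RowVanish.mono {g : G n} {a b : ℕ} (h : RowVanish z g b) (hab : a ≤ b) :
    RowVanish z g a := fun l hl => h l (hl.trans_le hab)

theorem ColVanish.mono {g : G n} {a b : ℕ} (h : ColVanish z g a) (hab : a ≤ b) :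
    ColVanish z g b := fun l hl => h l (hab.trans hl)

theorem HasType.unique {g : G n} {i j i' j' : ℕ} (h : HasType z i j g) (h' : HasType z i' j' g) :
    i = i' ∧ j = j' := by
  have h1 : ¬ i' < i := fun hlt => h'.row' (h.row.mono hlt)
  have h2 : ¬ i < i' := fun hlt => h.row' (h'.row.mono hlt)
  have h3 : ¬ j < j' := fun hlt => h'.col' (h.col.mono hlt)
  have h4 : ¬ j' < j := fun hlt => h.col' (h'.col.mono hlt)
  omega

theorem HasType.row_ne {g : G n} {i : Fin n} {j : ℕ} (h : HasType z i j g) : (g : 𝔤 n) z i ≠ 0 := by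
  refine fun h0 => h.row' fun l hl => ?_
  rcases Nat.lt_succ_iff_lt_or_eq.1 hl with hl | hl
  · exact h.row l hl
  · rwa [Fin.ext hl]

theorem HasType.col_ne {g : G n} {i : ℕ} {j : Fin n} (h : HasType z i j g) :
    ((g⁻¹ : G n) : 𝔤 n) j z ≠ 0 := by
  refine fun h0 => h.col' fun l hl => ?_
  rcases hl.lt_or_eq with hl | hl
  · exact h.col l hl
  · rwa [← Fin.ext hl]

theorem hasType_of_ne {g : G n} {i j : Fin n} (h1 : RowVanish z g i) (h2 : (g : 𝔤 n) z i ≠ 0)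
    (h3 : ColVanish z g (j + 1)) (h4 : ((g⁻¹ : G n) : 𝔤 n) j z ≠ 0) : HasType z i j g :=
  ⟨h1, fun h => h2 (h i (Nat.lt_succ_self _)), h3, fun h => h4 (h j le_rfl)⟩

theorem sum_row_col (z : Fin n) (g : G n) :
    ∑ l, (g : 𝔤 n) z l * ((g⁻¹ : G n) : 𝔤 n) l z = 1 := by
  rw [← Matrix.mul_apply, ← Units.val_mul, mul_inv_cancel, Units.val_one, Matrix.one_apply_eq]

/-- The sum of the products φ_l ψ_l is 1. Hence neither vector is zero, and some l satisfies i ≤ l ≤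
j. -/
theorem exists_hasType (z : Fin n) (g : G n) : ∃ i j : Fin n, i ≤ j ∧ HasType z i j g := by
  classical
  -- The least such bound a is i + 1, and the least bound b below is j + 1, because both conditions
  -- count columns.
  have hA : ∃ a, ¬ RowVanish z g a := by
    refine ⟨n, fun h => zero_ne_one ((Finset.sum_eq_zero fun l _ => ?_).symm.trans (sum_row_col z g))⟩
    rw [h l l.2, zero_mul]
  have hB : ∃ b, ColVanish z g b := ⟨n, fun l hl => absurd l.2 (not_lt.2 hl)⟩
  have hA0 : Nat.find hA ≠ 0 := fun h => Nat.find_spec hA (by rw [h]; exact fun l hl => absurd hl (Nat.not_lt_zero _))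
  have hB0 : Nat.find hB ≠ 0 := fun h => by
    have := Nat.find_spec hB
    rw [h] at this
    refine zero_ne_one ((Finset.sum_eq_zero fun l _ => ?_).symm.trans (sum_row_col z g))
    rw [this l (Nat.zero_le _), mul_zero]
  obtain ⟨i, hi⟩ := Nat.exists_eq_succ_of_ne_zero hA0
  obtain ⟨j, hj⟩ := Nat.exists_eq_succ_of_ne_zero hB0
  have row : RowVanish z g i := not_not.1 (Nat.find_min hA (by omega))
  have row' : ¬ RowVanish z g (i + 1) := by have := Nat.find_spec hA; rwa [hi] at this
  have col : ColVanish z g (j + 1) := by have := Nat.find_spec hB; rwa [hj] at this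
  have col' : ¬ ColVanish z g j := Nat.find_min hB (by omega)
  have hjn : j < n := by
    have : Nat.find hB ≤ n := Nat.find_min' hB fun l hl => absurd l.2 (not_lt.2 hl)
    omega
  have hij : i ≤ j := by
    by_contra hlt
    refine zero_ne_one ((Finset.sum_eq_zero fun l _ => ?_).symm.trans (sum_row_col z g))
    rcases lt_or_ge (l : ℕ) i with hl | hl
    · rw [row l hl, zero_mul]
    · rw [col l (by omega), mul_zero]
  exact ⟨⟨i, by omega⟩, ⟨j, hjn⟩, hij, row, row', col, col'⟩

/-! ### Invariance -/

/-- `p` preserves the span of the first `a` basis vectors. -/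
def Preserves (a : ℕ) (p : 𝔤 n) : Prop := ∀ l m : Fin n, a ≤ (l : ℕ) → (m : ℕ) < a → p l m = 0

theorem Preserves.inv {a : ℕ} {p : G n} (h : Preserves a (p : 𝔤 n)) :
    Preserves a ((p⁻¹ : G n) : 𝔤 n) := by
  -- Preserving one coordinate subspace is block triangularity for the grading with two values.
  let β : Fin n → ℕ := fun l => if (l : ℕ) < a then 0 else 1
  have h1 : (p : 𝔤 n).BlockTriangular β := by
    intro l m hlm
    simp only [β] at hlm
    split_ifs at hlm <;> first | omega | exact h l m (by omega) (by omega)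
  have : Invertible (p : 𝔤 n) := p.invertible
  have h2 := Matrix.blockTriangular_inv_of_blockTriangular h1
  rw [Matrix.coe_units_inv]
  intro l m hl hm
  exact h2 (by simp [β, hm, not_lt.2 hl])

theorem IsUpper.preserves {b : 𝔤 n} (hb : IsUpper 0 b) (a : ℕ) : Preserves a b :=
  fun l m hl hm => hb l m (by omega)

theorem RowVanish.mul {g p : G n} {a : ℕ} (h : RowVanish z g a) (hp : Preserves a (p : 𝔤 n)) :
    RowVanish z (g * p) a := by
  intro m hm
  rw [Units.val_mul, Matrix.mul_apply]
  refine Finset.sum_eq_zero fun l _ => ?_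
  rcases lt_or_ge (l : ℕ) a with hl | hl
  · rw [h l hl, zero_mul]
  · rw [hp l m hl hm, mul_zero]

theorem ColVanish.mul {g p : G n} {a : ℕ} (h : ColVanish z g a) (hp : Preserves a (p : 𝔤 n)) :
    ColVanish z (g * p) a := by
  intro m hm
  rw [_root_.mul_inv_rev, Units.val_mul, Matrix.mul_apply]
  refine Finset.sum_eq_zero fun l _ => ?_
  rcases lt_or_ge (l : ℕ) a with hl | hl
  · rw [hp.inv m l hm hl, zero_mul]
  · rw [h l hl, mul_zero]

theorem rowVanish_mul_iff {g p : G n} {a : ℕ} (hp : Preserves a (p : 𝔤 n)) :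
    RowVanish z (g * p) a ↔ RowVanish z g a :=
  ⟨fun h => by simpa using h.mul hp.inv, fun h => h.mul hp⟩

theorem colVanish_mul_iff {g p : G n} {a : ℕ} (hp : Preserves a (p : 𝔤 n)) :
    ColVanish z (g * p) a ↔ ColVanish z g a :=
  ⟨fun h => by simpa using h.mul hp.inv, fun h => h.mul hp⟩

theorem K_mul_row (hz : z.val + 1 = n) {k : G n} (hk : k ∈ K n) (g : 𝔤 n) (l : Fin n) :
    ((k : 𝔤 n) * g) z l = (k : 𝔤 n) z z * g z l := by
  rw [Matrix.mul_apply]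
  refine Finset.sum_eq_single z (fun c _ hc => ?_) fun h => absurd (Finset.mem_univ _) h
  have : ¬ c.val + 1 = n := fun h => hc (Fin.ext (by omega))
  rw [(mem_K_iff k).1 hk z c (by simp [hz, this]), zero_mul]

theorem mul_K_col (hz : z.val + 1 = n) {k : G n} (hk : k ∈ K n) (g : 𝔤 n) (l : Fin n) :
    (g * (k : 𝔤 n)) l z = g l z * (k : 𝔤 n) z z := by
  rw [Matrix.mul_apply]
  refine Finset.sum_eq_single z (fun c _ hc => ?_) fun h => absurd (Finset.mem_univ _) h
  have : ¬ c.val + 1 = n := fun h => hc (Fin.ext (by omega))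
  rw [(mem_K_iff k).1 hk c z (by simp [hz, this]), mul_zero]

theorem K_corner_ne (hz : z.val + 1 = n) {k : G n} (hk : k ∈ K n) : (k : 𝔤 n) z z ≠ 0 := by
  have := K_mul_row hz hk ((k⁻¹ : G n) : 𝔤 n) z
  rw [← Units.val_mul, mul_inv_cancel, Units.val_one, Matrix.one_apply_eq] at this
  exact left_ne_zero_of_mul (this ▸ one_ne_zero)

theorem rowVanish_K_mul_iff (hz : z.val + 1 = n) {k : G n} (hk : k ∈ K n) {g : G n} {a : ℕ} :
    RowVanish z (k * g) a ↔ RowVanish z g a := by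
  refine forall₂_congr fun l _ => ?_
  rw [Units.val_mul, K_mul_row hz hk, mul_eq_zero, or_iff_right (K_corner_ne hz hk)]

theorem colVanish_K_mul_iff (hz : z.val + 1 = n) {k : G n} (hk : k ∈ K n) {g : G n} {a : ℕ} :
    ColVanish z (k * g) a ↔ ColVanish z g a := by
  refine forall₂_congr fun l _ => ?_
  rw [_root_.mul_inv_rev, Units.val_mul, mul_K_col hz (inv_mem hk), mul_eq_zero,
    or_iff_left (K_corner_ne hz (inv_mem hk))]

/-- Left multiplication by K only rescales φ and ψ, and right multiplication by an upper triangular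
matrix does not change the flag. -/
theorem hasType_mul_iff (hz : z.val + 1 = n) {k b g : G n} (hk : k ∈ K n)
    (hb : IsUpper 0 (b : 𝔤 n)) {i j : ℕ} : HasType z i j (k * g * b) ↔ HasType z i j g := by
  have h1 : ∀ a, RowVanish z (k * g * b) a ↔ RowVanish z g a := fun a =>
    (rowVanish_mul_iff (hb.preserves a)).trans (rowVanish_K_mul_iff hz hk)
  have h2 : ∀ a, ColVanish z (k * g * b) a ↔ ColVanish z g a := fun a =>
    (colVanish_mul_iff (hb.preserves a)).trans (colVanish_K_mul_iff hz hk)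
  constructor
  · rintro ⟨p, q, r, s⟩
    exact ⟨(h1 _).1 p, mt (h1 _).2 q, (h2 _).1 r, mt (h2 _).2 s⟩
  · rintro ⟨p, q, r, s⟩
    exact ⟨(h1 _).2 p, mt (h1 _).1 q, (h2 _).2 r, mt (h2 _).1 s⟩

/-! ### The invariants separate the orbits -/

/-- The last row of hg⁻¹ is that of gg⁻¹, and its last column is that of hh⁻¹; both products are the
identity. -/
theorem exists_K_of_row_col (hz : z.val + 1 = n) {g h : G n}
    (hrow : ∀ l, (g : 𝔤 n) z l = (h : 𝔤 n) z l)
    (hcol : ∀ l, ((g⁻¹ : G n) : 𝔤 n) l z = ((h⁻¹ : G n) : 𝔤 n) l z) : h * g⁻¹ ∈ K n := by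
  rw [mem_K_iff]
  intro a b hab
  by_cases ha : a.val + 1 = n
  · obtain rfl : a = z := Fin.ext (by omega)
    have hb : a ≠ b := by rintro rfl; simp at hab
    rw [Units.val_mul, Matrix.mul_apply]
    simp only [← hrow]
    rw [← Matrix.mul_apply, ← Units.val_mul, mul_inv_cancel, Units.val_one, Matrix.one_apply_ne hb]
  · obtain rfl : b = z := Fin.ext (by have := not_not.1 (mt hab.2 ha); omega)
    have hb : a ≠ b := by rintro rfl; exact ha hz
    rw [Units.val_mul, Matrix.mul_apply]
    simp only [hcol]
    rw [← Matrix.mul_apply, ← Units.val_mul, mul_inv_cancel, Units.val_one, Matrix.one_apply_ne hb]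

/-- `g` is in normal form for the type `(i, j)`. -/
structure IsNormal (z i j : Fin n) (g : G n) : Prop where
  row : ∀ l, (g : 𝔤 n) z l = if l = i then 1 else 0
  col : ∀ l, ((g⁻¹ : G n) : 𝔤 n) l z =
    (if l = i then 1 else 0) - (if l = j ∧ i ≠ j then 1 else 0)

/-- Reads off a column of the inverse from a solution of a linear system, without inverting g. -/
theorem col_inv_eq {g : G n} {v : Fin n → ℂ} (h : ∀ r, ((g : 𝔤 n) *ᵥ v) r = if r = z then 1 else 0) (l : Fin n) :
    ((g⁻¹ : G n) : 𝔤 n) l z = v l := by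
  have h1 : (g : 𝔤 n) *ᵥ v = Pi.single z 1 := by
    ext r
    rw [h, Pi.single_apply]
  have h2 : v = ((g⁻¹ : G n) : 𝔤 n) *ᵥ Pi.single z 1 := by
    rw [← h1, Matrix.mulVec_mulVec, ← Units.val_mul, inv_mul_cancel, Units.val_one,
      Matrix.one_mulVec]
  rw [h2]
  simp

theorem IsNormal.hasType {i j : Fin n} {g : G n} (h : IsNormal z i j g) (hij : i ≤ j) :
    HasType z i j g := by
  refine hasType_of_ne (fun l hl => ?_) ?_ (fun l hl => ?_) ?_
  · rw [h.row, if_neg (by rintro rfl; omega)]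
  · simp [h.row]
  · rw [h.col, if_neg, if_neg, sub_zero]
    · rintro ⟨rfl, -⟩; omega
    · rintro rfl; have : (l : ℕ) ≤ j := hij; omega
  · rw [h.col]
    by_cases h' : i = j
    · simp [h']
    · simp [h', Ne.symm h']

/-- The required b is upper triangular with nonzero diagonal, satisfies φb = ε_i, and maps e_i - e_j
(or e_i, when i = j) to ψ. It is written down column by column; triangularity uses that φ vanishes
before i and ψ after j. -/
theorem exists_isNormal_mul {i j : Fin n} (hij : i ≤ j) {g : G n} (h : HasType z i j g) :
    ∃ b : G n, IsUpper 0 (b : 𝔤 n) ∧ IsNormal z i j (g * b) := by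
  have hφ := h.row_ne
  have hψ := h.col_ne
  set φ : Fin n → ℂ := fun l => (g : 𝔤 n) z l with hφdef
  set ψ : Fin n → ℂ := fun l => ((g⁻¹ : G n) : 𝔤 n) l z with hψdef
  have hφψ : ∑ l, φ l * ψ l = 1 := sum_row_col z g
  have hφ0 : ∀ l, l < i → φ l = 0 := fun l hl => h.row l hl
  have hψ0 : ∀ l, j < l → ψ l = 0 := fun l hl => h.col l hl
  change φ i ≠ 0 at hφ
  change ψ j ≠ 0 at hψ
  suffices ∃ b : 𝔤 n, IsUpper 0 b ∧ (∀ r, b r r ≠ 0) ∧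
      (∀ l, ∑ r, φ r * b r l = if l = i then 1 else 0) ∧
      ∀ r, (b *ᵥ fun l => (if l = i then 1 else 0) - (if l = j ∧ i ≠ j then 1 else 0)) r = ψ r by
    obtain ⟨b, hb, hdiag, hrow, hcol⟩ := this
    have hu : IsUnit b := by
      rw [Matrix.isUnit_iff_isUnit_det,
        Matrix.det_of_isUpperTriangular (show b.BlockTriangular id from hb), isUnit_iff_ne_zero]
      exact Finset.prod_ne_zero_iff.2 fun r _ => hdiag r
    refine ⟨hu.unit, hb, fun l => ?_, fun l => col_inv_eq
      (v := fun l => (if l = i then 1 else 0) - (if l = j ∧ i ≠ j then 1 else 0)) (fun r => ?_) l⟩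
    · rw [Units.val_mul, Matrix.mul_apply]
      exact hrow l
    · rw [Units.val_mul, ← Matrix.mulVec_mulVec]
      change ((g : 𝔤 n) *ᵥ (b *ᵥ _)) r = _
      rw [funext hcol]
      change ((g : 𝔤 n) * ((g⁻¹ : G n) : 𝔤 n)) r z = _
      rw [← Units.val_mul, mul_inv_cancel, Units.val_one, Matrix.one_apply]
  rcases hij.eq_or_lt with rfl | hij
  · have h1 : φ i * ψ i = 1 := by
      rw [← hφψ]
      refine (Finset.sum_eq_single (f := fun l => φ l * ψ l) i (fun l _ hl => ?_) fun h => absurd (Finset.mem_univ _) h).symm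
      rcases lt_or_gt_of_ne hl with hl | hl
      · rw [hφ0 l hl, zero_mul]
      · rw [hψ0 l hl, mul_zero]
    -- Column i is ψ, and every other column is e_l - (φ_l / φ_i) e_i, which φ annihilates.
    refine ⟨Matrix.of fun r l => if l = i then ψ r else
      (if r = l then 1 else 0) - (if r = i then φ l / φ i else 0), fun a b hab => ?_, fun r => ?_,
      fun l => ?_, fun r => ?_⟩
    · have hab : b < a := by simpa using hab
      by_cases hb : b = i
      · subst hb; simp [hψ0 a hab]
      · by_cases ha : a = i
        · subst ha; simp [hb, hab.ne', hφ0 b hab]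
        · simp [hb, ha, hab.ne']
    · by_cases hr : r = i
      · subst hr; simpa using hψ
      · simp [hr]
    · by_cases hl : l = i
      · simpa [hl] using hφψ
      · simp [hl, mul_sub, Finset.sum_sub_distrib, mul_div_cancel₀ _ hφ]
    · simp [Matrix.mulVec, dotProduct]
  -- Column i is e_i / φ_i and column j is e_i / φ_i - ψ, so that their difference is ψ and φ takes
  -- the values 1 and 1 - 1 = 0 on them. The other columns are as in the case i = j.
  · refine ⟨Matrix.of fun r l => if l = i then (if r = i then 1 / φ i else 0) else
      if l = j then (if r = i then 1 / φ i else 0) - ψ r else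
      (if r = l then 1 else 0) - (if r = i then φ l / φ i else 0), fun a b hab => ?_, fun r => ?_,
      fun l => ?_, fun r => ?_⟩
    · have hab : b < a := by simpa using hab
      by_cases hb : b = i
      · subst hb; simp [hab.ne']
      · by_cases hb' : b = j
        · subst hb'; simp [hb, hψ0 a hab, (hij.trans hab).ne']
        · by_cases ha : a = i
          · subst ha; simp [hb, hb', hab.ne', hφ0 b hab]
          · simp [hb, hb', ha, hab.ne']
    · by_cases hr : r = i
      · subst hr; simpa using hφ
      · by_cases hr' : r = j
        · subst hr'; simpa [hr] using hψ
        · simp [hr, hr']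
    · by_cases hl : l = i
      · simp [hl, hφ]
      · by_cases hl' : l = j
        · simp [hl', hij.ne', mul_sub, Finset.sum_sub_distrib, hφ, hφψ]
        · simp [hl, hl', mul_sub, Finset.sum_sub_distrib, mul_div_cancel₀ _ hφ]
    · simp [Matrix.mulVec, dotProduct, mul_sub, Finset.sum_sub_distrib, hij.ne, hij.ne']

theorem IsNormal.exists_K (hz : z.val + 1 = n) {i j : Fin n} {g h : G n} (hg : IsNormal z i j g)
    (hh : IsNormal z i j h) : ∃ k ∈ K n, h = k * g :=
  ⟨h * g⁻¹, exists_K_of_row_col hz (fun l => by rw [hg.row, hh.row])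
    (fun l => by rw [hg.col, hh.col]), by simp⟩

theorem HasType.exists_eq_mul (hz : z.val + 1 = n) {i j : Fin n} (hij : i ≤ j) {g h : G n}
    (hg : HasType z i j g) (hh : HasType z i j h) :
    ∃ k ∈ K n, ∃ b : G n, IsUpper 0 (b : 𝔤 n) ∧ h = k * g * b := by
  obtain ⟨b, hb, hgb⟩ := exists_isNormal_mul hij hg
  obtain ⟨b', hb', hhb⟩ := exists_isNormal_mul hij hh
  obtain ⟨k, hk, hkeq⟩ := hgb.exists_K hz hhb
  refine ⟨k, hk, b * b'⁻¹, ?_, ?_⟩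
  · rw [Units.val_mul]
    exact hb.mul (isUpper_inv hb')
  · rw [← mul_assoc, mul_assoc k, ← hkeq, mul_inv_cancel_right]

/-- The flags of type `(i, j)`. -/
def typeSet (z : Fin n) (i j : ℕ) : Set (𝓑 n) := {x | ∃ g, x = flagPt g ∧ HasType z i j g}

theorem flagPt_mem_typeSet (hz : z.val + 1 = n) {i j : ℕ} {g : G n} :
    flagPt g ∈ typeSet z i j ↔ HasType z i j g := by
  refine ⟨?_, fun h => ⟨g, rfl, h⟩⟩
  rintro ⟨h, heq, hh⟩
  have h1 := hasType_mul_iff (g := g) (i := i) (j := j) hz (one_mem _) (flagPt_eq_iff.1 heq)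
  rw [one_mul, mul_inv_cancel_left] at h1
  exact h1.1 hh

/-- Invariance of the type gives one inclusion, uniqueness of the normal form up to K the other. -/
theorem orbit_eq_typeSet (hz : z.val + 1 = n) {i j : Fin n} (hij : i ≤ j) {g : G n}
    (hg : HasType z i j g) : orbit (AdSub g (b₀ n)) = typeSet z i j := by
  ext x
  constructor
  · rintro ⟨k, hk, hx⟩
    refine ⟨k * g, Subtype.ext ?_, ?_⟩
    · rw [hx, flagPt_val, AdSub_mul]
    · simpa using (hasType_mul_iff (b := 1) (g := g) (i := i) (j := j) hz hk
        (by rw [Units.val_one]; exact Matrix.blockTriangular_one)).2 hg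
  · rintro ⟨h, rfl, hh⟩
    obtain ⟨k, hk, b, hb, rfl⟩ := hg.exists_eq_mul hz hij hh
    exact ⟨k, hk, by rw [flagPt_val, AdSub_mul, AdSub_of_isUpper hb, AdSub_mul]⟩

theorem IsKOrbit.exists_typeSet (hz : z.val + 1 = n) {Q : Set (𝓑 n)} (hQ : IsKOrbit Q) :
    ∃ i j : Fin n, i ≤ j ∧ Q = typeSet z i j := by
  obtain ⟨x, rfl⟩ := hQ
  obtain ⟨g, rfl⟩ := flagPt_surjective x
  obtain ⟨i, j, hij, hg⟩ := exists_hasType z g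
  exact ⟨i, j, hij, orbit_eq_typeSet hz hij hg⟩

/-! ### The given flags in normal form. -/

theorem exists_G_of_columns {v : Fin n → Fin n → ℂ}
    (hv : ∀ k : Fin n, e n k ∈ Submodule.span ℂ (Set.range v)) :
    ∃ g : G n, ∀ k r, v k r = (g : 𝔤 n) r k := by
  have htop : ⊤ ≤ Submodule.span ℂ (Set.range v) := by
    intro w _
    have : w = ∑ k, w k • e n k := by
      ext r
      simp [e, Finset.sum_apply, Fin.val_inj]
    rw [this]
    exact Submodule.sum_mem _ fun k _ => Submodule.smul_mem _ _ (hv k)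
  obtain ⟨g, hg⟩ := exists_G_of_basis (basisOfTopLeSpanOfCardEqFinrank v htop (by simp))
  exact ⟨g, fun k r => by rw [hg]; simp⟩

theorem exists_G_flagC (hz : z.val + 1 = n) (i : Fin n) :
    ∃ g : G n, (∀ k r, flagC i k r = (g : 𝔤 n) r k) ∧ IsNormal z i i g := by
  obtain ⟨g, hg⟩ := exists_G_of_columns (v := flagC i) fun k => by
    rcases lt_or_ge k i with hk | hk
    · exact Submodule.subset_span ⟨k, if_pos hk⟩
    · rcases eq_or_ne k z with rfl | hkz
      · refine Submodule.subset_span ⟨i, ?_⟩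
        rw [flagC, if_neg (lt_irrefl _), if_pos rfl, show n - 1 = (k : ℕ) by omega]
      · have h1 : (k : ℕ) + 1 < n := by
          have := k.2
          have : (k : ℕ) ≠ z := fun h => hkz (Fin.ext h)
          omega
        have h2 : (i : ℕ) ≤ k := hk
        refine Submodule.subset_span ⟨⟨k + 1, h1⟩, ?_⟩
        rw [flagC, if_neg (by rw [Fin.lt_def]; simp; omega), if_neg (by rw [Fin.ext_iff]; simp; omega)]
        rfl
  refine ⟨g, hg, fun l => ?_, fun l => col_inv_eq
    (v := fun l => (if l = i then 1 else 0) - (if l = i ∧ i ≠ i then 1 else 0)) (fun r => ?_) l⟩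
  · rw [← hg, flagC]
    have := l.2
    have := i.2
    rcases lt_trichotomy l i with h | rfl | h
    · have h' : (l : ℕ) < i := h
      rw [if_pos h, if_neg h.ne, e, if_neg (by omega)]
    · rw [if_neg (lt_irrefl _), if_pos rfl, if_pos rfl, e, if_pos (by omega)]
    · have h' : (i : ℕ) < l := h
      rw [if_neg h.not_gt, if_neg h.ne', if_neg h.ne', e, if_neg (by omega)]
  · simp only [Matrix.mulVec, dotProduct, ← hg]
    simp [flagC, e, show n - 1 = (z : ℕ) by omega, Fin.val_inj]

theorem exists_G_flagO (hz : z.val + 1 = n) {i j : Fin n} (hij : i < j) :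
    ∃ g : G n, (∀ k r, flagO i j k r = (g : 𝔤 n) r k) ∧ IsNormal z i j g := by
  have hi : flagO i j i = e n i + e n (n - 1) := by simp [flagO]
  have hj : flagO i j j = e n i := by simp [flagO, hij.not_gt, hij.ne']
  obtain ⟨g, hg⟩ := exists_G_of_columns (v := flagO i j) fun k => by
    rcases lt_trichotomy k i with hk | rfl | hk
    · exact Submodule.subset_span ⟨k, if_pos hk⟩
    · rw [← hj]
      exact Submodule.subset_span ⟨j, rfl⟩
    · rcases lt_or_ge k j with hk' | hk'
      · refine Submodule.subset_span ⟨k, ?_⟩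
        rw [flagO, if_neg hk.not_gt, if_neg hk.ne', if_pos hk']
      · rcases eq_or_ne k z with rfl | hkz
        -- The vector e_n is column i minus column j; this is also why the last column of the
        -- inverse is e_i - e_j.
        · have : e n k = flagO i j i - flagO i j j := by
            rw [hi, hj, add_sub_cancel_left, show n - 1 = (k : ℕ) by omega]
          rw [this]
          exact sub_mem (Submodule.subset_span ⟨i, rfl⟩) (Submodule.subset_span ⟨j, rfl⟩)
        · have h1 : (k : ℕ) + 1 < n := by
            have := k.2
            have : (k : ℕ) ≠ z := fun h => hkz (Fin.ext h)
            omega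
          have h2 : (i : ℕ) < k := hk
          have h3 : (j : ℕ) ≤ k := hk'
          refine Submodule.subset_span ⟨⟨k + 1, h1⟩, ?_⟩
          rw [flagO, if_neg, if_neg, if_neg, if_neg]
          · rfl
          all_goals simp only [Fin.lt_def, Fin.ext_iff]; omega
  have hij' : (i : ℕ) < j := hij
  refine ⟨g, hg, fun l => ?_, fun l => col_inv_eq
    (v := fun l => (if l = i then 1 else 0) - (if l = j ∧ i ≠ j then 1 else 0)) (fun r => ?_) l⟩
  · rw [← hg, flagO]
    have := l.2
    have := j.2
    rcases lt_trichotomy l i with h | rfl | h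
    · have h' : (l : ℕ) < i := h
      rw [if_pos h, if_neg h.ne, e, if_neg (by omega)]
    · rw [if_neg (lt_irrefl _), if_pos rfl, if_pos rfl, Pi.add_apply, e, e, if_neg (by omega),
        if_pos (by omega), zero_add]
    · have h' : (i : ℕ) < l := h
      rw [if_neg h.not_gt, if_neg h.ne', if_neg h.ne']
      rcases lt_trichotomy l j with h1 | rfl | h1
      · have h1' : (l : ℕ) < j := h1
        rw [if_pos h1, e, if_neg (by omega)]
      · rw [if_neg (lt_irrefl _), if_pos rfl, e, if_neg (by omega)]
      · have h1' : (j : ℕ) < l := h1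
        rw [if_neg h1.not_gt, if_neg h1.ne', e, if_neg (by omega)]
  · have : ((g : 𝔤 n) *ᵥ fun l => (if l = i then 1 else 0) - (if l = j ∧ i ≠ j then 1 else 0)) r =
        flagO i j i r - flagO i j j r := by
      simp [Matrix.mulVec, dotProduct, hg, mul_sub, Finset.sum_sub_distrib, hij.ne]
    rw [this, hi, hj]
    simp [e, show n - 1 = (z : ℕ) by omega, Fin.val_inj]

theorem QC_eq (hz : z.val + 1 = n) (i : Fin n) : QC i = typeSet z i i := by
  obtain ⟨g, hg, hn⟩ := exists_G_flagC hz i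
  rw [QC, flagStabilizer_eq g _ hg, orbit_eq_typeSet hz le_rfl (hn.hasType le_rfl)]

theorem QO_eq (hz : z.val + 1 = n) {i j : Fin n} (hij : i < j) : QO i j = typeSet z i j := by
  obtain ⟨g, hg, hn⟩ := exists_G_flagO hz hij
  rw [QO, flagStabilizer_eq g _ hg, orbit_eq_typeSet hz hij.le (hn.hasType hij.le)]

theorem exists_isNormal (hz : z.val + 1 = n) {i j : Fin n} (hij : i ≤ j) :
    ∃ g : G n, IsNormal z i j g := by
  rcases hij.eq_or_lt with rfl | hij
  · obtain ⟨g, -, hg⟩ := exists_G_flagC hz i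
    exact ⟨g, hg⟩
  · obtain ⟨g, -, hg⟩ := exists_G_flagO hz hij
    exact ⟨g, hg⟩

theorem isKOrbit_typeSet (hz : z.val + 1 = n) {i j : Fin n} (hij : i ≤ j) :
    IsKOrbit (typeSet z i j) := by
  obtain ⟨g, hg⟩ := exists_isNormal hz hij
  exact ⟨flagPt g, (orbit_eq_typeSet hz hij (hg.hasType hij)).symm⟩

theorem typeSet_injective (hz : z.val + 1 = n) {i j : Fin n} (hij : i ≤ j) {i' j' : ℕ}
    (h : typeSet z i j = typeSet z i' j') : (i : ℕ) = i' ∧ (j : ℕ) = j' := by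
  obtain ⟨g, hg⟩ := exists_isNormal hz hij
  have h1 := (flagPt_mem_typeSet hz).2 (hg.hasType hij)
  rw [h] at h1
  exact (hg.hasType hij).unique ((flagPt_mem_typeSet hz).1 h1)

end Types

/-! ### The topology of the flag variety -/

section FlagTopology

variable {n : ℕ} {z : Fin n}

/-- The coordinates on `G`. -/
def coG {n : ℕ} (g : G n) (q : Fin n × Fin n) : ℂ := (g : 𝔤 n) q.1 q.2

/-- The determinant as a polynomial. -/
noncomputable def detPoly (n : ℕ) : MvPolynomial (Fin n × Fin n) ℂ := (Matrix.mvPolynomialX (Fin n) (Fin n) ℂ).det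

theorem eval_detPoly {n : ℕ} (x : 𝔤 n) :
    MvPolynomial.eval (fun q : Fin n × Fin n => x q.1 q.2) (detPoly n) = x.det := by
  rw [detPoly, RingHom.map_det]
  congr 1
  ext a b
  simp

theorem det_G_ne {n : ℕ} (g : G n) : (g : 𝔤 n).det ≠ 0 :=
  ((Matrix.isUnit_iff_isUnit_det _).1 g.isUnit).ne_zero

theorem eval_detPoly_ne {n : ℕ} (g : G n) : MvPolynomial.eval (coG g) (detPoly n) ≠ 0 := by
  rw [show coG g = fun q : Fin n × Fin n => (g : 𝔤 n) q.1 q.2 from rfl, eval_detPoly]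
  exact det_G_ne g

theorem regFun_inv_entry (D : MvPolynomial (Fin n × Fin n) ℂ) (hD : detPoly n ∣ D) (a b : Fin n) :
    (fun g : G n => ((g⁻¹ : G n) : 𝔤 n) a b) ∈ regFun coG D := by
  have h : (fun g : G n => ((g⁻¹ : G n) : 𝔤 n) a b) =
      (fun g : G n => (MvPolynomial.eval (coG g) (detPoly n))⁻¹) *
        fun g : G n => (g : 𝔤 n).adjugate a b := by
    ext g
    rw [Pi.mul_apply, show coG g = fun q : Fin n × Fin n => (g : 𝔤 n) q.1 q.2 from rfl,
      eval_detPoly, Matrix.coe_units_inv, Matrix.inv_def, Ring.inverse_eq_inv', Matrix.smul_apply,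
      smul_eq_mul]
  rw [h]
  exact mul_mem (regFun_inv hD) (adjugate_mem _ (fun c d => regFun_coord (co := coG) (c, d)) a b)

theorem continuous_mul_right_zariski (h : G n) :
    @Continuous _ _ (zariski n) (zariski n) fun g => g * h :=
  continuous_zar (co := coG) (co' := coG) eval_detPoly_ne fun q =>
    matMul_mem (M := fun g : G n => (g : 𝔤 n)) (M' := fun _ => (h : 𝔤 n)) _
      (fun c d => regFun_coord (co := coG) (c, d)) (fun _ _ => regFun_const _) q.1 q.2

theorem map_flagPt (g h : G n) : (flagPt h).map (Ad g) = flagPt (g * h) :=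
  Subtype.ext (AdSub_mul g h (b₀ n)).symm

/-- All Borel subalgebras are conjugate, so the orbit maps differ by right translations, which are
Zariski continuous. A single orbit map therefore tests openness. -/
theorem isOpen_flag_iff {U : Set (𝓑 n)} :
    IsOpen U ↔ IsOpen[zariski n] {g : G n | flagPt g ∈ U} := by
  change IsOpen[flagTopology (zariski n) Ad] U ↔ _
  rw [flagTopology, isOpen_iSup_iff]
  constructor
  · intro h
    have := h (flagPt 1)
    rw [isOpen_coinduced] at this
    convert this using 1
    ext g
    rw [Set.mem_preimage, map_flagPt, mul_one]
    rfl
  · intro h x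
    obtain ⟨g, rfl⟩ := flagPt_surjective x
    rw [isOpen_coinduced]
    convert @Continuous.isOpen_preimage _ _ (zariski n) (zariski n) _
      (continuous_mul_right_zariski g) _ h using 1
    ext g'
    rw [Set.mem_preimage, map_flagPt]
    rfl

/-- The line is drawn in the space of all matrices, and may leave G at finitely many parameters. -/
theorem exists_finite_line_G {U₀ U₁ : Set (G n)} (h₀ : IsOpen[zariski n] U₀)
    (h₁ : IsOpen[zariski n] U₁) {g₀ g₁ : G n} (hg₀ : g₀ ∈ U₀) (hg₁ : g₁ ∈ U₁) :
    ∃ F : Finset ℂ, ∀ t ∉ F, ∃ g ∈ U₀ ∩ U₁, (g : 𝔤 n) = (1 - t) • (g₀ : 𝔤 n) + t • (g₁ : 𝔤 n) := by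
  obtain ⟨p₀, hp₀, hp₀'⟩ := exists_poly_of_isOpen (co := coG) h₀ hg₀
  obtain ⟨p₁, hp₁, hp₁'⟩ := exists_poly_of_isOpen (co := coG) h₁ hg₁
  -- The determinant is a factor of the first polynomial in order that the points found be
  -- invertible.
  obtain ⟨F, hF⟩ := exists_finite_line
    (isOpen_zar_ne (fun (x : 𝔤 n) (q : Fin n × Fin n) => x q.1 q.2) (p₀ * detPoly n))
    (isOpen_zar_ne _ p₁) (x₀ := (g₀ : 𝔤 n)) (x₁ := (g₁ : 𝔤 n))
    (by rw [Set.mem_ofPred_eq, map_mul]; exact mul_ne_zero hp₀ (eval_detPoly_ne g₀)) hp₁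
  refine ⟨F, fun t ht => ?_⟩
  obtain ⟨h2, h3⟩ := hF t ht ((1 - t) • (g₀ : 𝔤 n) + t • (g₁ : 𝔤 n)) fun q => by simp
  rw [Set.mem_ofPred_eq, map_mul, eval_detPoly] at h2
  have hu : IsUnit ((1 - t) • (g₀ : 𝔤 n) + t • (g₁ : 𝔤 n)) := by
    rw [Matrix.isUnit_iff_isUnit_det, isUnit_iff_ne_zero]
    exact right_ne_zero_of_mul h2
  exact ⟨hu.unit, ⟨hp₀' _ (left_ne_zero_of_mul h2), hp₁' _ h3⟩, rfl⟩

theorem isOpen_not_rowVanish (z : Fin n) (a : ℕ) :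
    IsOpen[zariski n] {g : G n | ¬ RowVanish z g a} := by
  refine isOpen_zar_of_forall (co := coG) fun g hg => ?_
  obtain ⟨l, hl, hgl⟩ : ∃ l : Fin n, (l : ℕ) < a ∧ (g : 𝔤 n) z l ≠ 0 := by
    simpa [RowVanish] using hg
  refine ⟨MvPolynomial.X (z, l), by rwa [MvPolynomial.eval_X], fun h hh hv => hh ?_⟩
  rw [MvPolynomial.eval_X]
  exact hv l hl

theorem isOpen_not_colVanish (z : Fin n) (b : ℕ) :
    IsOpen[zariski n] {g : G n | ¬ ColVanish z g b} := by
  have : {g : G n | ¬ ColVanish z g b} = ⋃ l : Fin n, ⋃ _ : b ≤ (l : ℕ),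
      {g : G n | MvPolynomial.eval (coG g) (detPoly n) ≠ 0 ∧ ((g⁻¹ : G n) : 𝔤 n) l z ≠ 0} := by
    ext g
    simp [ColVanish, eval_detPoly_ne]
  rw [this]
  let := zariski n
  exact isOpen_iUnion fun l => isOpen_iUnion fun _ =>
    isOpen_regFun_ne (co := coG) (regFun_inv_entry _ dvd_rfl l z)

theorem isOpen_flag_not_rowVanish (z : Fin n) (a : ℕ) :
    IsOpen {x : 𝓑 n | ∃ g, x = flagPt g ∧ ¬ RowVanish z g a} := by
  rw [isOpen_flag_iff]
  convert isOpen_not_rowVanish z a using 1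
  ext g
  refine ⟨?_, fun h => ⟨g, rfl, h⟩⟩
  rintro ⟨h, heq, hh⟩
  rw [← mul_inv_cancel_left g h] at hh
  rwa [rowVanish_mul_iff ((flagPt_eq_iff.1 heq).preserves a)] at hh

theorem isOpen_flag_not_colVanish (z : Fin n) (b : ℕ) :
    IsOpen {x : 𝓑 n | ∃ g, x = flagPt g ∧ ¬ ColVanish z g b} := by
  rw [isOpen_flag_iff]
  convert isOpen_not_colVanish z b using 1
  ext g
  refine ⟨?_, fun h => ⟨g, rfl, h⟩⟩
  rintro ⟨h, heq, hh⟩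
  rw [← mul_inv_cancel_left g h] at hh
  rwa [colVanish_mul_iff ((flagPt_eq_iff.1 heq).preserves b)] at hh

/-! ### Open and closed orbits -/

/-- For a flag of type (a, b), the two closed conditions say i ≤ a and b ≤ i; together with a ≤ b
they force a = b = i. -/
theorem isClosed_typeSet_diag (hz : z.val + 1 = n) (i : Fin n) : IsClosed (typeSet z i i) := by
  rw [← isOpen_compl_iff]
  convert (isOpen_flag_not_rowVanish z i).union (isOpen_flag_not_colVanish z (i + 1)) using 1
  ext x
  obtain ⟨g, rfl⟩ := flagPt_surjective x
  rw [Set.mem_compl_iff, flagPt_mem_typeSet hz]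
  constructor
  · intro h
    by_cases h1 : RowVanish z g i
    · by_cases h2 : ColVanish z g (i + 1)
      · obtain ⟨a, b, hab, hg⟩ := exists_hasType z g
        have h3 : ¬ (a : ℕ) < i := fun hlt => hg.row' (h1.mono hlt)
        have h4 : ¬ (i : ℕ) < b := fun hlt => hg.col' (h2.mono hlt)
        have h5 : (a : ℕ) ≤ b := hab
        have h6 : a = i := Fin.ext (by omega)
        have h7 : b = i := Fin.ext (by omega)
        rw [h6, h7] at hg
        exact absurd hg h
      · exact Or.inr ⟨g, rfl, h2⟩
    · exact Or.inl ⟨g, rfl, h1⟩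
  · rintro (⟨h, heq, hh⟩ | ⟨h, heq, hh⟩) hg <;> rw [← flagPt_mem_typeSet hz, heq,
      flagPt_mem_typeSet hz] at hg
    · exact hh hg.row
    · exact hh hg.col

/-- The elementary matrix `1 + E_{j,i}` as an element of `G`, for `i ≠ j`. -/
def elemG (j i : Fin n) (h : j ≠ i) (t : ℂ) : G n :=
  ⟨Matrix.transvection j i t, Matrix.transvection j i (-t),
    by rw [Matrix.transvection_mul_transvection_same _ _ h, add_neg_cancel, Matrix.transvection_zero],
    by rw [Matrix.transvection_mul_transvection_same _ _ h, neg_add_cancel, Matrix.transvection_zero]⟩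

/-- The factor leaves φ = ε_i unchanged, since φ_j = 0, and turns ψ = e_i into e_i - t e_j. -/
theorem IsNormal.mul_elemG {i j : Fin n} (hij : i < j) {g : G n} (hg : IsNormal z i i g) {t : ℂ}
    (ht : t ≠ 0) : HasType z i j (g * elemG j i hij.ne' t) := by
  have hrow : ∀ l, ((g * elemG j i hij.ne' t : G n) : 𝔤 n) z l = if l = i then 1 else 0 := by
    intro l
    change ((g : 𝔤 n) * (1 + single j i t)) z l = _
    rw [Matrix.mul_add, Matrix.mul_one, Matrix.add_apply, hg.row]
    by_cases hl : l = i
    · subst hl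
      rw [Matrix.mul_single_apply_same, hg.row, if_neg hij.ne']
      simp
    · rw [Matrix.mul_single_apply_of_ne _ _ _ _ _ hl, add_zero]
  have hcol : ∀ l, (((g * elemG j i hij.ne' t)⁻¹ : G n) : 𝔤 n) l z =
      (if l = i then 1 else 0) - if l = j then t else 0 := by
    intro l
    rw [_root_.mul_inv_rev]
    change ((1 + single j i (-t)) * ((g⁻¹ : G n) : 𝔤 n)) l z = _
    rw [Matrix.add_mul, Matrix.one_mul, Matrix.add_apply, hg.col]
    by_cases hl : l = j
    · subst hl
      rw [Matrix.single_mul_apply_same, hg.col]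
      simp [hij.ne', sub_eq_add_neg]
    · rw [Matrix.single_mul_apply_of_ne _ _ _ _ _ hl]
      simp [hl]
  refine hasType_of_ne (fun l hl => ?_) (by simp [hrow]) (fun l hl => ?_)
    (by rw [hcol]; simpa [hij.ne'] using ht)
  · rw [hrow, if_neg (by rintro rfl; omega)]
  · have h1 : (i : ℕ) < j := hij
    rw [hcol, if_neg (by rintro rfl; omega), if_neg (by rintro rfl; omega), sub_zero]

/-- A flag of type (i, i) is the value at t = 0 of a line whose other points have type (i, j). -/
theorem not_isClosed_typeSet (hz : z.val + 1 = n) {i j : Fin n} (hij : i < j) :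
    ¬ IsClosed (typeSet z i j) := by
  intro h
  obtain ⟨g, hg⟩ := exists_isNormal hz (le_refl i)
  have h1 := isOpen_flag_iff.1 h.isOpen_compl
  have h2 : g ∈ {g : G n | flagPt g ∈ (typeSet z i j)ᶜ} := by
    rw [Set.mem_ofPred_eq, Set.mem_compl_iff, flagPt_mem_typeSet hz]
    intro h3
    have := (h3.unique (hg.hasType le_rfl)).2
    exact hij.ne' (Fin.ext this)
  -- If the complement were open, it would contain almost all points of the line because it contains
  -- the end t = 0.
  obtain ⟨F, hF⟩ := exists_finite_line_G h1 (@isOpen_univ _ (zariski n)) h2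
    (Set.mem_univ (g * elemG j i hij.ne' 1))
  obtain ⟨t, ht⟩ := Infinite.exists_notMem_finset (insert 0 F)
  rw [Finset.mem_insert, not_or] at ht
  obtain ⟨x, ⟨hx, -⟩, hx'⟩ := hF t ht.2
  have h4 : x = g * elemG j i hij.ne' t := by
    ext1
    rw [hx', Units.val_mul, Units.val_mul]
    change _ + t • ((g : 𝔤 n) * (1 + single j i 1)) = (g : 𝔤 n) * (1 + single j i t)
    rw [Matrix.mul_add, Matrix.mul_add, Matrix.mul_one, smul_add, ← add_assoc, ← add_smul,
      sub_add_cancel, one_smul, ← Matrix.mul_smul, Matrix.smul_single, smul_eq_mul, mul_one]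
  rw [h4] at hx
  exact hx ((flagPt_mem_typeSet hz).2 (hg.mul_elemG hij ht.1))

theorem nonempty_inter_of_isOpen {U V : Set (𝓑 n)} (hU : IsOpen U) (hV : IsOpen V)
    (hU' : U.Nonempty) (hV' : V.Nonempty) : (U ∩ V).Nonempty := by
  obtain ⟨x, hx⟩ := hU'
  obtain ⟨y, hy⟩ := hV'
  obtain ⟨g, rfl⟩ := flagPt_surjective x
  obtain ⟨h, rfl⟩ := flagPt_surjective y
  obtain ⟨F, hF⟩ := exists_finite_line_G (isOpen_flag_iff.1 hU) (isOpen_flag_iff.1 hV)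
    (g₀ := g) (g₁ := h) hx hy
  obtain ⟨t, ht⟩ := Infinite.exists_notMem_finset F
  obtain ⟨k, hk, -⟩ := hF t ht
  exact ⟨flagPt k, hk⟩

theorem typeSet_eq_of_mem (hz : z.val + 1 = n) {i j i' j' : ℕ} {x : 𝓑 n} (h : x ∈ typeSet z i j)
    (h' : x ∈ typeSet z i' j') : typeSet z i j = typeSet z i' j' := by
  obtain ⟨g, rfl⟩ := flagPt_surjective x
  obtain ⟨rfl, rfl⟩ := ((flagPt_mem_typeSet hz).1 h).unique ((flagPt_mem_typeSet hz).1 h')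
  rfl

theorem typeSet_nonempty (hz : z.val + 1 = n) {i j : Fin n} (hij : i ≤ j) :
    (typeSet z i j).Nonempty := by
  obtain ⟨g, hg⟩ := exists_isNormal hz hij
  exact ⟨_, g, rfl, hg.hasType hij⟩

/-- At the extreme type the two vanishing conditions are vacuous, and only the open conditions
remain. -/
theorem isOpen_typeSet (hz : z.val + 1 = n) : IsOpen (typeSet z 0 z) := by
  convert (isOpen_flag_not_rowVanish z 1).inter (isOpen_flag_not_colVanish z z) using 1
  ext x
  constructor
  · rintro ⟨g, rfl, hg⟩
    exact ⟨⟨g, rfl, hg.row'⟩, ⟨g, rfl, hg.col'⟩⟩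
  · rintro ⟨⟨g, rfl, hg⟩, ⟨h, heq, hh⟩⟩
    rw [← mul_inv_cancel_left g h, colVanish_mul_iff ((flagPt_eq_iff.1 heq).preserves z)] at hh
    exact ⟨g, rfl, fun l hl => absurd hl (Nat.not_lt_zero _), hg, fun l hl => by omega, hh⟩

theorem isOpen_typeSet_iff (hz : z.val + 1 = n) {i j : Fin n} (hij : i ≤ j) :
    IsOpen (typeSet z i j) ↔ typeSet z i j = typeSet z 0 z := by
  refine ⟨fun h => ?_, fun h => h ▸ isOpen_typeSet hz⟩
  have h0 : (typeSet z 0 z).Nonempty :=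
    typeSet_nonempty hz (i := ⟨0, z.pos⟩) (j := z) (Nat.zero_le _)
  obtain ⟨x, hx, hx'⟩ := nonempty_inter_of_isOpen h (isOpen_typeSet hz) (typeSet_nonempty hz hij) h0
  exact typeSet_eq_of_mem hz hx hx'

/-! ### The action of simple reflections -/

/-- The parabolic moves only the step of dimension k + 1 of the flag. Invariants read at other steps
are thus constant along the fibres of π_k. -/
theorem preserves_of_mem_P {k a : ℕ} (ha : a ≠ k + 1) {p : G n} (hp : p ∈ P n k) :
    Preserves a (p : 𝔤 n) := fun l m hl hm =>
  hp l m (show (m : ℕ) < l by omega) (by omega)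

theorem isUpper_mul_mem_P {k : ℕ} {b p : G n} (hb : IsUpper 0 (b : 𝔤 n)) (hp : p ∈ P n k) :
    b * p ∈ P n k := by
  intro a c hca hne
  rw [Units.val_mul, Matrix.mul_apply]
  refine Finset.sum_eq_zero fun l _ => ?_
  have h1 : (c : ℕ) < a := hca
  rcases lt_or_ge (l : ℕ) a with hl | hl
  · rw [hb a l (by omega), zero_mul]
  · rw [hp l c (show (c : ℕ) < l by omega) (by omega), mul_zero]

theorem mem_saturation_iff (hz : z.val + 1 = n) {k i j : ℕ} {x : 𝓑 n} :
    x ∈ saturation k (typeSet z i j) ↔ ∃ g p, HasType z i j g ∧ p ∈ P n k ∧ x = flagPt (g * p) := by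
  constructor
  · rintro ⟨g, ⟨y, hy, hyg⟩, p, hp, hx⟩
    have : y = flagPt g := Subtype.ext hyg
    subst this
    exact ⟨g, p, (flagPt_mem_typeSet hz).1 hy, hp, Subtype.ext hx⟩
  · rintro ⟨g, p, hg, hp, rfl⟩
    exact ⟨g, ⟨flagPt g, ⟨g, rfl, hg⟩, rfl⟩, p, hp, rfl⟩

/-- One relatively open orbit in the saturation is enough: it is then the only one. Modulo K, points
of two such orbits come from the same coset g₀P_k, and a line joining their representatives stays in
this coset wherever it is invertible, so the two open sets meet inside the saturation. -/
theorem m_eq (hz : z.val + 1 = n) {k : ℕ} {i j i' j' : Fin n} (hij : i ≤ j) (hij' : i' ≤ j')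
    (U : Set (𝓑 n)) (hU : IsOpen U)
    (h : typeSet z i' j' = U ∩ saturation k (typeSet z i j)) :
    m k (typeSet z i j) = typeSet z i' j' := by
  have hex : ∃! Q' : Set (𝓑 n), IsOpenOrbitIn k (typeSet z i j) Q' := by
    refine ⟨typeSet z i' j', ⟨isKOrbit_typeSet hz hij', U, hU, h⟩, ?_⟩
    rintro Q ⟨hQ, V, hV, rfl⟩
    obtain ⟨a, b, hab, hQ'⟩ := hQ.exists_typeSet hz
    obtain ⟨x, hx⟩ := typeSet_nonempty hz hab
    obtain ⟨y, hy⟩ := typeSet_nonempty hz hij'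
    have hx' := hx
    have hy' := hy
    rw [← hQ'] at hx
    rw [h] at hy
    obtain ⟨hxV, hxs⟩ := hx
    obtain ⟨hyU, hys⟩ := hy
    obtain ⟨g₁, p₁, hg₁, hp₁, rfl⟩ := (mem_saturation_iff hz).1 hxs
    obtain ⟨g₀, p₀, hg₀, hp₀, rfl⟩ := (mem_saturation_iff hz).1 hys
    -- The factor c in K is dropped, because it does not change the orbit, and d is absorbed into
    -- P_k.
    obtain ⟨c, hc, d, hd, rfl⟩ := hg₀.exists_eq_mul hz hij hg₁
    have hx₂ : flagPt (g₀ * (d * p₁)) ∈ V := by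
      rw [flagPt_mem_typeSet hz] at hx'
      have h1 : HasType z a b (g₀ * (d * p₁)) := by
        rw [← hasType_mul_iff hz hc (b := 1) (by rw [Units.val_one]; exact Matrix.blockTriangular_one)]
        simpa only [mul_one, mul_assoc] using hx'
      have h2 := (flagPt_mem_typeSet hz).2 h1
      rw [← hQ'] at h2
      exact h2.1
    have hp₂ := isUpper_mul_mem_P hd hp₁
    obtain ⟨F, hF⟩ := exists_finite_line_G (isOpen_flag_iff.1 hV) (isOpen_flag_iff.1 hU)
      (g₀ := g₀ * (d * p₁)) (g₁ := g₀ * p₀) hx₂ hyU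
    obtain ⟨t, ht⟩ := Infinite.exists_notMem_finset F
    obtain ⟨w, ⟨hwV, hwU⟩, hw⟩ := hF t ht
    have hws : flagPt w ∈ saturation k (typeSet z i j) := by
      -- The shape of P_k is given by linear equations, which persist on the line.
      refine (mem_saturation_iff hz).2 ⟨g₀, g₀⁻¹ * w, hg₀, fun r s hrs hne => ?_, by simp⟩
      rw [Units.val_mul, hw, Units.val_mul g₀, Units.val_mul g₀, ← Matrix.mul_smul, ← Matrix.mul_smul,
        ← Matrix.mul_add, ← Matrix.mul_assoc, ← Units.val_mul, inv_mul_cancel, Units.val_one,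
        Matrix.one_mul, Matrix.add_apply, Matrix.smul_apply, Matrix.smul_apply, hp₂ r s hrs hne,
        hp₀ r s hrs hne, smul_zero, smul_zero, add_zero]
    have h1 : flagPt w ∈ typeSet z a b := hQ' ▸ ⟨hwV, hws⟩
    have h2 : flagPt w ∈ typeSet z i' j' := h ▸ ⟨hwU, hws⟩
    rw [hQ']
    exact typeSet_eq_of_mem hz h1 h2
  rw [m, dif_pos hex]
  exact (hex.unique hex.choose_spec.1 ⟨isKOrbit_typeSet hz hij', U, hU, h⟩)

end FlagTopology

/-! ### The orbits m(s_k) · Q. -/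

section SimpleReflections

variable {n : ℕ} {z : Fin n}

/-- The saturation is stable under K, so one point of the orbit suffices. -/
theorem typeSet_subset_saturation (hz : z.val + 1 = n) {k i j : ℕ} {i' j' : Fin n} (hij' : i' ≤ j')
    {g p : G n} (hg : HasType z i j g) (hp : p ∈ P n k) (hgp : HasType z i' j' (g * p)) :
    typeSet z i' j' ⊆ saturation k (typeSet z i j) := by
  rintro _ ⟨h, rfl, hh⟩
  obtain ⟨c, hc, b, hb, rfl⟩ := hgp.exists_eq_mul hz hij' hh
  refine (mem_saturation_iff hz).2 ⟨c * g, p, ?_, hp, ?_⟩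
  · have := hasType_mul_iff (g := g) (i := i) (j := j) hz hc (b := 1)
      (by rw [Units.val_one]; exact Matrix.blockTriangular_one)
    rw [mul_one] at this
    exact this.2 hg
  · refine (flagPt_eq_iff.2 ?_).symm
    rwa [← mul_assoc c, inv_mul_cancel_left]

theorem mul_permG_apply (σ : Equiv.Perm (Fin n)) (M : 𝔤 n) (a l : Fin n) :
    (M * (permG σ : 𝔤 n)) a l = M a (σ l) := by
  simp [permG, Matrix.mul_apply, Equiv.Perm.permMatrix, PEquiv.toMatrix_apply,
    Equiv.toPEquiv_apply, Equiv.symm_apply_eq, Equiv.Perm.inv_def]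

theorem permG_inv_mul_apply (σ : Equiv.Perm (Fin n)) (M : 𝔤 n) (a l : Fin n) :
    (((permG σ)⁻¹ : G n) * M : 𝔤 n) l a = M (σ l) a := by
  change (σ.permMatrix ℂ * M) l a = _
  simp [Matrix.mul_apply, Equiv.Perm.permMatrix, PEquiv.toMatrix_apply, Equiv.toPEquiv_apply]

theorem permG_swap_mem_P {a b : Fin n} (hab : (a : ℕ) + 1 = b) : permG (Equiv.swap a b) ∈ P n a := by
  intro r s hsr hne
  have h := mul_permG_apply (Equiv.swap a b) 1 r s
  rw [Matrix.one_mul] at h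
  rw [h, Matrix.one_apply, if_neg]
  have : (s : ℕ) < r := hsr
  rw [Equiv.swap_apply_def]
  split_ifs <;> simp only [Fin.ext_iff] at * <;> omega

theorem IsNormal.mul_swap {i j a b : Fin n} {g : G n} (hg : IsNormal z i j g)
    (hij' : Equiv.swap a b i < Equiv.swap a b j) :
    HasType z (Equiv.swap a b i : Fin n) (Equiv.swap a b j : Fin n) (g * permG (Equiv.swap a b)) := by
  refine IsNormal.hasType ⟨fun l => ?_, fun l => ?_⟩ hij'.le
  · rw [Units.val_mul, mul_permG_apply, hg.row]
    simp [Equiv.swap_apply_eq_iff]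
  · rw [_root_.mul_inv_rev, Units.val_mul, permG_inv_mul_apply, hg.col]
    simp [Equiv.swap_apply_eq_iff]

/-- Here the step of dimension i + 1 is free. The surviving conditions say that the flag leaves H at
i or later and contains L at i + 1 or earlier; requiring that it has left H, but does not yet
contain L, in the free step is open and singles out (i, i + 1). -/
theorem m_typeSet_diag (hz : z.val + 1 = n) {i j : Fin n} (hij : (i : ℕ) + 1 = j) :
    m (i : ℕ) (typeSet z i i) = typeSet z i j := by
  have hlt : i < j := show (i : ℕ) < j by omega
  refine m_eq hz le_rfl hlt.le _ ((isOpen_flag_not_rowVanish z (i + 1)).inter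
    (isOpen_flag_not_colVanish z (i + 1))) (Set.Subset.antisymm (fun x hx => ⟨?_, ?_⟩) ?_)
  · obtain ⟨g, rfl, hg⟩ := hx
    exact ⟨⟨g, rfl, hg.row'⟩, ⟨g, rfl, hij ▸ hg.col'⟩⟩
  · obtain ⟨g, hg⟩ := exists_isNormal hz (le_refl i)
    refine typeSet_subset_saturation hz hlt.le (hg.hasType le_rfl)
      (p := elemG j i hlt.ne' 1) ?_ (hg.mul_elemG hlt one_ne_zero) hx
    intro a b hba hne
    change (1 + single j i 1 : 𝔤 n) a b = 0
    rw [Matrix.add_apply, Matrix.one_apply_ne hba.ne', zero_add, Matrix.single_apply, if_neg]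
    rintro ⟨rfl, rfl⟩
    exact hne ⟨rfl, hij.symm⟩
  · rintro _ ⟨⟨⟨g, rfl, hg⟩, ⟨h, heq, hh⟩⟩, hs⟩
    rw [← mul_inv_cancel_left g h, colVanish_mul_iff ((flagPt_eq_iff.1 heq).preserves _)] at hh
    obtain ⟨w, p, hw, hp, heq'⟩ := (mem_saturation_iff hz).1 hs
    have hb := flagPt_eq_iff.1 heq'.symm
    refine ⟨g, rfl, ?_, hg, ?_, hij ▸ hh⟩ <;> rw [← mul_inv_cancel_left (w * p) g]
    · rw [rowVanish_mul_iff (hb.preserves _), rowVanish_mul_iff (preserves_of_mem_P (by omega) hp)]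
      exact hw.row
    · rw [colVanish_mul_iff (hb.preserves _), colVanish_mul_iff (preserves_of_mem_P (by omega) hp)]
      exact hw.col.mono (by omega)

/-- With the step of dimension j + 1 free, i is preserved and L is absorbed at j + 1 at the latest;
the open condition is that this is not earlier. A transposition of columns supplies a point. -/
theorem m_typeSet_right (hz : z.val + 1 = n) {i j j' : Fin n} (hij : i < j) (hj : (j : ℕ) + 1 = j') :
    m (j : ℕ) (typeSet z i j) = typeSet z i j' := by
  have hij0 : (i : ℕ) < j := hij
  have hlt : i < j' := show (i : ℕ) < j' by omega
  refine m_eq hz hij.le hlt.le _ (isOpen_flag_not_colVanish z (j + 1))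
    (Set.Subset.antisymm (fun x hx => ⟨?_, ?_⟩) ?_)
  · obtain ⟨g, rfl, hg⟩ := hx
    exact ⟨g, rfl, hj ▸ hg.col'⟩
  · obtain ⟨g, hg⟩ := exists_isNormal hz hij.le
    have h1 : Equiv.swap j j' i = i := Equiv.swap_apply_of_ne_of_ne hij.ne hlt.ne
    have h2 := hg.mul_swap (a := j) (b := j') (by rwa [h1, Equiv.swap_apply_left])
    rw [h1, Equiv.swap_apply_left] at h2
    exact typeSet_subset_saturation hz hlt.le (hg.hasType hij.le) (permG_swap_mem_P hj) h2 hx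
  · rintro _ ⟨⟨g, rfl, hg⟩, hs⟩
    obtain ⟨w, p, hw, hp, heq'⟩ := (mem_saturation_iff hz).1 hs
    have hb := flagPt_eq_iff.1 heq'.symm
    refine ⟨g, rfl, ?_, ?_, ?_, hj ▸ hg⟩ <;> rw [← mul_inv_cancel_left (w * p) g]
    · rw [rowVanish_mul_iff (hb.preserves _), rowVanish_mul_iff (preserves_of_mem_P (by omega) hp)]
      exact hw.row
    · rw [rowVanish_mul_iff (hb.preserves _), rowVanish_mul_iff (preserves_of_mem_P (by omega) hp)]
      exact hw.row'
    · rw [colVanish_mul_iff (hb.preserves _), colVanish_mul_iff (preserves_of_mem_P (by omega) hp)]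
      exact hw.col.mono (by omega)

/-- With the step of dimension i free, j is preserved and the flag leaves H at i - 1 at the
earliest; the open condition is that it does so. -/
theorem m_typeSet_left (hz : z.val + 1 = n) {i i' j : Fin n} (hij : i < j) (hi : (i' : ℕ) + 1 = i) :
    m (i' : ℕ) (typeSet z i j) = typeSet z i' j := by
  have hij0 : (i : ℕ) < j := hij
  have hlt' : i' < i := show (i' : ℕ) < i by omega
  have hlt : i' < j := hlt'.trans hij
  refine m_eq hz hij.le hlt.le _ (isOpen_flag_not_rowVanish z i)
    (Set.Subset.antisymm (fun x hx => ⟨?_, ?_⟩) ?_)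
  · obtain ⟨g, rfl, hg⟩ := hx
    exact ⟨g, rfl, hi ▸ hg.row'⟩
  · obtain ⟨g, hg⟩ := exists_isNormal hz hij.le
    have h1 : Equiv.swap i' i j = j := Equiv.swap_apply_of_ne_of_ne hlt.ne' hij.ne'
    have h2 := hg.mul_swap (a := i') (b := i) (by rwa [h1, Equiv.swap_apply_right])
    rw [h1, Equiv.swap_apply_right] at h2
    exact typeSet_subset_saturation hz hlt.le (hg.hasType hij.le) (permG_swap_mem_P hi) h2 hx
  · rintro _ ⟨⟨g, rfl, hg⟩, hs⟩
    obtain ⟨w, p, hw, hp, heq'⟩ := (mem_saturation_iff hz).1 hs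
    have hb := flagPt_eq_iff.1 heq'.symm
    refine ⟨g, rfl, ?_, hi ▸ hg, ?_, ?_⟩ <;> rw [← mul_inv_cancel_left (w * p) g]
    · rw [rowVanish_mul_iff (hb.preserves _), rowVanish_mul_iff (preserves_of_mem_P (by omega) hp)]
      exact hw.row.mono (by omega)
    · rw [colVanish_mul_iff (hb.preserves _), colVanish_mul_iff (preserves_of_mem_P (by omega) hp)]
      exact hw.col
    · rw [colVanish_mul_iff (hb.preserves _), colVanish_mul_iff (preserves_of_mem_P (by omega) hp)]
      exact hw.col'

theorem foldl_m_typeSet (hz : z.val + 1 = n) (i : Fin n) (d : ℕ) (hd : (i : ℕ) + d < n) :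
    (List.range' (i : ℕ) d).foldl (fun Q k => m k Q) (typeSet z i i) = typeSet z i (i + d) := by
  induction d with
  | zero => rfl
  | succ d ih =>
    rw [List.range'_concat, List.foldl_append, ih (by omega), List.foldl_cons, List.foldl_nil, one_mul]
    -- Only the first reflection starts from a closed orbit; all the later ones raise j.
    rcases Nat.eq_zero_or_pos d with rfl | hd0
    · exact m_typeSet_diag hz (j := ⟨i + 1, hd⟩) rfl
    · exact m_typeSet_right hz (i := i) (j := ⟨i + d, by omega⟩) (j' := ⟨i + (d + 1), hd⟩)
        (show (i : ℕ) < i + d by omega) rfl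

end SimpleReflections

/-! ### The involution attached to a representative -/

section Springer

variable {n : ℕ} {z : Fin n}

theorem mem_T₀_iff {g : G n} : g ∈ T₀ n ↔ ∀ a b, a ≠ b → (g : 𝔤 n) a b = 0 := by
  constructor
  · rintro ⟨d, rfl⟩ a b hab
    exact Matrix.diagonal_apply_ne _ hab
  · intro h
    have hd : (g : 𝔤 n) = Matrix.diagonal fun a => (g : 𝔤 n) a a := by
      ext a b
      by_cases hab : a = b
      · subst hab; simp
      · rw [h a b hab, Matrix.diagonal_apply_ne _ hab]
    have hne : ∀ a, (g : 𝔤 n) a a ≠ 0 := by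
      have := det_G_ne g
      rw [hd, Matrix.det_diagonal] at this
      exact fun a => Finset.prod_ne_zero_iff.1 this a (Finset.mem_univ a)
    refine ⟨⟨fun a => (g : 𝔤 n) a a, fun a => ((g : 𝔤 n) a a)⁻¹, ?_, ?_⟩, Units.ext hd.symm⟩
    · ext a; exact mul_inv_cancel₀ (hne a)
    · ext a; exact inv_mul_cancel₀ (hne a)

theorem c_mem_T₀ (n : ℕ) : c n ∈ T₀ n := mem_T₀_iff.2 fun _ _ hab => Matrix.diagonal_apply_ne _ hab

theorem T₀_le_N (n : ℕ) : T₀ n ≤ N n := Subgroup.le_normalizer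

/-- The element `v⁻¹ c v`, conjugation by which is `θ_v`. -/
noncomputable def cConj (v : G n) : G n := v⁻¹ * c n * v

theorem θᵥ_eq (v : G n) (x : 𝔤 n) : θᵥ v x = Ad (cConj v) x := by
  rw [θᵥ, dθ, ← Ad_mul, ← Ad_mul, cConj]

theorem cConj_inv (v : G n) : (cConj v)⁻¹ = cConj v := by
  rw [cConj, _root_.mul_inv_rev, _root_.mul_inv_rev, inv_inv, mul_assoc]
  rfl

/-- As c is diagonal, τ(v) may be replaced by v⁻¹cv both for membership in N and for the class
modulo T₀. -/
theorem τ_eq (v : G n) : τ v = cConj v * c n := by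
  rw [τ, cConj, θ, MulAut.conj_apply, show (c n)⁻¹ = c n from rfl]
  simp only [mul_assoc]

theorem mem_𝓥_iff {v : G n} : v ∈ 𝓥 n ↔ cConj v ∈ N n := by
  change τ v ∈ N n ↔ _
  rw [τ_eq]
  exact Subgroup.mul_mem_cancel_right _ (T₀_le_N n (c_mem_T₀ n))

/-- Since c = 1 - 2E_{zz} for the last index z, the conjugate is 1 - 2ψφ and depends only on φ and
ψ. -/
theorem cConj_apply (hz : z.val + 1 = n) (v : G n) (a b : Fin n) :
    (cConj v : 𝔤 n) a b =
      (if a = b then 1 else 0) - 2 * ((v⁻¹ : G n) : 𝔤 n) a z * (v : 𝔤 n) z b := by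
  have hc : (c n : 𝔤 n) = 1 - single z z 2 := by
    ext r s
    simp only [c, Matrix.diagonal_apply, Matrix.sub_apply, Matrix.one_apply, Matrix.single_apply]
    by_cases hrs : r = s
    · subst hrs
      by_cases hr : r = z
      · subst hr; simp [hz]; norm_num
      · have : ¬ r.val + 1 = n := fun h => hr (Fin.ext (by omega))
        simp [this, Ne.symm hr]
    · have : ¬ (z = r ∧ z = s) := by rintro ⟨rfl, rfl⟩; exact hrs rfl
      simp [hrs, this]
  rw [cConj, Units.val_mul, Units.val_mul, hc, Matrix.mul_sub, Matrix.mul_one, Matrix.sub_mul,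
    ← Units.val_mul, inv_mul_cancel, Units.val_one, Matrix.sub_apply, Matrix.one_apply]
  congr 1
  rw [Matrix.mul_apply, Finset.sum_eq_single z, Matrix.mul_single_apply_same]
  · ring
  · intro l _ hl
    rw [Matrix.mul_single_apply_of_ne _ _ _ _ _ hl, zero_mul]
  · exact fun h => absurd (Finset.mem_univ _) h

/-- The matrix u = v⁻¹cv is its own inverse. Conjugating the diagonal matrix 1 + E_{kk} by it gives
1 plus (column k of u) times (row k of u), which must again be diagonal. -/
theorem cConj_mul_eq_zero {v : G n} (hv : v ∈ 𝓥 n) {a b : Fin n} (hab : a ≠ b) (k : Fin n) :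
    (cConj v : 𝔤 n) a k * (cConj v : 𝔤 n) k b = 0 := by
  have hne : ∀ l, (1 + if l = k then 1 else 0 : ℂ) ≠ 0 := fun l => by split_ifs <;> norm_num
  let t : G n := ⟨diagonal fun l => 1 + if l = k then 1 else 0,
    diagonal fun l => (1 + if l = k then 1 else 0)⁻¹,
    by simp [diagonal_mul_diagonal, mul_inv_cancel₀ (hne _)],
    by simp [diagonal_mul_diagonal, inv_mul_cancel₀ (hne _)]⟩
  have ht : t ∈ T₀ n := mem_T₀_iff.2 fun _ _ hab => Matrix.diagonal_apply_ne _ hab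
  have h1 := (Subgroup.mem_normalizer_iff.1 (mem_𝓥_iff.1 hv) t).1 ht
  have h2 := mem_T₀_iff.1 h1 a b hab
  have h3 : (t : 𝔤 n) = 1 + single k k 1 := by
    ext r s
    simp only [t, Matrix.diagonal_apply, Matrix.add_apply, Matrix.one_apply, Matrix.single_apply]
    by_cases hrs : r = s
    · subst hrs; simp [eq_comm]
    · have : ¬ (k = r ∧ k = s) := by rintro ⟨rfl, rfl⟩; exact hrs rfl
      simp [hrs, this]
  rw [Units.val_mul, Units.val_mul, h3, Matrix.mul_add, Matrix.mul_one, Matrix.add_mul,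
    ← Units.val_mul, mul_inv_cancel, Units.val_one, Matrix.add_apply, Matrix.one_apply_ne hab,
    zero_add, cConj_inv, Matrix.mul_apply, Finset.sum_eq_single k, Matrix.mul_single_apply_same,
    mul_one] at h2
  · exact h2
  · intro l _ hl
    rw [Matrix.mul_single_apply_of_ne _ _ _ _ _ hl, zero_mul]
  · exact fun h => absurd (Finset.mem_univ _) h

/-- For a representative `v` of type `(i, j)`, the element `v⁻¹ c v` is a monomial matrix for the
transposition `(i j)`. -/
theorem cConj_monomial (hz : z.val + 1 = n) {i j : Fin n} (hij : i < j) {v : G n}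
    (hv : v ∈ 𝓥 n) (ht : HasType z i j v) : ∃ d : Fin n → ℂ,
      (∀ a b, (cConj v : 𝔤 n) a b = if b = Equiv.swap i j a then d a else 0) ∧
      (∀ a, d a * d (Equiv.swap i j a) = 1) ∧ ∀ a, a ≠ i → a ≠ j → d a = 1 := by
  have hu := cConj_apply hz v
  have hu0 := fun a b hab k => cConj_mul_eq_zero hv (a := a) (b := b) hab k
  set φ : Fin n → ℂ := fun l => (v : 𝔤 n) z l
  set ψ : Fin n → ℂ := fun l => ((v⁻¹ : G n) : 𝔤 n) l z
  have hu : ∀ a b, (cConj v : 𝔤 n) a b = (if a = b then 1 else 0) - 2 * ψ a * φ b := hu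
  have hφ : φ i ≠ 0 := ht.row_ne
  have hψ : ψ j ≠ 0 := ht.col_ne
  -- This entry is -2ψ_jφ_i. Being nonzero, it kills the rest of row i and of column j.
  have hji : (cConj v : 𝔤 n) j i ≠ 0 := by
    rw [hu, if_neg hij.ne', zero_sub]
    exact neg_ne_zero.2 (mul_ne_zero (mul_ne_zero two_ne_zero hψ) hφ)
  have hrow : ∀ b, b ≠ j → (cConj v : 𝔤 n) i b = 0 := fun b hb =>
    (mul_eq_zero.1 (hu0 j b hb.symm i)).resolve_left hji
  have hcol : ∀ a, a ≠ i → (cConj v : 𝔤 n) a j = 0 := fun a ha =>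
    (mul_eq_zero.1 (hu0 a i ha j)).resolve_right hji
  -- The diagonal entries at i and j vanish; hence no factor here is zero, and φ and ψ are supported
  -- on {i, j}.
  have hii : 2 * ψ i * φ i = 1 := by
    have := hrow i hij.ne
    rw [hu, if_pos rfl] at this
    linear_combination -this
  have hjj : 2 * ψ j * φ j = 1 := by
    have := hcol j hij.ne'
    rw [hu, if_pos rfl] at this
    linear_combination -this
  have hψi : ψ i ≠ 0 := fun h => by simp [h] at hii
  have hφj : φ j ≠ 0 := fun h => by simp [h] at hjj
  have hφ0 : ∀ b, b ≠ i → b ≠ j → φ b = 0 := by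
    intro b hbi hbj
    have := hrow b hbj
    rw [hu, if_neg hbi.symm, zero_sub, neg_eq_zero] at this
    exact (mul_eq_zero.1 this).resolve_left (mul_ne_zero two_ne_zero hψi)
  have hψ0 : ∀ b, b ≠ i → b ≠ j → ψ b = 0 := by
    intro b hbi hbj
    have := hcol b hbi
    rw [hu, if_neg hbj, zero_sub, neg_eq_zero] at this
    simpa using (mul_eq_zero.1 this).resolve_right hφj
  refine ⟨fun a => (cConj v : 𝔤 n) a (Equiv.swap i j a), fun a b => ?_, fun a => ?_, fun a hai haj => ?_⟩
  · split_ifs with hb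
    · rw [hb]
    · by_cases hai : a = i
      · subst hai
        rw [Equiv.swap_apply_left] at hb
        exact hrow b hb
      · by_cases haj : a = j
        · subst haj
          rw [Equiv.swap_apply_right] at hb
          by_cases hba : b = a
          · rw [hba]; exact hcol a hai
          · rw [hu, hφ0 b hb hba, if_neg (Ne.symm hba)]; simp
        · rw [Equiv.swap_apply_of_ne_of_ne hai haj] at hb
          rw [hu, hψ0 a hai haj, if_neg (Ne.symm hb)]; simp
  · by_cases hai : a = i
    · subst hai
      simp only [Equiv.swap_apply_left, Equiv.swap_apply_right, hu, if_neg hij.ne, if_neg hij.ne']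
      linear_combination (2 * ψ j * φ j) * hii + hjj
    · by_cases haj : a = j
      · subst haj
        simp only [Equiv.swap_apply_left, Equiv.swap_apply_right, hu, if_neg hij.ne, if_neg hij.ne']
        linear_combination (2 * ψ i * φ i) * hjj + hii
      · simp [Equiv.swap_apply_of_ne_of_ne hai haj, hu, hψ0 a hai haj]
  · simp [Equiv.swap_apply_of_ne_of_ne hai haj, hu, hψ0 a hai haj]

theorem mul_permG_mem_T₀ {u : G n} {σ : Equiv.Perm (Fin n)}
    (hu : ∀ a b, b ≠ σ a → (u : 𝔤 n) a b = 0) : u * permG σ ∈ T₀ n := by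
  refine mem_T₀_iff.2 fun a b hab => ?_
  rw [Units.val_mul, mul_permG_apply]
  exact hu _ _ fun h => hab (σ.injective h).symm

theorem springer_eq {v : G n} (hv : v ∈ 𝓥 n) {i j : Fin n}
    (hu : ∀ a b, b ≠ Equiv.swap i j a → (cConj v : 𝔤 n) a b = 0) :
    springer v hv = weyl (Equiv.swap i j) := by
  rw [springer, weyl, QuotientGroup.eq, Subgroup.mem_subgroupOf]
  change (τ v)⁻¹ * permG (Equiv.swap i j) ∈ T₀ n
  rw [τ_eq, _root_.mul_inv_rev, cConj_inv, mul_assoc]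
  exact mul_mem (inv_mem (c_mem_T₀ n)) (mul_permG_mem_T₀ hu)

theorem θᵥ_apply {σ : Equiv.Perm (Fin n)} (hσ : ∀ a, σ (σ a) = a) {v : G n} {d : Fin n → ℂ}
    (hd : ∀ a b, (cConj v : 𝔤 n) a b = if b = σ a then d a else 0) (x : 𝔤 n) (a b : Fin n) :
    θᵥ v x a b = d a * d (σ b) * x (σ a) (σ b) := by
  rw [θᵥ_eq, Ad_apply, cConj_inv, Matrix.mul_apply, Finset.sum_eq_single (σ b), Matrix.mul_apply,
    Finset.sum_eq_single (σ a), hd, hd, if_pos rfl, if_pos (hσ b).symm]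
  · ring
  · intro l _ hl
    rw [hd, if_neg hl, zero_mul]
  · exact fun h => absurd (Finset.mem_univ _) h
  · intro l _ hl
    rw [hd l b, if_neg (fun h => hl (by rw [h, hσ])), mul_zero]
  · exact fun h => absurd (Finset.mem_univ _) h

theorem mapsRoot_iff {σ : Equiv.Perm (Fin n)} (hσ : ∀ a, σ (σ a) = a) {v : G n} {d : Fin n → ℂ}
    (hd : ∀ a b, (cConj v : 𝔤 n) a b = if b = σ a then d a else 0)
    (hd1 : ∀ a, d a * d (σ a) = 1) {a b : Fin n} (hab : a ≠ b) (r : Fin n × Fin n) :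
    MapsRoot (θᵥ v) (a, b) r ↔ r = (σ a, σ b) := by
  have hdiag : ∀ (t : 𝔤 n) (l : Fin n), θᵥ v t l l = t (σ l) (σ l) := fun t l => by
    rw [θᵥ_apply hσ hd, hd1, one_mul]
  constructor
  · intro h
    obtain ⟨p, q⟩ := r
    -- Evaluation on the diagonal matrix units compares the coefficients of the two weights.
    have h1 : ∀ k : Fin n, (if k = σ p then 1 else 0 : ℂ) - (if k = σ q then 1 else 0) =
        (if k = a then 1 else 0) - (if k = b then 1 else 0) := by
      intro k
      have := (h (diagonal fun l => if k = l then 1 else 0) (Matrix.isDiag_diagonal _)).2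
      simpa only [rootVal, hdiag, Matrix.diagonal_apply_eq] using this
    have ha := h1 a
    have hb := h1 b
    rw [if_pos rfl, if_neg hab] at ha
    rw [if_pos rfl, if_neg hab.symm] at hb
    have h2 : a = σ p := by
      by_contra hne
      rw [if_neg hne] at ha
      split_ifs at ha <;> norm_num at ha
    have h3 : b = σ q := by
      by_contra hne
      rw [if_neg hne] at hb
      split_ifs at hb <;> norm_num at hb
    rw [h2, h3, hσ, hσ]
  · rintro rfl t ht
    refine ⟨fun k l hkl => ?_, ?_⟩
    · change θᵥ v t k l = 0
      rw [θᵥ_apply hσ hd, ht (fun h => hkl (σ.injective h)), mul_zero]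
    · simp only [rootVal, hdiag, hσ]

theorem isPositive_iff {a b : Fin n} : IsPositive (a, b) ↔ a ≤ b := by
  constructor
  · intro h
    by_contra hlt
    have := h (i := a) (j := b) (not_le.1 hlt)
    simp [rootVec] at this
  · intro h k l hkl
    refine Matrix.single_apply_of_ne _ _ _ _ _ ?_
    rintro ⟨h1, h2⟩
    have : (l : Fin n) < k := hkl
    rw [← h1, ← h2] at this
    exact this.not_ge h

theorem isComplexStable_iff {σ : Equiv.Perm (Fin n)} (hσ : ∀ a, σ (σ a) = a) {v : G n}
    {d : Fin n → ℂ} (hd : ∀ a b, (cConj v : 𝔤 n) a b = if b = σ a then d a else 0)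
    (hd1 : ∀ a, d a * d (σ a) = 1) {a b : Fin n} (hab : a < b) :
    IsComplexStable (θᵥ v) (a, b) ↔ ¬ (b = σ a ∧ a = σ b) ∧ ¬ (a = σ a ∧ b = σ b) ∧ σ a ≤ σ b := by
  rw [IsComplexStable, IsRealRoot, IsImaginary, mapsRoot_iff hσ hd hd1 hab.ne,
    mapsRoot_iff hσ hd hd1 hab.ne, isPositive_iff, Prod.swap_prod_mk, Prod.mk.injEq, Prod.mk.injEq]
  refine and_congr_right fun _ => and_congr_right fun _ => ?_
  constructor
  · rintro ⟨-, s, -, hs, hpos⟩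
    rw [mapsRoot_iff hσ hd hd1 hab.ne] at hs
    rw [hs] at hpos
    exact isPositive_iff.1 hpos
  · exact fun h => ⟨hab.le, (σ a, σ b), fun h => hab.ne (σ.injective h),
      (mapsRoot_iff hσ hd hd1 hab.ne _).2 rfl, isPositive_iff.2 h⟩

/-- A consecutive pair disjoint from {i, j} is fixed. If a = i or b = j the transposition reverses
the order of the pair; if b = i or a = j it moves the indices further apart in the same order. -/
theorem complexStable_simple_iff {i j a b : Fin n} (hij : i < j) (hab : (a : ℕ) + 1 = b) :
    (¬ (b = Equiv.swap i j a ∧ a = Equiv.swap i j b) ∧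
      ¬ (a = Equiv.swap i j a ∧ b = Equiv.swap i j b) ∧ Equiv.swap i j a ≤ Equiv.swap i j b) ↔
      b = i ∨ a = j := by
  rw [Equiv.swap_apply_def, Equiv.swap_apply_def]
  split_ifs <;> simp only [Fin.ext_iff, Fin.lt_def, Fin.le_def, and_self, not_true_eq_false,
    false_and, and_false, false_iff, not_or] at * <;> omega

/-- Both indices of an imaginary root are fixed by (i j). There the monomial matrix has entries 1,
so the root vector is fixed by θ_v and not negated. -/
theorem not_isNoncompactImaginary {i j : Fin n} (hij : i < j) {v : G n} {d : Fin n → ℂ}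
    (hd : ∀ a b, (cConj v : 𝔤 n) a b = if b = Equiv.swap i j a then d a else 0)
    (hd1 : ∀ a, d a * d (Equiv.swap i j a) = 1) (hd2 : ∀ a, a ≠ i → a ≠ j → d a = 1)
    {a b : Fin n} (hab : a ≠ b) : ¬ IsNoncompactImaginary (θᵥ v) (a, b) := by
  have hσ := Equiv.swap_apply_self i j
  rintro ⟨him, hneg⟩
  rw [IsImaginary, mapsRoot_iff hσ hd hd1 hab, Prod.mk.injEq] at him
  have hfix : ∀ {x : Fin n}, x = Equiv.swap i j x → x ≠ i ∧ x ≠ j := by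
    intro x hx
    constructor
    · rintro rfl
      rw [Equiv.swap_apply_left] at hx
      exact hij.ne hx
    · rintro rfl
      rw [Equiv.swap_apply_right] at hx
      exact hij.ne' hx
  have h := congrFun (congrFun hneg a) b
  rw [θᵥ_apply hσ hd, ← him.1, ← him.2, hd2 a (hfix him.1).1 (hfix him.1).2,
    hd2 b (hfix him.2).1 (hfix him.2).2] at h
  simp [rootVec] at h
  norm_num [eq_neg_iff_add_eq_zero] at h

end Springer

/-! ### The explicit representatives -/

section Representatives

variable {n : ℕ} {z : Fin n}

theorem mul_single_add_single {M : 𝔤 n} {p q : Fin n} (s t : ℂ) (r : Fin n) :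
    (M *ᵥ fun l => (if l = p then s else 0) + (if l = q then t else 0)) r =
      M r p * s + M r q * t := by
  simp [Matrix.mulVec, dotProduct, mul_add, Finset.sum_add_distrib]

theorem inv_sqrt_two_mul_self : ((Real.sqrt 2 : ℝ) : ℂ)⁻¹ * ((Real.sqrt 2 : ℝ) : ℂ)⁻¹ = 1 / 2 := by
  rw [← mul_inv, ← Complex.ofReal_mul, Real.mul_self_sqrt zero_le_two]
  norm_num

theorem cayleyMatrix_apply {p q : Fin n} (hpq : (p : ℕ) + 1 = q) (a b : Fin n) :
    cayleyMatrix n p a b = if a = p ∨ a = q then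
      (if b = p ∨ b = q then ((Real.sqrt 2 : ℝ) : ℂ)⁻¹ * (if a = b then 1 else Complex.I) else 0)
      else if a = b then 1 else 0 := by
  have h : ∀ a : Fin n, (a.val = p ∨ a.val = p + 1) ↔ (a = p ∨ a = q) := fun a => by
    rw [Fin.ext_iff, Fin.ext_iff, hpq]
  simp only [cayleyMatrix, Matrix.of_apply, h]
  by_cases ha : a = p ∨ a = q
  · by_cases hb : b = p ∨ b = q
    · simp [ha, hb]
    · have : a ≠ b := by rintro rfl; exact hb ha
      simp [ha, hb, this]
  · simp [ha]

theorem isUnit_cayleyMatrix {p q : Fin n} (hpq : (p : ℕ) + 1 = q) : IsUnit (cayleyMatrix n p) := by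
  have hne : p ≠ q := by rintro rfl; omega
  have hs := inv_sqrt_two_mul_self
  set s := ((Real.sqrt 2 : ℝ) : ℂ)⁻¹ with hsdef
  have hs0 : s ≠ 0 := fun h => by rw [h] at hs; norm_num at hs
  rw [← Matrix.mulVec_injective_iff_isUnit]
  intro x y hxy
  rw [← sub_eq_zero] at hxy ⊢
  rw [← Matrix.mulVec_sub] at hxy
  generalize x - y = w at hxy
  have hsum : ∀ (α β : ℂ), ∑ b, (if b = p then α * w b else if b = q then β * w b else 0) =
      α * w p + β * w q := by
    intro α β
    rw [← Finset.add_sum_erase _ _ (Finset.mem_univ p), if_pos rfl, add_right_inj,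
      Finset.sum_eq_single q]
    · rw [if_neg hne.symm, if_pos rfl]
    · intro b hb hbq
      rw [if_neg (Finset.ne_of_mem_erase hb), if_neg hbq]
    · intro h
      exact absurd (Finset.mem_erase.2 ⟨hne.symm, Finset.mem_univ _⟩) h
  have hp : s * w p + s * Complex.I * w q = 0 := by
    refine (hsum _ _).symm.trans (Eq.trans ?_ (congrFun hxy p))
    rw [Matrix.mulVec, dotProduct]
    refine Finset.sum_congr rfl fun b _ => ?_
    rw [cayleyMatrix_apply hpq]
    by_cases hb : b = p
    · simp [hb, hsdef]
    · by_cases hb' : b = q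
      · simp [hb', hne, hne.symm, hsdef]
      · simp [hb, hb']
  have hq : s * Complex.I * w p + s * w q = 0 := by
    refine (hsum _ _).symm.trans (Eq.trans ?_ (congrFun hxy q))
    rw [Matrix.mulVec, dotProduct]
    refine Finset.sum_congr rfl fun b _ => ?_
    rw [cayleyMatrix_apply hpq]
    by_cases hb : b = p
    · simp [hb, hne.symm, hsdef]
    · by_cases hb' : b = q
      · simp [hb', hne.symm, hsdef]
      · simp [hb, hb']
  have hwp : w p = 0 := by
    have : s * 2 * w p = 0 := by
      linear_combination hp - Complex.I * hq + (s * w p) * Complex.I_mul_I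
    exact (mul_eq_zero.1 this).resolve_left (mul_ne_zero hs0 two_ne_zero)
  have hwq : w q = 0 := by
    rw [hwp, mul_zero, zero_add] at hq
    exact (mul_eq_zero.1 hq).resolve_left hs0
  ext a
  by_cases ha : a = p
  · rw [ha, hwp]; rfl
  · by_cases ha' : a = q
    · rw [ha', hwq]; rfl
    · rw [← congrFun hxy a, Matrix.mulVec, dotProduct]
      simp [cayleyMatrix_apply hpq, ha, ha']

/-- Only φ and ψ need to be followed. After the Cayley transform they are (ε_i + ı ε_{i+1})/√2 and
(e_i - ı e_{i+1})/√2, and every further simple reflection moves the second index one place to the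
right. -/
theorem exists_partial_rep (hz : z.val + 1 = n) (i : Fin n) (d : ℕ) :
    ∀ q : Fin n, (i : ℕ) + 1 + d = q → ∃ v : G n,
      (v : 𝔤 n) = cycleMatrix i * cayleyMatrix n i *
        ((List.range' (i + 1) d).map (simpleMatrix n)).prod ∧
      (∀ l, (v : 𝔤 n) z l = (if l = i then ((Real.sqrt 2 : ℝ) : ℂ)⁻¹ else 0) +
        (if l = q then ((Real.sqrt 2 : ℝ) : ℂ)⁻¹ * Complex.I else 0)) ∧
      ∀ l, ((v⁻¹ : G n) : 𝔤 n) l z = (if l = i then ((Real.sqrt 2 : ℝ) : ℂ)⁻¹ else 0) +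
        (if l = q then -(((Real.sqrt 2 : ℝ) : ℂ)⁻¹ * Complex.I) else 0) := by
  induction d with
  | zero =>
    intro q hq
    have hq : (i : ℕ) + 1 = q := hq
    have hne : i ≠ q := by rintro rfl; omega
    obtain ⟨g, hg, hgn⟩ := exists_G_flagC hz i
    have hcyc : cycleMatrix i = (g : 𝔤 n) := by
      ext r k
      rw [← hg]
      rfl
    let u := (isUnit_cayleyMatrix hq).unit
    have hu : (u : 𝔤 n) = cayleyMatrix n i := rfl
    have hs := inv_sqrt_two_mul_self
    refine ⟨g * u, by simp [hcyc, hu], fun l => ?_, fun l => col_inv_eq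
      (v := fun l => (if l = i then ((Real.sqrt 2 : ℝ) : ℂ)⁻¹ else 0) +
        (if l = q then -(((Real.sqrt 2 : ℝ) : ℂ)⁻¹ * Complex.I) else 0)) (fun r => ?_) l⟩
    · rw [Units.val_mul, Matrix.mul_apply, Finset.sum_eq_single i, hgn.row, if_pos rfl, one_mul, hu,
        cayleyMatrix_apply hq]
      · by_cases h1 : l = i
        · simp [h1, hne]
        · by_cases h2 : l = q
          · simp [h2, hne, hne.symm]
          · simp [h1, h2]
      · intro c _ hc
        rw [hgn.row, if_neg hc, zero_mul]
      · exact fun h => absurd (Finset.mem_univ _) h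
    · rw [Units.val_mul, ← Matrix.mulVec_mulVec]
      have h1 : ((u : 𝔤 n) *ᵥ fun l => (if l = i then ((Real.sqrt 2 : ℝ) : ℂ)⁻¹ else 0) +
          (if l = q then -(((Real.sqrt 2 : ℝ) : ℂ)⁻¹ * Complex.I) else 0)) =
          fun l => ((g⁻¹ : G n) : 𝔤 n) l z := by
        ext l
        rw [mul_single_add_single, hu, cayleyMatrix_apply hq, cayleyMatrix_apply hq, hgn.col]
        by_cases h1 : l = i
        · simp only [h1, true_or, or_true, if_true, if_neg hne, ne_eq, not_true_eq_false, and_false,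
            if_false]
          linear_combination 2 * hs -
            (((Real.sqrt 2 : ℝ) : ℂ)⁻¹ * ((Real.sqrt 2 : ℝ) : ℂ)⁻¹) * Complex.I_mul_I
        · by_cases h2 : l = q
          · simp only [h2, true_or, or_true, if_true, if_neg hne.symm, ne_eq, not_true_eq_false,
              and_false, if_false]
            ring
          · simp [h1, h2]
      rw [h1]
      change ((g : 𝔤 n) * ((g⁻¹ : G n) : 𝔤 n)) r z = _
      rw [← Units.val_mul, mul_inv_cancel, Units.val_one, Matrix.one_apply]
  | succ d ih =>
    intro q hq
    have hlt : (i : ℕ) + 1 + d < n := by have := q.2; omega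
    obtain ⟨v, hv, hrow, hcol⟩ := ih ⟨i + 1 + d, hlt⟩ rfl
    set p : Fin n := ⟨i + 1 + d, hlt⟩ with hp
    have hsimple : simpleMatrix n (i + 1 + d) = (permG (Equiv.swap p q) : 𝔤 n) := by
      have : (⟨i + 1 + d + 1, by have := q.2; omega⟩ : Fin n) = q := Fin.ext (by simp; omega)
      rw [simpleMatrix, dif_pos (by have := q.2; omega), this]
      change _ = (Equiv.swap p q)⁻¹.permMatrix ℂ
      rw [Equiv.swap_inv]
    have hip : i ≠ p := by rw [Ne, Fin.ext_iff]; simp [hp]; omega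
    have hiq : i ≠ q := by rw [Ne, Fin.ext_iff]; omega
    have hswap : ∀ l, (Equiv.swap p q l = i ↔ l = i) ∧ (Equiv.swap p q l = p ↔ l = q) := by
      intro l
      rw [Equiv.swap_apply_eq_iff, Equiv.swap_apply_eq_iff, Equiv.swap_apply_left,
        Equiv.swap_apply_of_ne_of_ne hip hiq]
      exact ⟨Iff.rfl, Iff.rfl⟩
    refine ⟨v * permG (Equiv.swap p q), ?_, fun l => ?_, fun l => ?_⟩
    · rw [Units.val_mul, hv, List.range'_concat, List.map_append, List.prod_append, one_mul,
        List.map_singleton, List.prod_singleton, hsimple]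
      exact Matrix.mul_assoc _ _ _
    · rw [Units.val_mul, mul_permG_apply, hrow]
      simp only [hswap]
    · rw [_root_.mul_inv_rev, Units.val_mul, permG_inv_mul_apply, hcol]
      simp only [hswap]

/-- For these φ and ψ the products 2ψ_iφ_i and 2ψ_jφ_j are both 1. So 1 - 2ψφ has zero diagonal at i
and j and is monomial for (i j). -/
theorem exists_rep (hz : z.val + 1 = n) {i j : Fin n} (hij : i < j) :
    ∃ v : G n, (v : 𝔤 n) = repMatrix i j ∧ IsRep v (QO i j) := by
  have hij0 : (i : ℕ) < j := hij
  obtain ⟨v, hv, hrow, hcol⟩ := exists_partial_rep hz i (j - 1 - i) j (by omega)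
  have hs := inv_sqrt_two_mul_self
  set s := ((Real.sqrt 2 : ℝ) : ℂ)⁻¹ with hsdef
  have hs0 : s ≠ 0 := fun h => by rw [h] at hs; norm_num at hs
  have ht : HasType z i j v := by
    refine hasType_of_ne (fun l hl => ?_) ?_ (fun l hl => ?_) ?_
    · rw [hrow, if_neg (by rintro rfl; omega), if_neg (by rintro rfl; omega), add_zero]
    · rw [hrow, if_pos rfl, if_neg hij.ne, add_zero]; exact hs0
    · rw [hcol, if_neg (by rintro rfl; omega), if_neg (by rintro rfl; omega), add_zero]
    · rw [hcol, if_pos rfl, if_neg hij.ne', zero_add]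
      exact neg_ne_zero.2 (mul_ne_zero hs0 Complex.I_ne_zero)
  refine ⟨v, hv, mem_𝓥_iff.2 ?_, by rw [QO_eq hz hij, orbit_eq_typeSet hz hij.le ht]⟩
  have hu : cConj v * permG (Equiv.swap i j) ∈ T₀ n := by
    refine mul_permG_mem_T₀ fun a b hb => ?_
    rw [cConj_apply hz, hrow, hcol]
    by_cases hai : a = i
    · rw [hai, Equiv.swap_apply_left] at hb
      rw [hai]
      by_cases hbi : b = i
      · rw [hbi]
        simp only [if_true, if_neg hij.ne]
        linear_combination -2 * hs
      · simp [hb, hbi, Ne.symm hbi]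
    · by_cases haj : a = j
      · rw [haj, Equiv.swap_apply_right] at hb
        rw [haj]
        by_cases hbj : b = j
        · rw [hbj]
          simp only [if_true, if_neg hij.ne']
          linear_combination -2 * hs + 2 * s * s * Complex.I_mul_I
        · simp [hb, hbj, Ne.symm hbj]
      · rw [Equiv.swap_apply_of_ne_of_ne hai haj] at hb
        simp [hai, haj, Ne.symm hb]
  exact (Subgroup.mul_mem_cancel_right _ (permG_mem_N _)).1 (T₀_le_N n hu)

theorem IsRep.hasType (hz : z.val + 1 = n) {i j : Fin n} (hij : i < j) {v : G n}
    (h : IsRep v (QO i j)) : HasType z i j v := by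
  rw [← flagPt_mem_typeSet hz, ← QO_eq hz hij, h.eq]
  exact ⟨1, one_mem _, by rw [flagPt_val, AdSub_one]⟩

end Representatives

/-! ### The big cell -/

section BigCell

variable {n : ℕ}

/-- Lower triangular with ones on the diagonal. -/
structure IsLowerUnip (w : 𝔤 n) : Prop where
  diag : ∀ a, w a a = 1
  lower : ∀ a b, a < b → w a b = 0

theorem IsLowerUnip.det {w : 𝔤 n} (hw : IsLowerUnip w) : w.det = 1 := by
  rw [Matrix.det_of_isLowerTriangular w fun a b hab => hw.lower a b hab]
  simp [hw.diag]

/-- A lower unipotent matrix as an element of `G`. -/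
def IsLowerUnip.toG {w : 𝔤 n} (hw : IsLowerUnip w) : G n :=
  ⟨w, w.adjugate, by rw [Matrix.mul_adjugate, hw.det, one_smul],
    by rw [Matrix.adjugate_mul, hw.det, one_smul]⟩

theorem IsLowerUnip.inv {w : G n} (hw : IsLowerUnip (w : 𝔤 n)) :
    IsLowerUnip ((w⁻¹ : G n) : 𝔤 n) := by
  have : Invertible (w : 𝔤 n) := w.invertible
  have h1 : (w : 𝔤 n).BlockTriangular OrderDual.toDual := fun a b hab => hw.lower a b hab
  have h2 : ∀ a b, a < b → ((w⁻¹ : G n) : 𝔤 n) a b = 0 := by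
    rw [Matrix.coe_units_inv]
    exact fun a b hab => Matrix.blockTriangular_inv_of_blockTriangular h1 hab
  refine ⟨fun a => ?_, h2⟩
  have h3 : ((w : 𝔤 n) * ((w⁻¹ : G n) : 𝔤 n)) a a = 1 := by
    rw [← Units.val_mul, mul_inv_cancel, Units.val_one, Matrix.one_apply_eq]
  rw [Matrix.mul_apply, Finset.sum_eq_single a, hw.diag, one_mul] at h3
  · exact h3
  · intro l _ hl
    rcases lt_or_gt_of_ne hl with hl | hl
    · rw [h2 l a hl, mul_zero]
    · rw [hw.lower a l hl, zero_mul]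
  · exact fun h => absurd (Finset.mem_univ _) h

/-- The leading principal submatrix of size `k`. -/
def leading (k : Fin n) (h : 𝔤 n) : Matrix {l // l < k} {l // l < k} ℂ :=
  h.submatrix Subtype.val Subtype.val

/-- The leading principal minor of size `k`, as a polynomial. -/
noncomputable def minorPoly (k : Fin n) : MvPolynomial (Fin n × Fin n) ℂ :=
  ((Matrix.mvPolynomialX (Fin n) (Fin n) ℂ).submatrix
    (Subtype.val : {l // l < k} → Fin n) Subtype.val).det

theorem eval_minorPoly (k : Fin n) (h : G n) :
    MvPolynomial.eval (coG h) (minorPoly k) = (leading k (h : 𝔤 n)).det := by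
  rw [minorPoly, RingHom.map_det]
  congr 1
  ext a b
  simp [coG, leading]

/-- The product of the determinant and of the leading principal minors. -/
noncomputable def cellPoly (n : ℕ) : MvPolynomial (Fin n × Fin n) ℂ :=
  detPoly n * ∏ k : Fin n, minorPoly k

theorem minorPoly_dvd (k : Fin n) : minorPoly k ∣ cellPoly n :=
  (Finset.dvd_prod_of_mem _ (Finset.mem_univ k)).mul_left _

theorem eval_cellPoly_ne_iff (h : G n) : MvPolynomial.eval (coG h) (cellPoly n) ≠ 0 ↔
    ∀ k, (leading k (h : 𝔤 n)).det ≠ 0 := by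
  simp only [cellPoly, map_mul, map_prod, eval_minorPoly, mul_ne_zero_iff, eval_detPoly_ne,
    Finset.prod_ne_zero_iff, Finset.mem_univ, true_imp_iff, ne_eq, not_false_eq_true, true_and]

/-- The lower unipotent factor: for `h` in the big cell, `lowerFactor h * h` is upper
triangular. -/
noncomputable def lowerFactor (h : 𝔤 n) : 𝔤 n := Matrix.of fun a b =>
  if hb : b < a then -∑ l : {l // l < a}, h a l * (leading a h)⁻¹ l ⟨b, hb⟩
  else if b = a then 1 else 0

theorem lowerFactor_isLowerUnip (h : 𝔤 n) : IsLowerUnip (lowerFactor h) :=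
  ⟨fun a => by simp [lowerFactor], fun a b hab => by simp [lowerFactor, hab.not_gt, hab.ne']⟩

/-- By Cramer's rule the only denominators are leading minors, and these divide `cellPoly`. -/
theorem regFun_lowerFactor (a b : Fin n) :
    (fun h : G n => lowerFactor (h : 𝔤 n) a b) ∈ regFun coG (cellPoly n) := by
  by_cases hb : b < a
  · have : (fun h : G n => lowerFactor (h : 𝔤 n) a b) =
        -∑ l : {l // l < a}, (fun h : G n => (h : 𝔤 n) a l) *
          ((fun h : G n => (MvPolynomial.eval (coG h) (minorPoly a))⁻¹) *
            fun h : G n => (leading a (h : 𝔤 n)).adjugate l ⟨b, hb⟩) := by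
      ext h
      simp only [lowerFactor, Matrix.of_apply, dif_pos hb, Pi.neg_apply, Finset.sum_apply,
        Pi.mul_apply, eval_minorPoly, Matrix.inv_def, Ring.inverse_eq_inv', Matrix.smul_apply,
        smul_eq_mul]
    rw [this]
    exact neg_mem (sum_mem fun l _ => mul_mem (regFun_coord (co := coG) (a, (l : Fin n)))
      (mul_mem (regFun_inv (minorPoly_dvd a)) (adjugate_mem
        (M := fun h : G n => leading a (h : 𝔤 n)) _
        (fun c d => regFun_coord (co := coG) ((c : Fin n), (d : Fin n))) l ⟨b, hb⟩)))
  · have : (fun h : G n => lowerFactor (h : 𝔤 n) a b) = fun _ => if b = a then 1 else 0 := by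
      ext h
      simp [lowerFactor, hb]
    rw [this]
    exact regFun_const _

theorem IsLowerUnip.mul_apply {u : 𝔤 n} (hu : IsLowerUnip u) (h : 𝔤 n) (a b : Fin n) :
    (u * h) a b = ∑ l : {l // l < a}, u a l * h l b + h a b := by
  rw [Matrix.mul_apply, ← Finset.sum_filter_add_sum_filter_not _ (fun l => l < a),
    Finset.sum_subtype (p := fun l => l < a) _ (fun l => by simp),
    Finset.sum_eq_single (s := Finset.univ.filter fun l => ¬ l < a) a, hu.diag, one_mul]
  · intro l hl hla
    have hl' := (Finset.mem_filter.1 hl).2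
    rw [hu.lower a l (lt_of_le_of_ne (not_lt.1 hl') hla.symm), zero_mul]
  · exact fun h => absurd (by simp) h

theorem IsLowerUnip.leading_mul {u : 𝔤 n} (hu : IsLowerUnip u) (h : 𝔤 n) (k : Fin n) :
    leading k (u * h) = leading k u * leading k h := by
  ext a m
  change (u * h) a m = ∑ l : {l // l < k}, u a l * h l m
  rw [Matrix.mul_apply, ← Finset.sum_filter_add_sum_filter_not _ (fun l => l < k),
    Finset.sum_subtype (p := fun l => l < k) _ (fun l => by simp),
    Finset.sum_eq_zero (s := Finset.univ.filter fun l => ¬ l < k), add_zero]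
  intro l hl
  have hl' := (Finset.mem_filter.1 hl).2
  rw [hu.lower a l (a.2.trans_le (not_lt.1 hl')), zero_mul]

/-- Row a of the factor solves the linear system with the leading block of size a that cancels the
entries of the product to the left of the diagonal. -/
theorem isUpper_lowerFactor_mul {h : G n} (hD : MvPolynomial.eval (coG h) (cellPoly n) ≠ 0) :
    IsUpper 0 (lowerFactor (h : 𝔤 n) * (h : 𝔤 n)) := by
  intro a b hab
  have hab : b < a := by simpa using hab
  have hdet := (eval_cellPoly_ne_iff h).1 hD a
  have hinv : (leading a (h : 𝔤 n))⁻¹ * leading a (h : 𝔤 n) = 1 :=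
    Matrix.nonsing_inv_mul _ (isUnit_iff_ne_zero.2 hdet)
  have h2 : ∀ l : {l // l < a}, lowerFactor (h : 𝔤 n) a l =
      -∑ m : {l // l < a}, (h : 𝔤 n) a m * (leading a (h : 𝔤 n))⁻¹ m l := fun l => by
    rw [lowerFactor, Matrix.of_apply, dif_pos l.2]
  rw [(lowerFactor_isLowerUnip _).mul_apply]
  simp only [h2, neg_mul, Finset.sum_neg_distrib, Finset.sum_mul]
  rw [Finset.sum_comm]
  have h3 : ∀ m : {l // l < a}, ∑ l : {l // l < a},
      (h : 𝔤 n) a m * (leading a (h : 𝔤 n))⁻¹ m l * (h : 𝔤 n) l b =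
      (h : 𝔤 n) a m * (1 : Matrix {l // l < a} {l // l < a} ℂ) m ⟨b, hab⟩ := by
    intro m
    rw [← hinv, Matrix.mul_apply, Finset.mul_sum]
    exact Finset.sum_congr rfl fun l _ => mul_assoc _ _ _
  simp only [h3]
  simp [Matrix.one_apply]

/-- The leading blocks of uh are products of those of u and h and are invertible triangular, so the
minors of h are nonzero. Each row of u then solves a system with a unique solution. -/
theorem lowerFactor_unique {h : G n} {u : 𝔤 n} (hu : IsLowerUnip u)
    (huh : IsUpper 0 (u * (h : 𝔤 n))) :
    MvPolynomial.eval (coG h) (cellPoly n) ≠ 0 ∧ lowerFactor (h : 𝔤 n) = u := by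
  have hdiag : ∀ a, (u * (h : 𝔤 n)) a a ≠ 0 := by
    have h1 : (u * (h : 𝔤 n)).det ≠ 0 := by
      rw [Matrix.det_mul, hu.det, one_mul]
      exact det_G_ne h
    rw [Matrix.det_of_isUpperTriangular
      (show (u * (h : 𝔤 n)).BlockTriangular id from huh)] at h1
    exact fun a => Finset.prod_ne_zero_iff.1 h1 a (Finset.mem_univ a)
  have hD : ∀ k, (leading k (h : 𝔤 n)).det ≠ 0 := by
    intro k
    have h1 : (leading k (u * (h : 𝔤 n))).det ≠ 0 := by
      rw [Matrix.det_of_isUpperTriangular]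
      · exact Finset.prod_ne_zero_iff.2 fun l _ => hdiag l
      · exact fun a b hab => huh a b (by simpa using hab)
    rw [hu.leading_mul, Matrix.det_mul] at h1
    exact right_ne_zero_of_mul h1
  refine ⟨(eval_cellPoly_ne_iff h).2 hD, ?_⟩
  ext a b
  rcases lt_trichotomy b a with hb | rfl | hb
  · have hinv : leading a (h : 𝔤 n) * (leading a (h : 𝔤 n))⁻¹ = 1 :=
      Matrix.mul_nonsing_inv _ (isUnit_iff_ne_zero.2 (hD a))
    have hrow : ∀ m : {l // l < a}, (h : 𝔤 n) a m =
        -∑ l : {l // l < a}, u a l * (h : 𝔤 n) l m := by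
      intro m
      have h1 := huh a m (by simpa using m.2)
      rw [hu.mul_apply] at h1
      exact eq_neg_of_add_eq_zero_right h1
    rw [lowerFactor, Matrix.of_apply, dif_pos hb]
    simp only [hrow, neg_mul, Finset.sum_neg_distrib, neg_neg, Finset.sum_mul]
    rw [Finset.sum_comm]
    have h3 : ∀ l : {l // l < a}, ∑ m : {l // l < a},
        u a l * (h : 𝔤 n) l m * (leading a (h : 𝔤 n))⁻¹ m ⟨b, hb⟩ =
        u a l * (1 : Matrix {l // l < a} {l // l < a} ℂ) l ⟨b, hb⟩ := by
      intro l
      rw [← hinv, Matrix.mul_apply, Finset.mul_sum]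
      exact Finset.sum_congr rfl fun m _ => mul_assoc _ _ _
    simp only [h3]
    simp [Matrix.one_apply]
  · rw [(lowerFactor_isLowerUnip _).diag, hu.diag]
  · rw [(lowerFactor_isLowerUnip _).lower a b hb, hu.lower a b hb]

/-- A family of lower unipotent elements of a group that maps to `G` parametrizes an open piece of
a set of points in a homogeneous space of the group. -/
theorem isOpenEmbedding_cell {H X ι : Type*} [Group H] [TopologicalSpace X] (ρ : H →* G n)
    (π : H → X) (hπ : ∀ U : Set X, IsOpen U ↔ IsOpen[zar fun h => coG (ρ h)] (π ⁻¹' U))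
    (hπe : ∀ g h, π g = π h ↔ IsUpper 0 ((ρ (g⁻¹ * h) : G n) : 𝔤 n))
    (Q : Set X) (g₀ : H) (hg₀ : π g₀ ∈ Q) (V : Set (Aff ι)) (w : Aff ι → H)
    (idx : ι → Fin n × Fin n)
    (hw : ∀ x, IsLowerUnip (ρ (w x) : 𝔤 n))
    (hpoly : ∀ a b, (fun x => (ρ (w x) : 𝔤 n) a b) ∈ regFun (fun x : ι → ℂ => x) 1)
    (hidx : ∀ x s, (ρ (w x) : 𝔤 n) (idx s).1 (idx s).2 = x s)
    (hmem : ∀ x ∈ V, π (g₀ * (w x)⁻¹) ∈ Q)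
    (hconv : ∀ h : H, π (g₀ * h) ∈ Q → MvPolynomial.eval (coG (ρ h)) (cellPoly n) ≠ 0 →
      ∀ x : ι → ℂ,
      (∀ s, x s = lowerFactor (ρ h : 𝔤 n) (idx s).1 (idx s).2) →
      x ∈ V ∧ (ρ (w x) : 𝔤 n) = lowerFactor (ρ h : 𝔤 n)) :
    ∃ f : V → Q, IsOpenEmbedding f ∧ ⟨π g₀, hg₀⟩ ∈ Set.range f := by
  let r : H → (ι → ℂ) := fun h s => lowerFactor (ρ h : 𝔤 n) (idx s).1 (idx s).2
  have hπmul : ∀ g h b, π g = π h → π (b * g) = π (b * h) := by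
    intro g h b heq
    rw [hπe] at heq ⊢
    rwa [_root_.mul_inv_rev, mul_assoc, inv_mul_cancel_left]
  -- The factor w(x) makes w(x)⁻¹ upper triangular, indeed equal to 1; by uniqueness the coordinates
  -- of w(x)⁻¹ are x.
  have hr : ∀ x, MvPolynomial.eval (coG (ρ (w x)⁻¹)) (cellPoly n) ≠ 0 ∧
      lowerFactor (ρ (w x)⁻¹ : 𝔤 n) = (ρ (w x) : 𝔤 n) := fun x => by
    refine lowerFactor_unique (hw x) ?_
    rw [map_inv, ← Units.val_mul, mul_inv_cancel, Units.val_one]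
    exact Matrix.blockTriangular_one
  have hrw : ∀ x, r (w x)⁻¹ = x := fun x => by
    ext s
    change lowerFactor (ρ (w x)⁻¹ : 𝔤 n) _ _ = _
    rw [(hr x).2, hidx]
  -- The big cell and the coordinates on it descend to the quotient.
  have hinvar : ∀ g h, π g = π h → MvPolynomial.eval (coG (ρ g)) (cellPoly n) ≠ 0 →
      MvPolynomial.eval (coG (ρ h)) (cellPoly n) ≠ 0 ∧
      lowerFactor (ρ h : 𝔤 n) = lowerFactor (ρ g : 𝔤 n) := by
    intro g h heq hD
    refine lowerFactor_unique (lowerFactor_isLowerUnip _) ?_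
    have h1 := (isUpper_lowerFactor_mul hD).mul ((hπe g h).1 heq)
    rwa [Matrix.mul_assoc, ← Units.val_mul, ← map_mul, mul_inv_cancel_left] at h1
  have hcell : ∀ h, π (g₀ * h) ∈ Q → MvPolynomial.eval (coG (ρ h)) (cellPoly n) ≠ 0 →
      r h ∈ V ∧ π (g₀ * (w (r h))⁻¹) = π (g₀ * h) := by
    intro h hQ hD
    obtain ⟨hV, hwr⟩ := hconv h hQ hD (r h) fun _ => rfl
    refine ⟨hV, hπmul _ _ _ ((hπe _ _).2 ?_)⟩
    rw [inv_inv, map_mul, Units.val_mul, hwr]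
    exact isUpper_lowerFactor_mul hD
  have hleft : ∀ b : H, @Continuous _ _ (zar fun h => coG (ρ h)) (zar fun h => coG (ρ h))
      fun h => b * h := fun b =>
    continuous_zar (co := fun h => coG (ρ h)) (co' := fun h => coG (ρ h)) (D := 1) (by simp)
      fun q => by
        simp only [map_mul, coG, Units.val_mul]
        exact matMul_mem (M := fun _ => (ρ b : 𝔤 n)) (M' := fun h : H => (ρ h : 𝔤 n)) _
          (fun _ _ => regFun_const _)
          (fun c d => regFun_coord (co := fun h => coG (ρ h)) (c, d)) q.1 q.2
  have hcont : @Continuous (Aff ι) _ _ (zar fun h => coG (ρ h)) fun x => g₀ * (w x)⁻¹ := by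
    refine @Continuous.comp (Aff ι) H H _ (zar fun h => coG (ρ h)) (zar fun h => coG (ρ h)) _ _
      (hleft g₀) ?_
    refine continuous_zar (co := fun x : ι → ℂ => x) (co' := fun h => coG (ρ h)) (D := 1) (by simp)
      fun q => ?_
    have : (fun x : ι → ℂ => coG (ρ (w x)⁻¹) q) =
        fun x => (ρ (w x) : 𝔤 n).adjugate q.1 q.2 := by
      ext x
      rw [coG, map_inv, Matrix.coe_units_inv, Matrix.inv_def, (hw x).det, Ring.inverse_one, one_smul]
    rw [this]
    exact adjugate_mem _ hpoly q.1 q.2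
  refine ⟨fun x => ⟨π (g₀ * (w x)⁻¹), hmem _ x.2⟩, ?_, ?_⟩
  · refine IsOpenEmbedding.of_continuous_injective_isOpenMap ?_ ?_ ?_
    · refine Continuous.subtype_mk (f := fun x : V => π (g₀ * (w x)⁻¹)) ?_ _
      refine continuous_def.2 fun U hU => ?_
      exact (@Continuous.isOpen_preimage _ _ _ (zar fun h => coG (ρ h)) _ hcont _
        ((hπ U).1 hU)).preimage continuous_subtype_val
    · intro x y hxy
      have h1 : π (g₀ * (w x)⁻¹) = π (g₀ * (w y)⁻¹) := congrArg Subtype.val hxy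
      have h2 := hπmul _ _ g₀⁻¹ h1
      rw [inv_mul_cancel_left, inv_mul_cancel_left] at h2
      have h3 := (hinvar _ _ h2 (hr x).1).2
      rw [(hr x).2, (hr y).2] at h3
      refine Subtype.ext (funext fun s => ?_)
      rw [← hidx x.1 s, ← hidx y.1 s, h3]
    · rintro _ ⟨O, hO, rfl⟩
      -- The points of the translated big cell with coordinates in O. This set is open in X because
      -- the coordinates are regular functions.
      let U : Set X := {p | ∃ h, p = π (g₀ * h) ∧
        MvPolynomial.eval (coG (ρ h)) (cellPoly n) ≠ 0 ∧ r h ∈ O}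
      have hU : IsOpen U := by
        have h1 : IsOpen[zar fun h => coG (ρ h)]
            {h : H | MvPolynomial.eval (coG (ρ h)) (cellPoly n) ≠ 0 ∧ r h ∈ O} := by
          let := zar fun h => coG (ρ h)
          refine isOpen_iff_forall_mem_open.2 fun h hh => ?_
          obtain ⟨p, hp, hp'⟩ := exists_poly_of_isOpen hO hh.2
          refine ⟨_, fun h' hh' => ⟨hh'.1, hp' _ hh'.2⟩, isOpen_regFun_ne (co := fun h => coG (ρ h))
            (D := cellPoly n) (F := fun h => MvPolynomial.eval (r h) p) ?_, hh.1, hp⟩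
          refine regFun_comp (fun s => ?_) p
          obtain ⟨N, P, hP⟩ := regFun_lowerFactor (n := n) (idx s).1 (idx s).2
          exact ⟨N, P, fun h => hP (ρ h)⟩
        rw [hπ]
        convert @Continuous.isOpen_preimage _ _ (zar fun h => coG (ρ h)) (zar fun h => coG (ρ h)) _
          (hleft g₀⁻¹) _ h1 using 1
        ext g
        constructor
        · rintro ⟨h, heq, hD, hh⟩
          have h2 := hπmul _ _ g₀⁻¹ heq
          rw [inv_mul_cancel_left] at h2
          obtain ⟨h3, h4⟩ := hinvar _ _ h2.symm hD
          refine ⟨h3, ?_⟩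
          have : r (g₀⁻¹ * g) = r h := by
            ext s
            change lowerFactor _ _ _ = lowerFactor _ _ _
            rw [h4]
          rw [this]
          exact hh
        · rintro ⟨h3, h4⟩
          exact ⟨g₀⁻¹ * g, by rw [mul_inv_cancel_left], h3, h4⟩
      refine ⟨U, hU, ?_⟩
      ext ⟨p, hp⟩
      constructor
      · rintro ⟨h, rfl, hD, hh⟩
        obtain ⟨h1, h2⟩ := hcell h hp hD
        exact ⟨⟨r h, h1⟩, hh, Subtype.ext h2⟩
      · rintro ⟨x, hx, heq⟩
        refine ⟨(w x)⁻¹, (congrArg Subtype.val heq).symm, (hr x).1, ?_⟩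
        rw [hrw]
        exact hx
  -- The identity lies in the big cell, so the base point is covered.
  · have hD : MvPolynomial.eval (coG (ρ 1)) (cellPoly n) ≠ 0 := by
      refine (lowerFactor_unique (u := 1) ⟨fun a => Matrix.one_apply_eq a,
        fun a b hab => Matrix.one_apply_ne hab.ne⟩ ?_).1
      rw [map_one, Units.val_one, Matrix.one_mul]
      exact Matrix.blockTriangular_one
    obtain ⟨h1, h2⟩ := hcell 1 (by rwa [mul_one]) hD
    exact ⟨⟨r 1, h1⟩, Subtype.ext (h2.trans (by rw [mul_one]))⟩

end BigCell

/-! ### Dimensions -/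

section OrbitDimension

variable {n : ℕ} {z : Fin n}

/-- Extend a family that is indexed by some of the matrix positions by zero. -/
noncomputable def extendZero {p : Fin n × Fin n → Prop} (x : {q // p q} → ℂ) (a b : Fin n) : ℂ :=
  open Classical in if h : p (a, b) then x ⟨(a, b), h⟩ else 0

theorem extendZero_of {p : Fin n × Fin n → Prop} (x : {q // p q} → ℂ) (s : {q // p q}) :
    extendZero x s.1.1 s.1.2 = x s := dif_pos s.2

theorem extendZero_of_not {p : Fin n × Fin n → Prop} (x : {q // p q} → ℂ) {a b : Fin n}
    (h : ¬ p (a, b)) : extendZero x a b = 0 := dif_neg h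

theorem regFun_extendZero {p : Fin n × Fin n → Prop} (a b : Fin n)
    (D : MvPolynomial {q // p q} ℂ) :
    (fun x : {q // p q} → ℂ => extendZero x a b) ∈ regFun (fun x : {q // p q} → ℂ => x) D := by
  by_cases h : p (a, b)
  · convert regFun_coord (co := fun x : {q // p q} → ℂ => x) (D := D) ⟨(a, b), h⟩ using 1
    ext x
    exact extendZero_of x ⟨(a, b), h⟩
  · convert regFun_const (co := fun x : {q // p q} → ℂ => x) (D := D) 0 using 1
    ext x
    exact extendZero_of_not x h

theorem regFun_ite {X σ : Type*} {co : X → σ → ℂ} {D : MvPolynomial σ ℂ} (p : Prop) [Decidable p]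
    {F F' : X → ℂ} (hF : F ∈ regFun co D) (hF' : F' ∈ regFun co D) :
    (fun x => if p then F x else F' x) ∈ regFun co D := by
  split_ifs
  exacts [hF, hF']

/-! #### The flag variety of `K` -/

theorem map_flagPtK (hn : 1 ≤ n) (g h : K n) :
    (flagPtK hn h).map (AdK g) = flagPtK hn (g * h) := by
  refine Subtype.ext (LieSubalgebra.ext _ _ fun y => ?_)
  change y ∈ ((bK n).map (AdK h : 𝔨 n →ₗ⁅ℂ⁆ 𝔨 n)).map (AdK g : 𝔨 n →ₗ⁅ℂ⁆ 𝔨 n) ↔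
    y ∈ (bK n).map (AdK (g * h) : 𝔨 n →ₗ⁅ℂ⁆ 𝔨 n)
  have key : ∀ y, AdK (g * h) y = AdK g (AdK h y) := fun y =>
    Subtype.ext (by rw [AdK_coe, AdK_coe, AdK_coe, Subgroup.coe_mul, Ad_mul])
  simp only [LieSubalgebra.mem_map]
  constructor
  · rintro ⟨_, ⟨v, hv, rfl⟩, rfl⟩
    exact ⟨v, hv, key v⟩
  · rintro ⟨v, hv, rfl⟩
    exact ⟨_, ⟨v, hv, rfl⟩, (key v).symm⟩

theorem isOpen_flagK_iff (hn : 1 ≤ n) {U : Set (𝓑K n)} :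
    IsOpen U ↔ IsOpen[zar fun k : K n => coG (k : G n)] (flagPtK hn ⁻¹' U) := by
  change IsOpen[flagTopology (TopologicalSpace.induced Subtype.val (zariski n)) AdK] U ↔ _
  rw [show zariski n = zar coG from rfl, induced_zar]
  refine (isOpen_iSup_iff (α := BorelSubalgebra (𝔨 n))).trans ?_
  constructor
  · intro h
    have := isOpen_coinduced.1 (h (flagPtK hn 1))
    convert this using 1
    ext g
    have heq := map_flagPtK hn g 1
    rw [mul_one] at heq
    exact Iff.of_eq (congrArg (· ∈ U) heq.symm)
  · intro h x
    obtain ⟨g, rfl⟩ := flagPtK_surjective hn x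
    refine isOpen_coinduced.2 ?_
    have hc : @Continuous _ _ (zar fun k : K n => coG (k : G n)) (zar fun k : K n => coG (k : G n))
        fun k => k * g :=
      continuous_zar (D := 1) (by simp) fun q =>
        matMul_mem (M := fun k : K n => ((k : G n) : 𝔤 n)) (M' := fun _ => ((g : G n) : 𝔤 n)) _
          (fun c d => regFun_coord (co := fun k : K n => coG (k : G n)) (c, d))
          (fun _ _ => regFun_const _) q.1 q.2
    convert @Continuous.isOpen_preimage _ _ (zar fun k : K n => coG (k : G n))
      (zar fun k : K n => coG (k : G n)) _ hc _ h using 1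
    ext g'
    exact Iff.of_eq (congrArg (· ∈ U) (map_flagPtK hn g' g))

/-- The positions below the diagonal in the blocks of `K`. -/
abbrev PosK (z : Fin n) : Type := {q : Fin n × Fin n // q.2 < q.1 ∧ q.1 ≠ z}

/-- The lower unipotent elements of `K`. -/
noncomputable def unipK (x : PosK z → ℂ) : 𝔤 n :=
  Matrix.of fun a b => (if a = b then 1 else 0) + extendZero x a b

theorem unipK_isLowerUnip (x : PosK z → ℂ) : IsLowerUnip (unipK x) :=
  ⟨fun a => by simp [unipK, extendZero_of_not], fun a b hab => by
    rw [unipK, Matrix.of_apply, extendZero_of_not x fun h => hab.not_gt h.1, if_neg hab.ne,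
      add_zero]⟩

theorem unipK_mem (hz : z.val + 1 = n) (x : PosK z → ℂ) : (unipK_isLowerUnip x).toG ∈ K n := by
  rw [mem_K_iff]
  intro a b hab
  change (if a = b then 1 else 0) + extendZero x a b = 0
  rw [if_neg (by rintro rfl; tauto), zero_add]
  refine extendZero_of_not x fun h => ?_
  have h1 : b < a := h.1
  have h2 : (a : ℕ) ≠ z := fun h' => h.2 (Fin.ext h')
  have h3 : (b : ℕ) < a := h1
  omega

theorem topologicalKrullDim_flagK (hz : z.val + 1 = n) :
    topologicalKrullDim (𝓑K n) = (Fintype.card (PosK z) : WithBot ℕ∞) := by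
  have hn : 1 ≤ n := by omega
  have hne : Nonempty (𝓑K n) := ⟨flagPtK hn 1⟩
  rw [← IsHomeomorph.topologicalKrullDim_eq _ (Homeomorph.Set.univ (𝓑K n)).isHomeomorph]
  have : Nonempty (Set.univ : Set (𝓑K n)) := ⟨⟨flagPtK hn 1, trivial⟩⟩
  refine topologicalKrullDim_eq_of_cells (ι := PosK z) Set.univ isOpen_univ trivial ?_
  rintro ⟨x, hx⟩
  obtain ⟨g₀, rfl⟩ := flagPtK_surjective hn x
  refine isOpenEmbedding_cell (K n).subtype (flagPtK hn) (fun U => isOpen_flagK_iff hn)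
    (fun g h => flagPtK_eq_iff hn) Set.univ g₀ hx Set.univ
    (fun x => ⟨_, unipK_mem hz x⟩) Subtype.val (fun x => unipK_isLowerUnip x) ?_ ?_
    (fun _ _ => trivial) ?_
  · intro a b
    exact add_mem (regFun_const _) (regFun_extendZero a b _)
  · intro x s
    change (if s.1.1 = s.1.2 then 1 else 0) + extendZero x s.1.1 s.1.2 = x s
    rw [if_neg s.2.1.ne', zero_add]
    exact extendZero_of x s
  · intro h _ _ x hx
    refine ⟨trivial, ?_⟩
    ext a b
    change (if a = b then 1 else 0) + extendZero x a b = _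
    have hL := lowerFactor_isLowerUnip ((h : G n) : 𝔤 n)
    rcases lt_trichotomy b a with hab | rfl | hab
    · rw [if_neg hab.ne', zero_add]
      by_cases haz : a = z
      -- For h in K the last row of the lower factor vanishes to the left of the diagonal, since
      -- that of h does; the positions in `PosK` thus suffice.
      · subst haz
        rw [extendZero_of_not x fun h => h.2 rfl, Subgroup.subtype_apply, lowerFactor,
          Matrix.of_apply, dif_pos hab, eq_comm, neg_eq_zero]
        refine Finset.sum_eq_zero fun l _ => ?_
        have h1 : ((l : Fin n) : ℕ) < a := l.2
        rw [(mem_K_iff _).1 h.2 a l (by omega), zero_mul]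
      · rw [extendZero_of x ⟨(a, b), hab, haz⟩, hx]
    · rw [if_pos rfl, extendZero_of_not x fun h => h.1.ne rfl, add_zero]
      exact (hL.diag b).symm
    · rw [if_neg hab.ne, extendZero_of_not x fun h => hab.not_gt h.1, add_zero]
      exact (hL.lower a b hab).symm

/-! #### The orbits -/

/-- For fw⁻¹, φ is row i of w⁻¹ and ψ is column i minus column j of w. Row i of w⁻¹ vanishes left of
the diagonal exactly if row i of w does, so all the equations are linear in w; the inequality is ψ_j
≠ 0. -/
theorem IsLowerUnip.hasType_mul_inv_iff {i j : Fin n} (hij : i < j) {f w : G n}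
    (hf : IsNormal z i j f) (hw : IsLowerUnip (w : 𝔤 n)) :
    HasType z i j (f * w⁻¹) ↔ (∀ l, l < i → (w : 𝔤 n) i l = 0) ∧
      (∀ l, j < l → (w : 𝔤 n) l i = (w : 𝔤 n) l j) ∧ (w : 𝔤 n) j i ≠ 1 := by
  have hrow : ∀ l, ((f * w⁻¹ : G n) : 𝔤 n) z l = ((w⁻¹ : G n) : 𝔤 n) i l := fun l => by
    simp [Units.val_mul, Matrix.mul_apply, hf.row]
  have hcol : ∀ l, (((f * w⁻¹)⁻¹ : G n) : 𝔤 n) l z = (w : 𝔤 n) l i - (w : 𝔤 n) l j := fun l => by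
    rw [_root_.mul_inv_rev, inv_inv, Units.val_mul, Matrix.mul_apply]
    simp [hf.col, hij.ne, mul_sub, Finset.sum_sub_distrib]
  have hinv : (∀ l, l < i → ((w⁻¹ : G n) : 𝔤 n) i l = 0) ↔ ∀ l, l < i → (w : 𝔤 n) i l = 0 := by
    have key : ∀ {u : G n}, IsLowerUnip (u : 𝔤 n) → (∀ l, l < i → (u : 𝔤 n) i l = 0) →
        ∀ l, l < i → ((u⁻¹ : G n) : 𝔤 n) i l = 0 := by
      intro u hu h l hl
      have h1 : ((u : 𝔤 n) * ((u⁻¹ : G n) : 𝔤 n)) i l = 0 := by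
        rw [← Units.val_mul, mul_inv_cancel, Units.val_one, Matrix.one_apply_ne hl.ne']
      rw [hu.mul_apply, Finset.sum_eq_zero fun m _ => by rw [h m m.2, zero_mul], zero_add] at h1
      exact h1
    exact ⟨fun h => by simpa using key hw.inv h, key hw⟩
  rw [← hinv]
  constructor
  · intro h
    refine ⟨fun l hl => ?_, fun l hl => ?_, fun h1 => ?_⟩
    · rw [← hrow]
      exact h.row l hl
    · rw [← sub_eq_zero, ← hcol]
      exact h.col l (Nat.succ_le_of_lt hl)
    · refine h.col_ne ?_
      rw [hcol, hw.diag, h1, sub_self]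
  · rintro ⟨h1, h2, h3⟩
    refine hasType_of_ne (fun l hl => ?_) ?_ (fun l hl => ?_) ?_
    · rw [hrow]
      exact h1 l hl
    · rw [hrow, hw.inv.diag]
      exact one_ne_zero
    · rw [hcol, h2 l (Nat.lt_of_succ_le hl), sub_self]
    · rw [hcol, hw.diag]
      exact sub_ne_zero.2 h3

/-- The free positions in the cells of the orbit of type `(i, j)`. -/
abbrev PosO (i j : Fin n) : Type := {q : Fin n × Fin n // q.2 < q.1 ∧ q.1 ≠ i ∧ q.2 ≠ j}

/-- The lower unipotent matrices whose row `i` is a basis vector, and whose columns `i` and `j`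
agree below row `j`. -/
noncomputable def unipO {i j : Fin n} (x : PosO i j → ℂ) : 𝔤 n :=
  Matrix.of fun a b => (if a = b then 1 else 0) +
    if b = j ∧ j < a then extendZero x a i else extendZero x a b

theorem unipO_isLowerUnip {i j : Fin n} (x : PosO i j → ℂ) : IsLowerUnip (unipO x) := by
  refine ⟨fun a => ?_, fun a b hab => ?_⟩
  · rw [unipO, Matrix.of_apply, if_pos rfl, if_neg (by rintro ⟨rfl, h⟩; exact lt_irrefl _ h),
      extendZero_of_not x fun h => h.1.ne rfl, add_zero]
  · rw [unipO, Matrix.of_apply, if_neg hab.ne,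
      if_neg (by rintro ⟨rfl, h⟩; exact lt_asymm h hab),
      extendZero_of_not x fun h => hab.not_gt h.1, add_zero]

theorem unipO_apply {i j : Fin n} (x : PosO i j → ℂ) (s : PosO i j) :
    unipO x s.1.1 s.1.2 = x s := by
  rw [unipO, Matrix.of_apply, if_neg s.2.1.ne', if_neg fun h => s.2.2.2 h.1, zero_add,
    extendZero_of]

theorem unipO_row {i j : Fin n} (hij : i < j) (x : PosO i j → ℂ) (l : Fin n) (hl : l < i) :
    unipO x i l = 0 := by
  rw [unipO, Matrix.of_apply, if_neg hl.ne', if_neg fun h => hij.not_gt h.2, zero_add,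
    extendZero_of_not x fun h => h.2.1 rfl]

theorem unipO_col {i j : Fin n} (hij : i < j) (x : PosO i j → ℂ) (l : Fin n) (hl : j < l) :
    unipO x l i = unipO x l j := by
  rw [unipO, Matrix.of_apply, Matrix.of_apply, if_neg (hij.trans hl).ne', if_neg hl.ne',
    if_neg fun h => hij.ne h.1, if_pos ⟨rfl, hl⟩]

/-- Translation by K and B reduces every base point to the normal form f, where the orbit in the big
cell is an affine space without the hyperplane w_{ji} = 1. The origin is not on this hyperplane. -/
theorem topologicalKrullDim_typeSet (hz : z.val + 1 = n) {i j : Fin n} (hij : i < j) :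
    topologicalKrullDim (typeSet z i j) = (Fintype.card (PosO i j) : WithBot ℕ∞) := by
  have : Nonempty (typeSet z i j) := (typeSet_nonempty hz hij.le).to_subtype
  let s₀ : PosO i j := ⟨(j, i), hij, hij.ne', hij.ne⟩
  obtain ⟨f, hf⟩ := exists_isNormal hz hij.le
  have hV : IsOpen {x : Aff (PosO i j) | x s₀ ≠ 1} := by
    have key : ∀ x : PosO i j → ℂ,
        MvPolynomial.eval x (MvPolynomial.X s₀ - 1) ≠ 0 ↔ x s₀ ≠ 1 := fun x => by
      rw [map_sub, MvPolynomial.eval_X, map_one, sub_ne_zero]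
    exact isOpen_zar_of_forall fun x hx => ⟨_, (key x).2 hx, fun y hy => (key y).1 hy⟩
  refine topologicalKrullDim_eq_of_cells (ι := PosO i j) _ hV zero_ne_one ?_
  rintro ⟨x, hx⟩
  obtain ⟨g, rfl⟩ := flagPt_surjective x
  obtain ⟨k, hk, b, hb, rfl⟩ :=
    (hf.hasType hij.le).exists_eq_mul hz hij.le ((flagPt_mem_typeSet hz).1 hx)
  obtain ⟨g₀, hg₀⟩ : ∃ g₀, g₀ = k * f := ⟨_, rfl⟩
  have heq : flagPt (k * f * b) = flagPt g₀ := by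
    rw [eq_comm, flagPt_eq_iff, hg₀, inv_mul_cancel_left]
    exact hb
  have htype : ∀ h u : G n, IsUpper 0 (u : 𝔤 n) →
      (flagPt (g₀ * (h * u)) ∈ typeSet z i j ↔ HasType z i j (f * h)) := fun h u hu => by
    rw [flagPt_mem_typeSet hz, hg₀, ← hasType_mul_iff (g := f * h) hz hk hu]
    simp only [mul_assoc]
  have h1 : IsUpper 0 ((1 : G n) : 𝔤 n) := by
    rw [Units.val_one]
    exact Matrix.blockTriangular_one
  revert hx
  rw [heq]
  intro hx
  refine isOpenEmbedding_cell (MonoidHom.id (G n)) flagPt (fun U => isOpen_flag_iff)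
    (fun g h => flagPt_eq_iff) _ g₀ hx _ (fun x => (unipO_isLowerUnip x).toG) Subtype.val
    (fun x => unipO_isLowerUnip x) ?_ ?_ ?_ ?_
  · intro a b
    exact add_mem (regFun_const _)
      (regFun_ite _ (regFun_extendZero a i _) (regFun_extendZero a b _))
  · exact fun x s => unipO_apply x s
  · intro x hx
    rw [← mul_one (unipO_isLowerUnip x).toG⁻¹, htype _ _ h1,
      IsLowerUnip.hasType_mul_inv_iff hij hf (unipO_isLowerUnip x)]
    exact ⟨unipO_row hij x, unipO_col hij x, fun h => hx ((unipO_apply x s₀).symm.trans h)⟩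
  · intro h hh hD x hx
    have hL := lowerFactor_isLowerUnip (h : 𝔤 n)
    have hLh : h = hL.toG⁻¹ * (hL.toG * h) := by rw [inv_mul_cancel_left]
    rw [hLh, htype _ _ (isUpper_lowerFactor_mul hD), IsLowerUnip.hasType_mul_inv_iff hij hf hL] at hh
    obtain ⟨hrow, hcol, hne⟩ := hh
    change ∀ l, l < i → lowerFactor (h : 𝔤 n) i l = 0 at hrow
    change ∀ l, j < l → lowerFactor (h : 𝔤 n) l i = lowerFactor (h : 𝔤 n) l j at hcol
    change ∀ s, x s = lowerFactor (h : 𝔤 n) s.1.1 s.1.2 at hx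
    refine ⟨fun h' => hne ((hx s₀).symm.trans h'), ?_⟩
    change unipO x = lowerFactor (h : 𝔤 n)
    ext a b
    rcases lt_trichotomy b a with hab | rfl | hab
    · by_cases ha : a = i
      · subst ha
        rw [unipO_row hij x b hab, hrow b hab]
      · by_cases hb : b = j
        · subst hb
          rw [← unipO_col hij x a hab, ← hcol a hab]
          exact (unipO_apply x ⟨(a, i), hij.trans hab, ha, hij.ne⟩).trans (hx _)
        · exact (unipO_apply x ⟨(a, b), hab, ha, hb⟩).trans (hx _)
    · rw [(unipO_isLowerUnip x).diag, hL.diag]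
    · rw [(unipO_isLowerUnip x).lower a b hab, hL.lower a b hab]

/-! ### Counting matrix positions. -/

theorem card_pos_left (i : Fin n) :
    (Finset.univ.filter fun q : Fin n × Fin n => q.2 < q.1 ∧ q.1 = i).card = i := by
  rw [← Fin.card_Iio i]
  refine Finset.card_bij' (fun q _ => q.2) (fun b _ => (i, b)) ?_ ?_ ?_ ?_ <;> aesop

theorem card_pos_right (i j : Fin n) (hij : i < j) :
    (Finset.univ.filter fun q : Fin n × Fin n => (q.2 < q.1 ∧ q.1 ≠ i) ∧ q.2 = j).card =
      n - 1 - j := by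
  rw [← Fin.card_Ioi j]
  refine Finset.card_bij' (fun q _ => q.1) (fun a _ => (a, j)) ?_ ?_ ?_ ?_
  · rintro ⟨a, b⟩ h
    obtain ⟨⟨h1, -⟩, h2⟩ := (Finset.mem_filter.1 h).2
    exact Finset.mem_Ioi.2 (h2 ▸ h1)
  · intro a ha
    have ha := Finset.mem_Ioi.1 ha
    exact Finset.mem_filter.2 ⟨Finset.mem_univ _, ⟨ha, (hij.trans ha).ne'⟩, rfl⟩
  · rintro ⟨a, b⟩ h
    exact Prod.ext rfl (Finset.mem_filter.1 h).2.2.symm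
  · exact fun _ _ => rfl

/-- Of all positions below the diagonal, `PosK` omits the n - 1 in the last row. `PosO` omits the i
in row i and the n - 1 - j in column j, which are disjoint as i < j. -/
theorem card_posO_add (hz : z.val + 1 = n) {i j : Fin n} (hij : i < j) :
    Fintype.card (PosO i j) + i = Fintype.card (PosK z) + j := by
  have hK : Fintype.card (PosK z) =
      (Finset.univ.filter fun q : Fin n × Fin n => q.2 < q.1 ∧ q.1 ≠ z).card :=
    Fintype.card_subtype _
  have hO : Fintype.card (PosO i j) = (Finset.univ.filter fun q : Fin n × Fin n =>
      (q.2 < q.1 ∧ q.1 ≠ i) ∧ q.2 ≠ j).card := by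
    rw [Fintype.card_subtype]
    simp only [and_assoc]
  have key : ∀ p q : Fin n × Fin n → Prop, ∀ [DecidablePred p] [DecidablePred q],
      (Finset.univ.filter fun x => p x ∧ q x).card +
        (Finset.univ.filter fun x => p x ∧ ¬ q x).card = (Finset.univ.filter p).card := by
    intro p q _ _
    rw [← Finset.filter_filter, ← Finset.filter_filter, Finset.card_filter_add_card_filter_not]
  have h1 := key (fun q => q.2 < q.1) (fun q => q.1 = z)
  have h2 := key (fun q => q.2 < q.1) (fun q => q.1 = i)
  have h3 := key (fun q => q.2 < q.1 ∧ q.1 ≠ i) (fun q => q.2 = j)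
  rw [card_pos_left] at h1 h2
  rw [card_pos_right i j hij] at h3
  rw [hK, hO]
  simp only [ne_eq] at h3 ⊢
  omega

theorem hasLength_QO (hz : z.val + 1 = n) {i j : Fin n} (hij : i < j) :
    HasLength (QO i j) ((j : ℤ) - i) := by
  refine ⟨Fintype.card (PosO i j), _, ?_, topologicalKrullDim_flagK hz, ?_⟩
  · rw [QO_eq hz hij, topologicalKrullDim_typeSet hz hij]
  · have := card_posO_add hz hij
    omega

end OrbitDimension

end KOrb

/-! ### Translation of the results on types into the theorem. -/

theorem mainTheorem8 (n : ℕ) (hn : 1 ≤ n) :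
    -- the `K`-orbits are the `Q_i` and the `Q_{i,j}`
    (∀ Q : Set (KOrb.𝓑 n), KOrb.IsKOrbit Q ↔
      (∃ i : Fin n, Q = KOrb.QC i) ∨ ∃ i j : Fin n, i < j ∧ Q = KOrb.QO i j) ∧
    -- the closed ones are the `Q_i`
    (∀ Q : Set (KOrb.𝓑 n), KOrb.IsKOrbit Q → (IsClosed Q ↔ ∃ i : Fin n, Q = KOrb.QC i)) ∧
    -- they are all distinct
    (∀ i j : Fin n, KOrb.QC i = KOrb.QC j → i = j) ∧
    (∀ i j i' j' : Fin n, i < j → i' < j' → KOrb.QO i j = KOrb.QO i' j' → i = i' ∧ j = j') ∧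
    (∀ k i j : Fin n, i < j → KOrb.QC k ≠ KOrb.QO i j) ∧
    (∀ i j : Fin n, i < j →
      -- `Q_{i,j} = m(s_{j-1}) ⋯ m(s_i) Q_i`, and `l(Q_{i,j}) = j - i`
      KOrb.QO i j =
        (List.range' (i : ℕ) (j - i)).foldl (fun Q k => KOrb.m k Q) (KOrb.QC i) ∧
      KOrb.HasLength (KOrb.QO i j) ((j : ℤ) - i) ∧
      -- the Springer invariant is the transposition `(i j)`
      KOrb.HasSpringerInvariant (KOrb.QO i j) (KOrb.weyl (Equiv.swap i j)) ∧
      -- the explicit representative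
      (∃ v : KOrb.G n, (v : KOrb.𝔤 n) = KOrb.repMatrix i j ∧ KOrb.IsRep v (KOrb.QO i j)) ∧
      (∀ v : KOrb.G n, KOrb.IsRep v (KOrb.QO i j) →
        -- the associated involution acts on the roots as `(i j)`
        (∀ a b : Fin n, a ≠ b →
          KOrb.MapsRoot (KOrb.θᵥ v) (a, b) (Equiv.swap i j a, Equiv.swap i j b)) ∧
        -- the complex `θ`-stable simple roots are `α_{i-1}` and `α_j`
        (∀ a b : Fin n, (a : ℕ) + 1 = b →
          (KOrb.IsComplexStable (KOrb.θᵥ v) (a, b) ↔ b = i ∨ a = j)) ∧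
        -- there are no non-compact imaginary roots
        (∀ a b : Fin n, a ≠ b → ¬ KOrb.IsNoncompactImaginary (KOrb.θᵥ v) (a, b))) ∧
      -- `m(s_{i-1}) Q_{i,j} = Q_{i-1,j}`
      (∀ i' : Fin n, (i' : ℕ) + 1 = i → KOrb.m (i' : ℕ) (KOrb.QO i j) = KOrb.QO i' j)) ∧
    -- `Q_{1,n}` is the unique open orbit
    (∀ _ : 2 ≤ n, ∀ Q : Set (KOrb.𝓑 n), KOrb.IsKOrbit Q →
      (IsOpen Q ↔ Q = KOrb.QO ⟨0, by omega⟩ ⟨n - 1, by omega⟩)) := by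
  let z : Fin n := ⟨n - 1, by omega⟩
  have hz : z.val + 1 = n := Nat.sub_add_cancel hn
  have hinj : ∀ {i j i' j' : Fin n}, i ≤ j → KOrb.typeSet z i j = KOrb.typeSet z i' j' →
      i = i' ∧ j = j' := fun hij h =>
    (KOrb.typeSet_injective hz hij h).imp Fin.ext Fin.ext
  have horb : ∀ Q : Set (KOrb.𝓑 n), KOrb.IsKOrbit Q →
      (∃ i : Fin n, Q = KOrb.QC i) ∨ ∃ i j : Fin n, i < j ∧ Q = KOrb.QO i j := fun Q hQ => by
    obtain ⟨i, j, hij, rfl⟩ := hQ.exists_typeSet hz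
    rcases hij.eq_or_lt with rfl | hij
    · exact Or.inl ⟨i, (KOrb.QC_eq hz i).symm⟩
    · exact Or.inr ⟨i, j, hij, (KOrb.QO_eq hz hij).symm⟩
  refine ⟨fun Q => ⟨horb Q, ?_⟩, fun Q hQ => ⟨fun hcl => ?_, ?_⟩, fun i j h => ?_,
    fun i j i' j' hij hij' h => ?_, fun k i j hij h => ?_, fun i j hij => ?_, fun h2 Q hQ => ?_⟩
  · rintro (⟨i, rfl⟩ | ⟨i, j, hij, rfl⟩)
    · rw [KOrb.QC_eq hz]
      exact KOrb.isKOrbit_typeSet hz le_rfl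
    · rw [KOrb.QO_eq hz hij]
      exact KOrb.isKOrbit_typeSet hz hij.le
  · refine (horb Q hQ).resolve_right ?_
    rintro ⟨i, j, hij, rfl⟩
    rw [KOrb.QO_eq hz hij] at hcl
    exact KOrb.not_isClosed_typeSet hz hij hcl
  · rintro ⟨i, rfl⟩
    rw [KOrb.QC_eq hz]
    exact KOrb.isClosed_typeSet_diag hz i
  · rw [KOrb.QC_eq hz, KOrb.QC_eq hz] at h
    exact (hinj le_rfl h).1
  · rw [KOrb.QO_eq hz hij, KOrb.QO_eq hz hij'] at h
    exact hinj hij.le h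
  · rw [KOrb.QC_eq hz, KOrb.QO_eq hz hij] at h
    obtain ⟨rfl, rfl⟩ := hinj le_rfl h
    exact lt_irrefl _ hij
  · have hij0 : (i : ℕ) < j := hij
    have hmono : ∀ v : KOrb.G n, KOrb.IsRep v (KOrb.QO i j) → _ := fun v hv =>
      KOrb.cConj_monomial hz hij hv.mem (hv.hasType hz hij)
    obtain ⟨v, hv, hrep⟩ := KOrb.exists_rep hz hij
    refine ⟨?_, KOrb.hasLength_QO hz hij, ⟨⟨v, hrep⟩, fun v hv => ?_⟩, ⟨v, hv, hrep⟩,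
      fun v hv => ?_, fun i' hi' => ?_⟩
    · rw [KOrb.QC_eq hz, KOrb.QO_eq hz hij, KOrb.foldl_m_typeSet hz i _ (by omega),
        Nat.add_sub_cancel' hij0.le]
    · obtain ⟨d, hd, -⟩ := hmono v hv
      exact KOrb.springer_eq hv.mem fun a b hab => (hd a b).trans (if_neg hab)
    · obtain ⟨d, hd, hd1, hd2⟩ := hmono v hv
      have hσ := Equiv.swap_apply_self i j
      refine ⟨fun a b hab => (KOrb.mapsRoot_iff hσ hd hd1 hab _).2 rfl, fun a b hab => ?_,
        fun a b hab => KOrb.not_isNoncompactImaginary hij hd hd1 hd2 hab⟩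
      rw [KOrb.isComplexStable_iff hσ hd hd1 (show (a : ℕ) < b by omega),
        KOrb.complexStable_simple_iff hij hab]
    · have hlt : i' < j := show (i' : ℕ) < j by omega
      rw [KOrb.QO_eq hz hij, KOrb.QO_eq hz hlt, KOrb.m_typeSet_left hz hij hi']
  · rw [KOrb.QO_eq hz (show (⟨0, by omega⟩ : Fin n) < ⟨n - 1, by omega⟩ from
      show 0 < n - 1 by omega)]
    obtain ⟨i, j, hij, rfl⟩ := hQ.exists_typeSet hz
    exact KOrb.isOpen_typeSet_iff hz hij
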